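/- **Setting.** Let $G=(V,E)$ be a finite simple graph with $n$ nodes; $\delta(v)$ is the degree of $v$, $\Delta$ the maximum degree, and $\Delta_i$ the largest size of an independent set contained in a neighborhood $N(v)$, $v\in V$; $H_k=\sum_{j=1}^k 1/j$. The nodes work in synchronous rounds. **Algorithm $\mathcal A_{col}$.** Node $v$ keeps a variable $c\in\{\bot\}\cup\{0,\dots,2^{b}-1\}$, where $b=\lfloor\log_2 n\rfloor+1$, and a Boolean variable $\mathit{final}$. In each round every node broadcasts $(c,\mathit{final})$ to all its neighbors. Let $\mathit{occupied}$ be the set of colors $\neq\bot$ that $v$ receives, and $\mathit{tabu}$ the set of those received together with $\mathit{final}=\mathrm{true}$. Then $v$ does the following. If $c=\bot$ or $c>\delta(v)$, it sets $\mathit{final}:=\mathrm{false}$. Otherwise, if $\mathit{final}$ is true and $c\in\mathit{tabu}$, it sets $\mathit{final}:=\mathrm{false}$; if $\mathit{final}$ is false and $c\notin\mathit{occupied}$, it sets $\mathit{final}:=\mathrm{true}$. If $\mathit{final}$ is now false, $v$ sets $c:=\bot$ with probability $\frac12$ and otherwise sets $c$ to a uniformly random element of $\{0,\dots,\delta(v)\}\setminus\mathit{tabu}$.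 All random choices are independent. A configuration (an assignment of values to the variables of all nodes) is *legitimate* if every node $v$ has $\mathit{final}=\mathrm{true}$ and $c\in\{0,\dots,\delta(v)\}$, and adjacent nodes have different values of $c$. **Theorem.** 1. The messages, and the variables that a node keeps between rounds, take $O(\log n)$ bits ($n\ge 2$). 2. $\mathcal A_{col}$ is a self-stabilizing $(\Delta+1)$-coloring algorithm: in a legitimate configuration the values of $c$ form a proper coloring with colors $0,\dots,\Delta$; if no fault occurs, a legitimate configuration almost surely never changes, and from every initial configuration, legitimate configurations only are reached from some round on, almost surely. 3. It stabilizes in $O(\log n)$ rounds with high probability: for every $a\ge 1$ there is a constant $C$, depending on $a$ only, such that for all $G$ and all initial configurations, with probability at least $1-n^{-a}$ all configurations reached after at least $C\log n$ rounds are legitimate. 4. Suppose that in a legitimate configuration a single fault occurs at a node $v$: either the values of one or both variables of $v$ are corrupted, or all neighbors of $v$ receive in one round the same corrupted message instead of the broadcast of $v$. Let no other fault occur. Then almost surely no node at distance greater than $1$ from $v$ ever changes its state (contamination radius $1$). Let $T$ be the number of rounds until the configuration is legitimate, where the round in which a corrupted message is delivered is counted. Then $T$ is almost surely finite, $$\mathbb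 E[T]\le \frac{1}{\ln 2}\,H_{\Delta_i}+\frac{11}{2}\qquad\text{and}\qquad \operatorname{Var}[T]<7.5 .$$ -/

import Mathlib

open MeasureTheory ProbabilityTheory

universe u

noncomputable section

/-! ### The synchronous network: registers, messages, configurations -/

/-- Colors are the contents of a register of `Nat.size n` bits in a network with `n` nodes.
Every degree, hence every color the algorithm ever chooses, is smaller than `2 ^ Nat.size n`. -/
abbrev Color (n : ℕ) : Type := Fin (2 ^ Nat.size n)

/-- The variables a node keeps from one round to the next: `c` (where `none` is `⊥`)
and `final`. -/
@[ext] structure NodeState (n : ℕ) where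
  c : Option (Color n)
  final : Bool

/-- A message is a pair `(c, final)`. -/
abbrev Message (n : ℕ) : Type := Option (Color n) × Bool

/-- The message a node in state `s` broadcasts at the beginning of a round. -/
def NodeState.broadcast {n : ℕ} (s : NodeState n) : Message n := (s.c, s.final)

theorem NodeState.broadcast_injective {n : ℕ} :
    Function.Injective (NodeState.broadcast (n := n)) := by
  intro s t h
  have h1 := congrArg Prod.fst h
  have h2 := congrArg Prod.snd h
  exact NodeState.ext h1 h2

instance (n : ℕ) : Finite (NodeState n) := Finite.of_injective _ NodeState.broadcast_injective

instance (n : ℕ) : MeasurableSpace (NodeState n) := ⊤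

instance (n : ℕ) : DiscreteMeasurableSpace (NodeState n) := ⟨fun _ => trivial⟩

/-- A configuration assigns a state to every node. -/
abbrev Config (V : Type*) [Fintype V] : Type _ := V → NodeState (Fintype.card V)

section Network

variable {V : Type*} [Fintype V] (G : SimpleGraph V) [DecidableRel G.Adj]

/-! ### One round of the algorithm at a node

Below, `m w` is the message received from node `w` by all neighbors of `w`. -/

/-- The set `occupied`: the colors different from `⊥` received from the neighbors of `v`. -/
def occupied (m : V → Message (Fintype.card V)) (v : V) : Finset (Color (Fintype.card V)) :=
  {x | ∃ w, G.Adj v w ∧ (m w).1 = some x}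

/-- The set `tabu`: the colors different from `⊥` received together with `final = true`
from the neighbors of `v`. -/
def tabu (m : V → Message (Fintype.card V)) (v : V) : Finset (Color (Fintype.card V)) :=
  {x | ∃ w, G.Adj v w ∧ (m w).1 = some x ∧ (m w).2 = true}

/-- The set `{0, 1, …, δ(v)} \ tabu` from which `v` draws a color. -/
def palette (m : V → Message (Fintype.card V)) (v : V) : Finset (Color (Fintype.card V)) :=
  {x | (x : ℕ) ≤ G.degree v ∧ x ∉ tabu G m v}

theorem palette_nonempty (m : V → Message (Fintype.card V)) (v : V) :
    (palette G m v).Nonempty := by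
  by_contra hne
  rw [Finset.not_nonempty_iff_eq_empty] at hne
  have hlt : G.degree v < 2 ^ Nat.size (Fintype.card V) :=
    (G.degree_lt_card_verts v).trans (Nat.lt_size_self _)
  let e : Fin (G.degree v + 1) → Color (Fintype.card V) := fun i => ⟨i, by omega⟩
  have he : Function.Injective e := by
    intro i j h
    exact Fin.ext (congrArg (fun z : Color (Fintype.card V) => (z : ℕ)) h)
  have hsub : Finset.univ.image e ⊆ tabu G m v := by
    intro x hx
    obtain ⟨i, -, rfl⟩ := Finset.mem_image.1 hx
    by_contra hx'
    have : e i ∈ palette G m v := by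
      simp only [palette, Finset.mem_filter, Finset.mem_univ, true_and]
      exact ⟨by simp [e]; omega, hx'⟩
    rw [hne] at this
    simp at this
  have hsub2 : (tabu G m v).image some ⊆ (G.neighborFinset v).image (fun w => (m w).1) := by
    intro y hy
    obtain ⟨x, hx, rfl⟩ := Finset.mem_image.1 hy
    simp only [tabu, Finset.mem_filter, Finset.mem_univ, true_and] at hx
    obtain ⟨w, hw, hc, -⟩ := hx
    exact Finset.mem_image.2 ⟨w, by simpa using hw, hc⟩
  have h1 := Finset.card_le_card hsub
  rw [Finset.card_image_of_injective _ he, Finset.card_univ, Fintype.card_fin] at h1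
  have h2 := (Finset.card_le_card hsub2).trans Finset.card_image_le
  rw [Finset.card_image_of_injective _ (Option.some_injective _),
    SimpleGraph.card_neighborFinset_eq_degree] at h2
  omega

/-- Function `randomColor`: `⊥` if a fair random bit is `1`, and otherwise a uniformly random
element of `{0, 1, …, δ(v)} \ tabu`. -/
def randomColor (m : V → Message (Fintype.card V)) (v : V) :
    PMF (Option (Color (Fintype.card V))) :=
  (PMF.uniformOfFintype Bool).bind fun bit =>
    if bit = true then PMF.pure none
    else (PMF.uniformOfFinset (palette G m v) (palette_nonempty G m v)).map some

/-- The value of `final` of node `v`, in state `s`, after the tests of the round. -/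
def newFinal (m : V → Message (Fintype.card V)) (v : V) (s : NodeState (Fintype.card V)) :
    Bool :=
  match s.c with
  | none => false
  | some x =>
    if G.degree v < (x : ℕ) then false
    else if s.final = true then decide (x ∉ tabu G m v)
    else decide (x ∉ occupied G m v)

/-- The distribution of the state of `v` after a round which it starts in state `s`. -/
def nodeRound (m : V → Message (Fintype.card V)) (v : V) (s : NodeState (Fintype.card V)) :
    PMF (NodeState (Fintype.card V)) :=
  if newFinal G m v s = true then PMF.pure ⟨s.c, true⟩
  else (randomColor G m v).map fun x => ⟨x, false⟩

/-! ### Executions -/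

/-- The distribution of the configuration after a round which starts in `σ` and in which the
messages `m` are delivered: the nodes use independent random bits. -/
def roundLaw (m : V → Message (Fintype.card V)) (σ : Config V) : Measure (Config V) :=
  Measure.pi fun v => (nodeRound G m v (σ v)).toMeasure

instance (m : V → Message (Fintype.card V)) (σ : Config V) :
    IsProbabilityMeasure (roundLaw G m σ) := by
  unfold roundLaw
  have : ∀ v, IsProbabilityMeasure (nodeRound G m v (σ v)).toMeasure :=
    fun _ => PMF.toMeasure.isProbabilityMeasure _
  infer_instance

/-- A message transport: `d t σ` is the family of messages delivered in the round leading from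
time `t` to time `t + 1` if that round starts in configuration `σ`. -/
abbrev Transport (V : Type*) [Fintype V] : Type _ :=
  ℕ → Config V → V → Message (Fintype.card V)

/-- All messages are delivered as they were sent. -/
def faultless : Transport V := fun _ σ w => (σ w).broadcast

/-- In the first round all neighbors of `v` receive `f` instead of the broadcast of `v`;
all other messages are delivered as they were sent. -/
def corruptFirst [DecidableEq V] (v : V) (f : Message (Fintype.card V)) : Transport V := fun t σ w =>
  if t = 0 ∧ w = v then f else (σ w).broadcast

/-- The transition kernel of the round that starts at time `t`. -/
def roundKernel (d : Transport V) (t : ℕ) : Kernel (Config V) (Config V) where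
  toFun σ := roundLaw G (d t σ) σ
  measurable' := measurable_of_finite _

instance (d : Transport V) (t : ℕ) : IsMarkovKernel (roundKernel G d t) :=
  ⟨fun σ => inferInstanceAs (IsProbabilityMeasure (roundLaw G (d t σ) σ))⟩

/-- The law of the sequence of configurations (at times `0, 1, 2, …`, one round per time step)
of the execution that starts in `σ`: the Markov chain with the above transition kernels. -/
def executionLaw (d : Transport V) (σ : Config V) : Measure (ℕ → Config V) :=
  Kernel.traj (X := fun _ : ℕ => Config V)
    (fun t => (roundKernel G d t).comap
      (fun h : (i : Finset.Iic t) → Config V => h ⟨t, by simp⟩) (measurable_pi_apply _))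
    0 (fun _ => σ)

/-! ### Legitimate configurations and containment -/

/-- All nodes made a final choice, the color of each node `v` lies in `{0, 1, …, δ(v)}`, and
neighbors have different colors. -/
def IsLegitimate (σ : Config V) : Prop :=
  (∀ v, (σ v).final = true ∧ ∃ x, (σ v).c = some x ∧ (x : ℕ) ≤ G.degree v) ∧
    ∀ v w, G.Adj v w → (σ v).c ≠ (σ w).c

/-- The first time `t ≥ k` at which the configuration is legitimate (`⊤` if there is none). -/
def hitLegitimate (k : ℕ) (ω : ℕ → Config V) : ℕ∞ :=
  ⨅ (t : ℕ) (_ : k ≤ t ∧ IsLegitimate G (ω t)), (t : ℕ∞)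

/-- During the execution `ω` only nodes within distance `r` of `v` leave their state in `σ`. -/
def ContaminatesOnly (r : ℕ) (v : V) (σ : Config V) (ω : ℕ → Config V) : Prop :=
  ∀ t u, (r : ℕ∞) < G.edist v u → ω t u = σ u

/-- `Δ_i(G)`: the largest size of an independent set of neighbors of a node. -/
def maxIndependentDegree : ℕ :=
  Finset.univ.sup fun v => (G.induce (G.neighborSet v)).indepNum

end Network

end

/-- Every element of `α` can be stored in `b` bits. -/
def FitsInBits (α : Type*) (b : ℕ) : Prop :=
  ∃ enc : α → (Fin b → Bool), Function.Injective enc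

/-!
In a faultless round a node redraws its color unless its color is permitted and in conflict with
no neighbor, where a final node yields to final neighbors only. A configuration in which no node
redraws becomes legitimate in this round and never changes afterwards, so everything reduces to
estimates of the probability that some node redraws. An execution is a Markov chain, so these
estimates are made round by round: if the one-round mean of `g` is at most `f`, then the mean of
`g` at time `t + 1` is at most that of `f` at time `t` (`integral_round_le`).

*Convergence.* After the first round final choices are consistent. If `v` then redraws, while `i`
of its neighbors redraw and `j` neighbors keep a color that they are about to make final, then the
palette of `v` has at least `1 + i + j` colors, as each other neighbor excludes at most one. The
draw of `v` fails if it is `⊥`, or one of the at most `j` confirmed colors, or one of the colors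
drawn by the redrawing neighbors, half of which draw `⊥` in the mean. Since a neighbor that draws
`⊥` redraws in the following round instead of confirming a color, the resulting bound for the
probability of failure has mean at most `7/8` one round earlier (`integral_failureBound_le`). Hence
`v` redraws at time `1 + 2 s` with probability at most `(7/8) ^ s`, and a union bound over the
nodes gives both almost sure convergence and the logarithmic bound.

*Containment.* A fault at `v` makes only `v` and those neighbors redraw whose color in the
legitimate configuration is the one that `v` appears to have. These neighbors have the same color,
so they form an independent set `A`. As the colors of all other nodes are final, and tabu for
`v` and `A`, only `v` and `A` ever change (`Contained`). Nodes of `A` are in conflict with `v` only,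
and a potential (`potential`) that is at least `1` as long as some node redraws has its mean halved
in every round (`Contained.integral_potential_le`). Therefore the recovery time `T` satisfies
`P(T > t + 1) ≤ C 2 ^ (-t)`, where `C` is essentially a multiple of the number `K` of nodes that
redraw in the first round. Conversely, each of these `K` nodes has to draw a color other than `⊥`
before it can become final, so that `P(T ≤ t + 1) ≤ (1 - 2 ^ (-t)) ^ K`.

*Moments.* The upper tail alone gives `E T ≤ log₂ C + 3` (`lintegral_le_log_add_three`), and
`C ≤ 2 ^ (5/2) K`, `K ≤ Δ_i + 1` and `ln (Δ_i + 1) ≤ H_{Δ_i}` give the bound for the mean. The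
variance is at most the mean square deviation from any reference point, which both tails together
bound (`lintegral_sq_sub_le`). That the bound is below `7.5` for a suitable reference point
(`exists_deviation_lt`) is a calculation for each `K < 32`; for larger `K` the bound depends, up to
a small error, only on the ratio of `K` and a power of two, and as it is convex in this ratio, it
suffices to consider three values. This needs a good constant `C`: hence the potential changes in
the first rounds (`psiSequence`).
-/

noncomputable section

section

variable {V : Type*} [Fintype V] (G : SimpleGraph V) [DecidableRel G.Adj]

/-! ### Executions as Markov chains -/

instance (d : Transport V) (σ : Config V) : IsProbabilityMeasure (executionLaw G d σ) := by
  unfold executionLaw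
  infer_instance

/-- The joint law of two consecutive configurations (the Markov property). -/
theorem executionLaw_map_pair (d : Transport V) (σ : Config V) (t : ℕ) :
    (executionLaw G d σ).map (fun ω => (ω t, ω (t + 1))) =
      ((executionLaw G d σ).map fun ω => ω t) ⊗ₘ roundKernel G d t := by
  have h := Kernel.partialTraj_compProd_eq_map_traj (X := fun _ : ℕ => Config V)
    (κ := fun t => (roundKernel G d t).comap
      (fun h : (i : Finset.Iic t) → Config V => h ⟨t, by simp⟩) (measurable_pi_apply _))
    (Nat.zero_le t) (x₀ := fun _ => σ)
  rw [← Kernel.traj_map_frestrictLe_apply] at h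
  change ((executionLaw G d σ).map _) ⊗ₘ _ = (executionLaw G d σ).map _ at h
  have h2 := congrArg (fun μ => μ.map (fun p : ((i : Finset.Iic t) → Config V) × Config V =>
    (p.1 ⟨t, by simp⟩, p.2))) h
  rw [Measure.map_map (by fun_prop) (by fun_prop)] at h2
  change _ = (executionLaw G d σ).map (fun ω => (ω t, ω (t + 1))) at h2
  rw [← h2]
  refine Measure.ext_of_lintegral _ fun f hf => ?_
  rw [lintegral_map hf (by fun_prop), Measure.lintegral_compProd (by fun_prop),
    Measure.lintegral_compProd hf, lintegral_map (measurable_of_finite _) (by fun_prop),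
    lintegral_map ?_ (by fun_prop)]
  · rfl
  · refine Measurable.lintegral_kernel_prod_right ?_
    fun_prop

/-- A property of consecutive configurations that almost surely holds in each round holds almost
surely in all rounds of an execution. -/
theorem ae_forall_round (d : Transport V) (σ : Config V)
    (Q : ℕ → Config V → Config V → Prop)
    (hQ : ∀ t τ, ∀ᵐ τ' ∂roundLaw G (d t τ) τ, Q t τ τ') :
    ∀ᵐ ω ∂executionLaw G d σ, ∀ t, Q t (ω t) (ω (t + 1)) := by
  rw [ae_all_iff]
  intro t
  have h : ∀ᵐ p ∂(((executionLaw G d σ).map fun ω => ω t) ⊗ₘ roundKernel G d t),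
      Q t p.1 p.2 := by
    refine Measure.ae_compProd_of_ae_ae (Set.toFinite _).measurableSet ?_
    exact Filter.Eventually.of_forall fun τ => hQ t τ
  rw [← executionLaw_map_pair] at h
  exact ae_of_ae_map (by fun_prop) h

theorem ae_apply_zero (d : Transport V) (σ : Config V) :
    ∀ᵐ ω ∂executionLaw G d σ, ω 0 = σ := by
  have h : (executionLaw G d σ).map (Preorder.frestrictLe 0) =
      Measure.dirac (fun _ : Finset.Iic 0 => σ) := by
    unfold executionLaw
    rw [Kernel.traj_map_frestrictLe_apply, Kernel.partialTraj_self, Kernel.id_apply]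
  have h2 : ∀ᵐ x ∂(executionLaw G d σ).map (Preorder.frestrictLe (π := fun _ : ℕ => Config V) 0),
      x ⟨0, by simp⟩ = σ := by
    rw [h, ae_dirac_iff (measurableSet_eq_fun (by fun_prop) (by fun_prop))]
  exact ae_of_ae_map (by fun_prop) h2

theorem integral_round (d : Transport V) (σ : Config V) (t : ℕ) (f : Config V → ℝ) :
    ∫ ω, f (ω (t + 1)) ∂executionLaw G d σ =
      ∫ ω, ∫ τ, f τ ∂roundLaw G (d t (ω t)) (ω t) ∂executionLaw G d σ := by
  have h := executionLaw_map_pair G d σ t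
  have hf : ∀ g : Config V × Config V → ℝ, ∀ μ : Measure (Config V × Config V),
      [IsFiniteMeasure μ] → Integrable g μ := fun g μ _ => Integrable.of_finite
  have hm : ∀ g : Config V → ℝ, ∀ μ, AEStronglyMeasurable g μ := fun g μ =>
    (measurable_of_finite g).aestronglyMeasurable
  have h1 : ∫ ω, f (ω (t + 1)) ∂executionLaw G d σ =
      ∫ p, f p.2 ∂(executionLaw G d σ).map (fun ω => (ω t, ω (t + 1))) := by
    rw [integral_map (by fun_prop) (measurable_of_finite _).aestronglyMeasurable]
  rw [h1, h, Measure.integral_compProd (hf _ _),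
    integral_map (measurable_pi_apply t).aemeasurable (hm _ _)]
  rfl

theorem integrable_apply (d : Transport V) (σ : Config V) (t : ℕ) (f : Config V → ℝ) :
    Integrable (fun ω => f (ω t)) (executionLaw G d σ) :=
  (integrable_map_measure (μ := executionLaw G d σ) (f := fun ω : ℕ → Config V => ω t) (g := f)
    (measurable_of_finite f).aestronglyMeasurable
    (measurable_pi_apply t).aemeasurable).1 Integrable.of_finite

/-- Expectations can be compared round by round: if the one-round mean of `g` is at most `f`,
then the mean of `g` at time `t + 1` is at most that of `f` at time `t`. -/
theorem integral_round_le (d : Transport V) (σ : Config V) (t : ℕ) (f g : Config V → ℝ)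
    (h : ∀ᵐ ω ∂executionLaw G d σ, ∫ τ, g τ ∂roundLaw G (d t (ω t)) (ω t) ≤ f (ω t)) :
    ∫ ω, g (ω (t + 1)) ∂executionLaw G d σ ≤ ∫ ω, f (ω t) ∂executionLaw G d σ := by
  rw [integral_round]
  exact integral_mono_ae
    (integrable_apply G d σ t fun τ => ∫ τ', g τ' ∂roundLaw G (d t τ) τ)
    (integrable_apply G d σ t f) h

theorem integral_apply_zero (d : Transport V) (σ : Config V) (f : Config V → ℝ) :
    ∫ ω, f (ω 0) ∂executionLaw G d σ = f σ := by
  have h : ∀ᵐ ω ∂executionLaw G d σ, f (ω 0) = f σ := by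
    filter_upwards [ae_apply_zero G d σ] with ω hω
    rw [hω]
  rw [integral_congr_ae h]
  simp

end

section

variable {V : Type*} [Fintype V] (G : SimpleGraph V) [DecidableRel G.Adj]

/-! ### The law of one round -/

/-- Resampling one coordinate does not change a product measure. -/
theorem map_update_pi_prod {ι : Type*} [Fintype ι] [DecidableEq ι] {X : ι → Type*}
    [∀ i, MeasurableSpace (X i)] (ν : ∀ i, Measure (X i)) [∀ i, IsProbabilityMeasure (ν i)]
    (i : ι) :
    ((Measure.pi ν).prod (ν i)).map (fun p => Function.update p.1 i p.2) = Measure.pi ν := by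
  have hmeas : Measurable fun p : (∀ j, X j) × X i => Function.update p.1 i p.2 := by
    fun_prop
  symm
  refine Measure.pi_eq fun s hs => ?_
  rw [Measure.map_apply hmeas (MeasurableSet.univ_pi hs)]
  have hpre : (fun p : (∀ j, X j) × X i => Function.update p.1 i p.2) ⁻¹' Set.univ.pi s =
      (Set.univ.pi (Function.update s i Set.univ)) ×ˢ s i := by
    ext ⟨x, y⟩
    simp only [Set.mem_preimage, Set.mem_pi, Set.mem_univ, true_implies, Set.mem_prod]
    constructor
    · intro h
      refine ⟨fun j => ?_, by simpa using h i⟩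
      rcases eq_or_ne j i with rfl | hj
      · simp
      · simpa [hj] using h j
    · rintro ⟨h1, h2⟩ j
      rcases eq_or_ne j i with rfl | hj
      · simpa using h2
      · simpa [hj] using h1 j
  rw [hpre, Measure.prod_prod, Measure.pi_pi,
    ← Finset.mul_prod_erase _ _ (Finset.mem_univ i),
    ← Finset.mul_prod_erase Finset.univ (fun j => ν j (s j)) (Finset.mem_univ i)]
  have : ∏ x ∈ Finset.univ.erase i, ν x (Function.update s i Set.univ x) =
      ∏ x ∈ Finset.univ.erase i, ν x (s x) :=
    Finset.prod_congr rfl fun j hj => by simp [Finset.ne_of_mem_erase hj]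
  rw [this]
  simp [mul_comm]

instance (m : V → Message (Fintype.card V)) (v : V) (s : NodeState (Fintype.card V)) :
    IsProbabilityMeasure (nodeRound G m v s).toMeasure :=
  PMF.toMeasure.isProbabilityMeasure _

/-- As the nodes are independent, the state of one node can be drawn anew without changing the law
of a round. This allows to average over the draw of `v` while the outcome of all other nodes is
fixed. -/
theorem integral_roundLaw_resample [DecidableEq V] (m : V → Message (Fintype.card V))
    (σ : Config V) (v : V) (F : Config V → ℝ) :
    ∫ τ, F τ ∂roundLaw G m σ =
      ∫ τ, ∫ s, F (Function.update τ v s) ∂(nodeRound G m v (σ v)).toMeasure ∂roundLaw G m σ := by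
  have h := map_update_pi_prod (fun v => (nodeRound G m v (σ v)).toMeasure) v
  have hmeas : Measurable fun p : Config V × NodeState (Fintype.card V) =>
    Function.update p.1 v p.2 := measurable_of_finite _
  conv_lhs => rw [roundLaw, ← h]
  rw [integral_map hmeas.aemeasurable (measurable_of_finite _).aestronglyMeasurable,
    integral_prod _ Integrable.of_finite]
  rfl

theorem card_palette_pos (m : V → Message (Fintype.card V)) (v : V) :
    0 < (palette G m v).card :=
  Finset.card_pos.2 (palette_nonempty G m v)

instance (n : ℕ) : MeasurableSpace (Option (Color n)) := ⊤

instance (n : ℕ) : DiscreteMeasurableSpace (Option (Color n)) := ⟨fun _ => trivial⟩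

theorem integral_nodeRound_of_true (m : V → Message (Fintype.card V)) (v : V)
    (s : NodeState (Fintype.card V)) (h : newFinal G m v s = true)
    (f : NodeState (Fintype.card V) → ℝ) :
    ∫ x, f x ∂(nodeRound G m v s).toMeasure = f ⟨s.c, true⟩ := by
  rw [nodeRound, if_pos h, PMF.toMeasure_pure, integral_dirac]

/-- A redrawing node gets `⊥` with probability `1/2` and each color of its palette with the same
probability. -/
theorem integral_nodeRound_of_false (m : V → Message (Fintype.card V)) (v : V)
    (s : NodeState (Fintype.card V)) (h : newFinal G m v s = false)
    (f : NodeState (Fintype.card V) → ℝ) :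
    ∫ x, f x ∂(nodeRound G m v s).toMeasure =
      f ⟨none, false⟩ / 2 +
        (∑ x ∈ palette G m v, f ⟨some x, false⟩) / (2 * (palette G m v).card) := by
  have hn : ((palette G m v).card : ℝ) ≠ 0 := by
    exact_mod_cast (card_palette_pos G m v).ne'
  rw [nodeRound, if_neg (by simp [h]), ← PMF.toMeasure_map _ _ (measurable_of_finite _),
    integral_map (measurable_of_finite _).aemeasurable
      (measurable_of_finite _).aestronglyMeasurable, PMF.integral_eq_sum, Fintype.sum_option]
  have h0 : (randomColor G m v none).toReal = 1 / 2 := by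
    simp [randomColor, PMF.bind_apply, tsum_fintype]
  have h1 : ∀ x, (randomColor G m v (some x)).toReal =
      if x ∈ palette G m v then 1 / (2 * ((palette G m v).card : ℝ)) else 0 := by
    intro x
    rw [randomColor, PMF.bind_apply, tsum_fintype, Fintype.sum_bool]
    have : ((PMF.uniformOfFinset (palette G m v) (palette_nonempty G m v)).map some) (some x) =
        (PMF.uniformOfFinset (palette G m v) (palette_nonempty G m v)) x := by
      rw [PMF.map_apply, tsum_eq_single x]
      · simp
      · intro y hy
        simp [hy.symm]
    simp [this, PMF.uniformOfFinset_apply, apply_ite ENNReal.toReal]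
    split_ifs <;> simp [mul_comm]
  simp only [h0, h1, smul_eq_mul, ite_mul, zero_mul, Finset.sum_ite_mem, Finset.univ_inter,
    ← Finset.mul_sum]
  field_simp

/-- The coordinate of a redrawing node can be integrated out first. -/
theorem integral_roundLaw_of_false [DecidableEq V] (m : V → Message (Fintype.card V))
    (σ : Config V) (v : V) (h : newFinal G m v (σ v) = false) (F : Config V → ℝ) :
    ∫ τ, F τ ∂roundLaw G m σ =
      ∫ τ, (F (Function.update τ v ⟨none, false⟩) / 2 +
        (∑ x ∈ palette G m v, F (Function.update τ v ⟨some x, false⟩)) /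
          (2 * (palette G m v).card)) ∂roundLaw G m σ := by
  rw [integral_roundLaw_resample G m σ v]
  simp only [integral_nodeRound_of_false G m v _ h]

/-- The support of a round. -/
theorem ae_roundLaw (m : V → Message (Fintype.card V)) (σ : Config V) :
    ∀ᵐ τ ∂roundLaw G m σ, ∀ u,
      (newFinal G m u (σ u) = true → τ u = ⟨(σ u).c, true⟩) ∧
      (newFinal G m u (σ u) = false →
        (τ u).final = false ∧ ∀ x, (τ u).c = some x → x ∈ palette G m u) := by
  rw [ae_all_iff]
  intro u
  have key : ∀ᵐ s ∂(nodeRound G m u (σ u)).toMeasure,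
      (newFinal G m u (σ u) = true → s = ⟨(σ u).c, true⟩) ∧
      (newFinal G m u (σ u) = false →
        s.final = false ∧ ∀ x, s.c = some x → x ∈ palette G m u) := by
    rw [ae_iff, PMF.toMeasure_apply_eq_zero_iff _ (Set.toFinite _).measurableSet,
      Set.disjoint_left]
    intro s hs
    simp only [Set.mem_ofPred_eq, not_not]
    refine ⟨fun h => ?_, fun h => ?_⟩
    · rw [nodeRound, if_pos h] at hs
      simpa using hs
    · rw [nodeRound, if_neg (by simp [h])] at hs
      simp only [PMF.support_map, Set.mem_image] at hs
      obtain ⟨y, hy, rfl⟩ := hs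
      refine ⟨rfl, ?_⟩
      rintro x rfl
      simp only [randomColor, PMF.mem_support_bind_iff] at hy
      obtain ⟨bit, -, hb⟩ := hy
      cases bit
      · simpa using hb
      · simp at hb
  exact (Measure.tendsto_eval_ae_ae (μ := fun v => (nodeRound G m v (σ v)).toMeasure) (i := u))
    key

/-! ### Numbers of undefined colors -/

/-- The mean of `f` at the number of heads in `i` independent tosses of a fair coin. -/
def coinMean : ℕ → (ℕ → ℝ) → ℝ
  | 0, f => f 0
  | i + 1, f => coinMean i fun s => (f s + f (s + 1)) / 2

theorem coinMean_add (i : ℕ) (f g : ℕ → ℝ) :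
    coinMean i (fun s => f s + g s) = coinMean i f + coinMean i g := by
  induction i generalizing f g with
  | zero => rfl
  | succ i ih =>
    simp only [coinMean]
    rw [← ih]
    congr 1
    ext s
    ring

theorem coinMean_const_mul (i : ℕ) (a : ℝ) (f : ℕ → ℝ) :
    coinMean i (fun s => a * f s) = a * coinMean i f := by
  induction i generalizing f with
  | zero => rfl
  | succ i ih =>
    simp only [coinMean]
    rw [← ih]
    congr 1
    ext s
    ring

theorem coinMean_const (i : ℕ) (a : ℝ) : coinMean i (fun _ => a) = a := by
  induction i with
  | zero => rfl
  | succ i ih =>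
    simp only [coinMean]
    rw [← ih]
    congr 1
    ext s
    rw [ih]
    ring

theorem coinMean_id (i : ℕ) : coinMean i (fun s => (s : ℝ)) = i / 2 := by
  induction i with
  | zero => simp [coinMean]
  | succ i ih =>
    have : (fun s : ℕ => ((s : ℝ) + ((s + 1 : ℕ) : ℝ)) / 2) = fun s : ℕ => (s : ℝ) + 1 / 2 := by
      ext s
      push_cast
      ring
    simp only [coinMean]
    rw [this, coinMean_add, coinMean_const, ih]
    push_cast
    ring

theorem coinMean_sq (i : ℕ) : coinMean i (fun s => (s : ℝ) ^ 2) = ((i : ℝ) ^ 2 + i) / 4 := by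
  induction i with
  | zero => simp [coinMean]
  | succ i ih =>
    have : (fun s : ℕ => ((s : ℝ) ^ 2 + ((s + 1 : ℕ) : ℝ) ^ 2) / 2) =
        fun s : ℕ => (s : ℝ) ^ 2 + ((s : ℝ) + 1 / 2) := by
      ext s
      push_cast
      ring
    simp only [coinMean]
    rw [this, coinMean_add, coinMean_add, coinMean_const, coinMean_id, ih]
    push_cast
    ring

theorem coinMean_cube (i : ℕ) :
    coinMean i (fun s => (s : ℝ) ^ 3) = ((i : ℝ) ^ 3 + 3 * (i : ℝ) ^ 2) / 8 := by
  induction i with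
  | zero => simp [coinMean]
  | succ i ih =>
    have : (fun s : ℕ => ((s : ℝ) ^ 3 + ((s + 1 : ℕ) : ℝ) ^ 3) / 2) =
        fun s : ℕ => (s : ℝ) ^ 3 + (3 / 2 * (s : ℝ) ^ 2 + (3 / 2 * (s : ℝ) + 1 / 2)) := by
      ext s
      push_cast
      ring
    simp only [coinMean]
    rw [this, coinMean_add, coinMean_add, coinMean_add, coinMean_const, coinMean_const_mul,
      coinMean_const_mul, coinMean_id, coinMean_sq, ih]
    push_cast
    ring

/-- The number of nodes of `B` without color. -/
def uncolored (B : Finset V) (τ : Config V) : ℕ := (B.filter fun w => (τ w).c = none).card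

theorem uncolored_le (B : Finset V) (τ : Config V) : uncolored B τ ≤ B.card :=
  Finset.card_filter_le _ _

theorem uncolored_update [DecidableEq V] {B : Finset V} {v : V} (hv : v ∉ B) (τ : Config V)
    (s : NodeState (Fintype.card V)) :
    uncolored B (Function.update τ v s) = uncolored B τ := by
  unfold uncolored
  congr 1
  refine Finset.filter_congr fun w hw => ?_
  rw [Function.update_of_ne (ne_of_mem_of_not_mem hw hv)]

/-- Among nodes that redraw, the number of those that draw `⊥` is a sum of independent fair
bits. -/
theorem integral_uncolored (m : V → Message (Fintype.card V)) (σ : Config V) (B : Finset V)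
    (hB : ∀ w ∈ B, newFinal G m w (σ w) = false) (f : ℕ → ℝ) :
    ∫ τ, f (uncolored B τ) ∂roundLaw G m σ = coinMean B.card f := by
  classical
  induction B using Finset.induction_on generalizing f with
  | empty => simp [uncolored, coinMean]
  | insert w B hw ih =>
    have hn : ((palette G m w).card : ℝ) ≠ 0 := by
      exact_mod_cast (card_palette_pos G m w).ne'
    have h1 : ∀ τ, uncolored (insert w B) (Function.update τ w ⟨none, false⟩) =
        uncolored B τ + 1 := by
      intro τ
      rw [uncolored, Finset.filter_insert, if_pos (by simp), Finset.card_insert_of_notMem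
        (fun h => hw (Finset.mem_filter.1 h).1)]
      exact congrArg (· + 1) (uncolored_update hw τ _)
    have h2 : ∀ τ x, uncolored (insert w B) (Function.update τ w ⟨some x, false⟩) =
        uncolored B τ := by
      intro τ x
      rw [uncolored, Finset.filter_insert, if_neg (by simp)]
      exact uncolored_update hw τ _
    rw [integral_roundLaw_of_false G m σ w (hB w (Finset.mem_insert_self _ _)),
      Finset.card_insert_of_notMem hw, coinMean,
      ← ih (fun u hu => hB u (Finset.mem_insert_of_mem hu))]
    congr 1
    ext τ
    simp only [h1, h2, Finset.sum_const, nsmul_eq_mul]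
    field_simp
    ring

theorem integral_roundLaw_prod (m : V → Message (Fintype.card V)) (σ : Config V)
    (h : V → NodeState (Fintype.card V) → ℝ) :
    ∫ τ, ∏ u, h u (τ u) ∂roundLaw G m σ =
      ∏ u, ∫ s, h u s ∂(nodeRound G m u (σ u)).toMeasure := by
  rw [roundLaw, integral_fintype_prod_eq_prod]

theorem integral_roundLaw_mono (m : V → Message (Fintype.card V)) (σ : Config V)
    {f g : Config V → ℝ} (h : ∀ᵐ τ ∂roundLaw G m σ, f τ ≤ g τ) :
    ∫ τ, f τ ∂roundLaw G m σ ≤ ∫ τ, g τ ∂roundLaw G m σ :=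
  integral_mono_ae Integrable.of_finite Integrable.of_finite h

/-! ### Nodes that redraw, and legitimate configurations -/

/-- Node `u` draws a new color in the faultless round that starts in `τ`. -/
def Redraws (τ : Config V) (u : V) : Prop :=
  newFinal G (fun w => (τ w).broadcast) u (τ u) = false

instance (τ : Config V) : DecidablePred (Redraws G τ) := fun u =>
  inferInstanceAs (Decidable (newFinal G (fun w => (τ w).broadcast) u (τ u) = false))

variable {G}

theorem newFinal_eq_true_iff {m : V → Message (Fintype.card V)} {v : V}
    {s : NodeState (Fintype.card V)} :
    newFinal G m v s = true ↔ ∃ x, s.c = some x ∧ (x : ℕ) ≤ G.degree v ∧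
      ∀ w, G.Adj v w → (m w).1 = some x → s.final = true ∧ (m w).2 = false := by
  unfold newFinal
  rcases hc : s.c with _ | x
  · simp
  · simp only [Option.some.injEq, exists_eq_left']
    by_cases hd : G.degree v < x
    · simp [hd]
    · rw [if_neg hd]
      cases hf : s.final
      · simp [occupied, not_lt.1 hd]
      · simp [tabu, not_lt.1 hd]

theorem not_redraws_iff {τ : Config V} {v : V} :
    ¬ Redraws G τ v ↔ ∃ x, (τ v).c = some x ∧ (x : ℕ) ≤ G.degree v ∧
      ∀ w, G.Adj v w → (τ w).c = some x → (τ v).final = true ∧ (τ w).final = false := by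
  rw [Redraws, Bool.not_eq_false, newFinal_eq_true_iff]
  rfl

theorem mem_palette {m : V → Message (Fintype.card V)} {v : V} {x : Color (Fintype.card V)} :
    x ∈ palette G m v ↔ (x : ℕ) ≤ G.degree v ∧
      ∀ w, G.Adj v w → (m w).1 = some x → (m w).2 = false := by
  simp [palette, tabu]

theorem IsLegitimate.not_redraws {τ : Config V} (h : IsLegitimate G τ) (u : V) :
    ¬ Redraws G τ u := by
  obtain ⟨-, x, hx, hxd⟩ := h.1 u
  exact not_redraws_iff.2 ⟨x, hx, hxd, fun w hw hwx => absurd (hx.trans hwx.symm) (h.2 u w hw)⟩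

/-- Final choices are consistent: the final nodes are properly colored. -/
def Consistent (G : SimpleGraph V) [DecidableRel G.Adj] (τ : Config V) : Prop :=
  ∀ v, (τ v).final = true → ∃ x, (τ v).c = some x ∧ (x : ℕ) ≤ G.degree v ∧
    ∀ w, G.Adj v w → (τ w).c = some x → (τ w).final = false

theorem Consistent.not_redraws {τ : Config V} (h : Consistent G τ) {v : V}
    (hv : (τ v).final = true) : ¬ Redraws G τ v := by
  obtain ⟨x, hx, hxd, hw⟩ := h v hv
  exact not_redraws_iff.2 ⟨x, hx, hxd, fun w hw' hwx => ⟨hv, hw w hw' hwx⟩⟩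

theorem Consistent.final_eq_false {τ : Config V} (h : Consistent G τ) {v : V}
    (hv : Redraws G τ v) : (τ v).final = false := by
  by_contra h'
  exact h.not_redraws (by simpa using h') hv

/-- `τ'` is a possible outcome of a faultless round that starts in `τ`. -/
def RoundOutcome (G : SimpleGraph V) [DecidableRel G.Adj] (τ τ' : Config V) : Prop :=
  ∀ u, (¬ Redraws G τ u → τ' u = ⟨(τ u).c, true⟩) ∧
    (Redraws G τ u → (τ' u).final = false ∧
      ∀ x, (τ' u).c = some x → x ∈ palette G (fun w => (τ w).broadcast) u)

theorem RoundOutcome.final_iff {τ τ' : Config V} (h : RoundOutcome G τ τ') (u : V) :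
    (τ' u).final = true ↔ ¬ Redraws G τ u := by
  by_cases hu : Redraws G τ u
  · simp [((h u).2 hu).1, hu]
  · simp [(h u).1 hu, hu]

variable (G)

theorem ae_round (τ : Config V) :
    ∀ᵐ τ' ∂roundLaw G (fun w => (τ w).broadcast) τ, RoundOutcome G τ τ' := by
  filter_upwards [ae_roundLaw G (fun w => (τ w).broadcast) τ] with τ' h u
  exact ⟨fun hu => (h u).1 (by simpa [Redraws] using hu), fun hu => (h u).2 hu⟩

theorem ae_final_iff (τ : Config V) :
    ∀ᵐ τ' ∂roundLaw G (fun w => (τ w).broadcast) τ, ∀ u,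
      (τ' u).final = true ↔ ¬ Redraws G τ u := by
  filter_upwards [ae_round G τ] with τ' h u using h.final_iff u

theorem ae_consistent (τ : Config V) :
    ∀ᵐ τ' ∂roundLaw G (fun w => (τ w).broadcast) τ, Consistent G τ' := by
  filter_upwards [ae_round G τ, ae_final_iff G τ] with τ' h hf v hv
  have hv' := (hf v).1 hv
  obtain ⟨x, hx, hxd, hw⟩ := not_redraws_iff.1 hv'
  refine ⟨x, by rw [(h v).1 hv', hx], hxd, fun w hvw hwx => ?_⟩
  by_contra hwf
  have hw' := (hf w).1 (by simpa using hwf)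
  rw [(h w).1 hw'] at hwx
  obtain ⟨y, hy, -, hy2⟩ := not_redraws_iff.1 hw'
  have hxy : y = x := by
    rw [hy] at hwx
    exact Option.some.inj hwx
  subst hxy
  have h1 := hw w hvw hy
  have h2 := hy2 v hvw.symm hx
  simp [h1.1] at h2

/-- A round without redrawing ends in a legitimate configuration. -/
theorem ae_isLegitimate (τ : Config V) :
    ∀ᵐ τ' ∂roundLaw G (fun w => (τ w).broadcast) τ,
      (∀ u, ¬ Redraws G τ u) → IsLegitimate G τ' := by
  filter_upwards [ae_consistent G τ, ae_final_iff G τ] with τ' hc hf h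
  refine ⟨fun v => ?_, fun v w hvw heq => ?_⟩
  · have hv := (hf v).2 (h v)
    obtain ⟨x, hx, hxd, -⟩ := hc v hv
    exact ⟨hv, x, hx, hxd⟩
  · obtain ⟨x, hx, -, h2⟩ := hc v ((hf v).2 (h v))
    have := h2 w hvw (heq ▸ hx)
    rw [(hf w).2 (h w)] at this
    simp at this

theorem IsLegitimate.ae_eq {τ : Config V} (h : IsLegitimate G τ) :
    ∀ᵐ τ' ∂roundLaw G (fun w => (τ w).broadcast) τ, τ' = τ := by
  filter_upwards [ae_round G τ] with τ' h'
  funext u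
  rw [(h' u).1 (h.not_redraws u)]
  exact NodeState.ext rfl (h.1 u).1.symm

end

section

variable {V : Type*} [Fintype V] (G : SimpleGraph V) [DecidableRel G.Adj]

/-! ### Space -/

theorem fitsInBits_message (n : ℕ) : FitsInBits (Message n) (Nat.size n + 2) := by
  classical
  have hcard : Fintype.card (Message n) ≤ Fintype.card (Fin (Nat.size n + 2) → Bool) := by
    simp only [Message, Color, Fintype.card_prod, Fintype.card_option, Fintype.card_fin,
      Fintype.card_bool, Fintype.card_fun, pow_add]
    have : 0 < 2 ^ Nat.size n := by positivity
    omega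
  obtain ⟨e⟩ := Function.Embedding.nonempty_of_card_le hcard
  exact ⟨e, e.injective⟩

theorem FitsInBits.nodeState {n b : ℕ} (h : FitsInBits (Message n) b) :
    FitsInBits (NodeState n) b := by
  obtain ⟨e, he⟩ := h
  exact ⟨fun s => e s.broadcast, he.comp NodeState.broadcast_injective⟩

theorem size_add_two_le (n : ℕ) (hn : 2 ≤ n) :
    ((Nat.size n + 2 : ℕ) : ℝ) ≤ 4 / Real.log 2 * Real.log n := by
  have h2 : 0 < Real.log 2 := Real.log_pos one_lt_two
  have hs : 2 ≤ Nat.size n := by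
    have := Nat.lt_size.2 (show 2 ^ 1 ≤ n by simpa using hn)
    exact this
  have hpow : 2 ^ (Nat.size n - 1) ≤ n := Nat.lt_size.1 (by omega)
  have hlog : ((Nat.size n : ℝ) - 1) * Real.log 2 ≤ Real.log n := by
    have h := Real.log_le_log (by positivity) (show ((2 : ℝ) ^ (Nat.size n - 1)) ≤ n by
      exact_mod_cast hpow)
    rw [Real.log_pow, Nat.cast_sub (by omega)] at h
    simpa using h
  have hlog2 : Real.log 2 ≤ Real.log n :=
    Real.log_le_log two_pos (by exact_mod_cast hn)
  rw [div_mul_eq_mul_div, le_div_iff₀ h2]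
  push_cast
  nlinarith

/-! ### Legitimate configurations -/

theorem IsLegitimate.exists_coloring {σ : Config V} (h : IsLegitimate G σ) :
    ∃ χ : G.Coloring (Fin (G.maxDegree + 1)), ∀ v,
      (σ v).c.map Fin.val = some (χ v : ℕ) := by
  choose x hx hd using fun v => (h.1 v).2
  refine ⟨SimpleGraph.Coloring.mk (fun v => ⟨(x v : ℕ),
    Nat.lt_succ_of_le ((hd v).trans (G.degree_le_maxDegree v))⟩) ?_, fun v => ?_⟩
  · intro v w hvw heq
    refine h.2 v w hvw ?_
    rw [hx, hx, Fin.ext (Fin.mk.inj_iff.1 heq)]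
  · rw [hx]
    rfl

variable {G}

/-- Closure: from a time on at which rounds are faultless, legitimate configurations persist. -/
theorem ae_isLegitimate_mono (d : Transport V) (k : ℕ)
    (hd : ∀ t, k ≤ t → ∀ τ, d t τ = fun w => (τ w).broadcast) (σ : Config V) :
    ∀ᵐ ω ∂executionLaw G d σ, ∀ t, k ≤ t → IsLegitimate G (ω t) → ω (t + 1) = ω t := by
  refine ae_forall_round G d σ (fun t τ τ' => k ≤ t → IsLegitimate G τ → τ' = τ) fun t τ => ?_
  by_cases ht : k ≤ t
  · by_cases hτ : IsLegitimate G τ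
    · rw [hd t ht]
      filter_upwards [hτ.ae_eq] with τ' h _ _ using h
    · exact Filter.Eventually.of_forall fun _ _ h => absurd h hτ
  · exact Filter.Eventually.of_forall fun _ h => absurd h ht

theorem eq_of_forall_legitimate {ω : ℕ → Config V} {k t₀ : ℕ} (hk : k ≤ t₀)
    (h : ∀ t, k ≤ t → IsLegitimate G (ω t) → ω (t + 1) = ω t) (h0 : IsLegitimate G (ω t₀)) :
    ∀ t, t₀ ≤ t → ω t = ω t₀ := by
  intro t ht
  induction t, ht using Nat.le_induction with
  | base => rfl
  | succ t ht ih => rw [h t (hk.trans ht) (ih ▸ h0), ih]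

theorem IsLegitimate.ae_forall_eq {σ : Config V} (h : IsLegitimate G σ) :
    ∀ᵐ ω ∂executionLaw G faultless σ, ∀ t, ω t = σ := by
  filter_upwards [ae_isLegitimate_mono faultless 0 (fun _ _ _ => rfl) σ,
    ae_apply_zero G faultless σ] with ω hω h0 t
  rw [← h0] at h ⊢
  exact eq_of_forall_legitimate le_rfl hω h t (Nat.zero_le t)

/-! ### Convergence from an arbitrary configuration -/

/-- The neighbors of `v` that redraw. -/
def redrawNbrs (G : SimpleGraph V) [DecidableRel G.Adj] (τ : Config V) (v : V) : Finset V :=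
  (G.neighborFinset v).filter fun w => Redraws G τ w

/-- The neighbors of `v` that are not final but do not redraw: they keep their color, which is
not yet tabu for `v`. -/
def confirmNbrs (G : SimpleGraph V) [DecidableRel G.Adj] (τ : Config V) (v : V) : Finset V :=
  (G.neighborFinset v).filter fun w => ¬ Redraws G τ w ∧ (τ w).final = false

theorem redraws_of_mem_redrawNbrs {τ : Config V} {v w : V} (h : w ∈ redrawNbrs G τ v) :
    Redraws G τ w :=
  (Finset.mem_filter.1 h).2

/-- Each color of `{0, …, δ(v)}` is in the palette of `v` or tabu. -/
theorem degree_lt_card_palette_add_card (m : V → Message (Fintype.card V)) (v : V)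
    (Y : Finset (Option (Color (Fintype.card V))))
    (hY : ∀ w x, G.Adj v w → m w = (some x, true) → some x ∈ Y) :
    G.degree v + 1 ≤ (palette G m v).card + Y.card := by
  classical
  have hlt : G.degree v < 2 ^ Nat.size (Fintype.card V) :=
    (G.degree_lt_card_verts v).trans (Nat.lt_size_self _)
  have hall : (Finset.univ.filter fun x : Color (Fintype.card V) =>
      (x : ℕ) ≤ G.degree v).card = G.degree v + 1 := by
    have : (Finset.univ.filter fun x : Color (Fintype.card V) => (x : ℕ) ≤ G.degree v) =
        Finset.Iic ⟨G.degree v, hlt⟩ := by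
      ext x
      simp [Fin.le_def]
    rw [this, Fin.card_Iic]
  have hcover : (Finset.univ.filter fun x : Color (Fintype.card V) =>
      (x : ℕ) ≤ G.degree v).image some ⊆ (palette G m v).image some ∪ Y := by
    intro y hy
    obtain ⟨x, hx, rfl⟩ := Finset.mem_image.1 hy
    by_cases hxP : x ∈ palette G m v
    · exact Finset.mem_union_left _ (Finset.mem_image_of_mem _ hxP)
    · rw [mem_palette] at hxP
      push Not at hxP
      obtain ⟨w, hw, hwx, hwf⟩ := hxP (Finset.mem_filter.1 hx).2
      exact Finset.mem_union_right _ (hY w x hw (Prod.ext hwx (by simpa using hwf)))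
  have h1 := (Finset.card_le_card hcover).trans (Finset.card_union_le _ _)
  rwa [Finset.card_image_of_injective _ (Option.some_injective _),
    Finset.card_image_of_injective _ (Option.some_injective _), hall] at h1

/-- Every final neighbor makes at most one color of `{0, …, δ(v)}` tabu. -/
theorem Consistent.card_palette_ge {τ : Config V} (h : Consistent G τ) (v : V) :
    1 + (redrawNbrs G τ v).card + (confirmNbrs G τ v).card ≤
      (palette G (fun w => (τ w).broadcast) v).card := by
  classical
  set F := (G.neighborFinset v).filter fun w => (τ w).final = true
  have hdeg : (redrawNbrs G τ v).card + (confirmNbrs G τ v).card + F.card = G.degree v := by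
    rw [← G.card_neighborFinset_eq_degree v,
      ← Finset.card_filter_add_card_filter_not (s := G.neighborFinset v)
        (fun w => (τ w).final = true),
      ← Finset.card_filter_add_card_filter_not (s := (G.neighborFinset v).filter
        fun w => ¬ (τ w).final = true) (fun w => Redraws G τ w), add_comm, Finset.filter_filter,
      Finset.filter_filter]
    congr 2
    · unfold redrawNbrs
      congr 1
      refine Finset.filter_congr fun w _ => ?_
      constructor
      · intro hw
        exact ⟨by simp [h.final_eq_false hw], hw⟩
      · exact fun hw => hw.2
    · unfold confirmNbrs
      congr 1
      refine Finset.filter_congr fun w _ => ?_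
      simp [and_comm]
  have h1 := degree_lt_card_palette_add_card (G := G) (fun w => (τ w).broadcast) v
    (F.image fun w => (τ w).c) fun w x hw hwx => by
      obtain ⟨hx, hf⟩ := Prod.ext_iff.1 hwx
      exact Finset.mem_image.2 ⟨w, by simpa [F] using ⟨hw, hf⟩, hx⟩
  have h2 : (F.image fun w => (τ w).c).card ≤ F.card := Finset.card_image_le
  omega

theorem redraws_of_c_eq_none {τ : Config V} {v : V} (h : (τ v).c = none) : Redraws G τ v := by
  by_contra h'
  obtain ⟨x, hx, -⟩ := not_redraws_iff.1 h'
  simp [h] at hx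

/-- A draw of `v` is in conflict with at most one color per neighbor that confirms its color or
draws a color. -/
theorem card_conflicts_add_uncolored_le [DecidableEq V] {τ τ' : Config V} {v : V}
    (h : RoundOutcome G τ τ') :
    ((palette G (fun w => (τ w).broadcast) v).filter fun x =>
        Redraws G (Function.update τ' v ⟨some x, false⟩) v).card +
      uncolored (redrawNbrs G τ v) τ' ≤ (redrawNbrs G τ v).card + (confirmNbrs G τ v).card := by
  set B := redrawNbrs G τ v
  set R := (palette G (fun w => (τ w).broadcast) v).filter fun x =>
        Redraws G (Function.update τ' v ⟨some x, false⟩) v with hR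
  have hsub : R.image some ⊆
      (B.filter (fun w => ¬ (τ' w).c = none) ∪ confirmNbrs G τ v).image fun w => (τ' w).c := by
    intro y hy
    obtain ⟨x, hx, rfl⟩ := Finset.mem_image.1 hy
    rw [hR, Finset.mem_filter] at hx
    obtain ⟨hxP, hx⟩ := hx
    obtain ⟨hxd, hxt⟩ := mem_palette.1 hxP
    have : ∃ w, G.Adj v w ∧ (τ' w).c = some x := by
      by_contra hno
      push Not at hno
      refine absurd hx (not_redraws_iff.2 ⟨x, by simp, hxd, fun w hw hwx => ?_⟩)
      rw [Function.update_of_ne hw.ne'] at hwx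
      exact absurd hwx (hno w hw)
    obtain ⟨w, hw, hwx⟩ := this
    refine Finset.mem_image.2 ⟨w, ?_, hwx⟩
    by_cases hwr : Redraws G τ w
    · refine Finset.mem_union_left _ (Finset.mem_filter.2 ⟨?_, by simp [hwx]⟩)
      exact Finset.mem_filter.2 ⟨by simpa using hw, hwr⟩
    · refine Finset.mem_union_right _ (Finset.mem_filter.2 ⟨by simpa using hw, hwr, ?_⟩)
      rw [(h w).1 hwr] at hwx
      exact hxt w hw hwx
  have h1 := (Finset.card_le_card hsub).trans
    (Finset.card_image_le.trans (Finset.card_union_le _ _))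
  rw [Finset.card_image_of_injective _ (Option.some_injective _)] at h1
  have h2 := Finset.card_filter_add_card_filter_not (s := B) (fun w => (τ' w).c = none)
  unfold uncolored
  omega

/-- After a round, the neighbors of `v` that redraw or confirm are those that have just redrawn. -/
theorem card_redrawNbrs_add_card_confirmNbrs {τ τ' : Config V} {v : V} (hc : Consistent G τ')
    (hf : ∀ w, G.Adj v w → ((τ' w).final = true ↔ ¬ Redraws G τ w)) :
    (redrawNbrs G τ' v).card + (confirmNbrs G τ' v).card = (redrawNbrs G τ v).card := by
  simp only [redrawNbrs, confirmNbrs]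
  rw [← Finset.card_filter_add_card_filter_not (s := (G.neighborFinset v).filter fun w =>
    Redraws G τ w) (fun w => Redraws G τ' w), Finset.filter_filter, Finset.filter_filter]
  congr 2
  · refine Finset.filter_congr fun w hw => ⟨fun hw' => ⟨?_, hw'⟩, fun hw' => hw'.2⟩
    by_contra hno
    exact hc.not_redraws ((hf w (by simpa using hw)).2 hno) hw'
  · refine Finset.filter_congr fun w hw => ?_
    rw [and_comm, ← Bool.not_eq_true, hf w (by simpa using hw), not_not]

/-- A bound for the probability that `v` redraws after the next round: it draws `⊥`, or one of at
least `1 + i + j` colors, among which `j` are confirmed by neighbors and, in the mean, at most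
`i / 2` are drawn by neighbors. -/
def failureBound (G : SimpleGraph V) [DecidableRel G.Adj] (τ : Config V) (v : V) : ℝ :=
  if Redraws G τ v then
    1 / 2 + ((confirmNbrs G τ v).card + (redrawNbrs G τ v).card / 2) /
      (2 * (1 + (redrawNbrs G τ v).card + (confirmNbrs G τ v).card))
  else 0

theorem Consistent.integral_redraws_le {τ : Config V} (hτ : Consistent G τ) (v : V) :
    ∫ τ', (if Redraws G τ' v then (1 : ℝ) else 0) ∂roundLaw G (fun w => (τ w).broadcast) τ ≤
      failureBound G τ v := by
  classical
  unfold failureBound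
  split_ifs with hv
  · set m := fun w => (τ w).broadcast
    set i := (redrawNbrs G τ v).card
    set j := (confirmNbrs G τ v).card
    set N := (palette G m v).card
    have hN : (1 + i + j : ℝ) ≤ N := by exact_mod_cast hτ.card_palette_ge v
    have hpos : (0 : ℝ) < 1 + i + j := by positivity
    have hNpos : (0 : ℝ) < N := hpos.trans_le hN
    rw [integral_roundLaw_of_false G m τ v hv]
    calc _ ≤ ∫ τ', (fun s : ℕ => (1 / 2 + (i + j) / (2 * N) : ℝ) + (-(1 / (2 * N))) * s)
          (uncolored (redrawNbrs G τ v) τ') ∂roundLaw G m τ := by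
          refine integral_roundLaw_mono G m τ ?_
          filter_upwards [ae_round G τ] with τ' h
          have hc := card_conflicts_add_uncolored_le (v := v) h
          have hc' : (((palette G m v).filter fun x =>
              Redraws G (Function.update τ' v ⟨some x, false⟩) v).card : ℝ) +
              uncolored (redrawNbrs G τ v) τ' ≤ i + j := by exact_mod_cast hc
          rw [Finset.sum_boole]
          have h1 : (if Redraws G (Function.update τ' v ⟨none, false⟩) v then (1 : ℝ) else 0) ≤
            1 := by split_ifs <;> norm_num
          have h2 : (((palette G m v).filter fun x =>
              Redraws G (Function.update τ' v ⟨some x, false⟩) v).card : ℝ) / (2 * N) ≤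
              (i + j - uncolored (redrawNbrs G τ v) τ') / (2 * N) := by
            gcongr
            linarith
          have h3 : ((i : ℝ) + j - uncolored (redrawNbrs G τ v) τ') / (2 * N) =
            (i + j) / (2 * N) + -(1 / (2 * N)) * uncolored (redrawNbrs G τ v) τ' := by ring
          linarith
      _ = 1 / 2 + (j + i / 2) / (2 * N) := by
          refine (integral_uncolored G m τ (redrawNbrs G τ v)
            (fun w hw => redraws_of_mem_redrawNbrs hw)
            (fun s : ℕ => (1 / 2 + (i + j) / (2 * N) : ℝ) + (-(1 / (2 * N))) * s)).trans ?_
          rw [coinMean_add, coinMean_const, coinMean_const_mul, coinMean_id]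
          ring
      _ ≤ _ := by gcongr
  · have : ∀ᵐ τ' ∂roundLaw G (fun w => (τ w).broadcast) τ,
        (if Redraws G τ' v then (1 : ℝ) else 0) ≤ 0 := by
      filter_upwards [ae_consistent G τ, ae_final_iff G τ] with τ' hc hf
      rw [if_neg (hc.not_redraws ((hf v).2 hv))]
    simpa using integral_roundLaw_mono G _ τ this

/-- The mean of the failure bound after a round is at most `7/8`. The neighbors that redraw or
confirm after the round are those `i` that redraw in it. The half of them that draw `⊥` redraw
again, and such a neighbor counts only half in the failure bound. -/
theorem integral_failureBound_le (τ : Config V) (v : V) :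
    ∫ τ', failureBound G τ' v ∂roundLaw G (fun w => (τ w).broadcast) τ ≤
      7 / 8 * if Redraws G τ v then (1 : ℝ) else 0 := by
  set m := fun w => (τ w).broadcast
  split_ifs with hv
  · set i := (redrawNbrs G τ v).card
    have hpos : (0 : ℝ) < 1 + i := by positivity
    calc _ ≤ ∫ τ', (fun s : ℕ => (1 / 2 + i / (2 * (1 + i)) : ℝ) + (-(1 / (4 * (1 + i)))) * s)
          (uncolored (redrawNbrs G τ v) τ') ∂roundLaw G m τ := by
          refine integral_roundLaw_mono G m τ ?_
          filter_upwards [ae_final_iff G τ, ae_consistent G τ] with τ' hf hc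
          have hsum : (redrawNbrs G τ' v).card + (confirmNbrs G τ' v).card = i :=
            card_redrawNbrs_add_card_confirmNbrs hc fun w _ => hf w
          have hle : uncolored (redrawNbrs G τ v) τ' ≤ (redrawNbrs G τ' v).card := by
            refine Finset.card_le_card fun w hw => ?_
            obtain ⟨hw1, hw2⟩ := Finset.mem_filter.1 hw
            exact Finset.mem_filter.2 ⟨(Finset.mem_filter.1 hw1).1, redraws_of_c_eq_none hw2⟩
          have hsum' : ((redrawNbrs G τ' v).card : ℝ) + (confirmNbrs G τ' v).card = i := by
            exact_mod_cast hsum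
          have hle' : (uncolored (redrawNbrs G τ v) τ' : ℝ) ≤ (redrawNbrs G τ' v).card := by
            exact_mod_cast hle
          unfold failureBound
          split_ifs
          · rw [add_assoc 1, hsum', add_assoc]
            gcongr
            rw [show (confirmNbrs G τ' v).card = (i : ℝ) - (redrawNbrs G τ' v).card by linarith,
              show (i : ℝ) / (2 * (1 + i)) + -(1 / (4 * (1 + i))) *
                uncolored (redrawNbrs G τ v) τ' =
                (i - uncolored (redrawNbrs G τ v) τ' / 2) / (2 * (1 + i)) by field_simp; ring]
            gcongr
            linarith
          · have h1 : (uncolored (redrawNbrs G τ v) τ' : ℝ) ≤ i := by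
              exact_mod_cast uncolored_le (redrawNbrs G τ v) τ'
            rw [show (1 / 2 : ℝ) + i / (2 * (1 + i)) + -(1 / (4 * (1 + i))) *
                uncolored (redrawNbrs G τ v) τ' =
                1 / 2 + (i - uncolored (redrawNbrs G τ v) τ' / 2) / (2 * (1 + i)) by
                  field_simp; ring]
            have : (0 : ℝ) ≤ i - uncolored (redrawNbrs G τ v) τ' / 2 := by
              have : (0 : ℝ) ≤ i := by positivity
              linarith
            positivity
      _ = 1 / 2 + 3 / 8 * (i / (1 + i)) := by
          refine (integral_uncolored G m τ (redrawNbrs G τ v)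
            (fun w hw => redraws_of_mem_redrawNbrs hw)
            (fun s : ℕ => (1 / 2 + i / (2 * (1 + i)) : ℝ) + (-(1 / (4 * (1 + i)))) * s)).trans ?_
          rw [coinMean_add, coinMean_const, coinMean_const_mul, coinMean_id]
          field_simp
          ring
      _ ≤ _ := by
          have : (i : ℝ) / (1 + i) ≤ 1 := by
            rw [div_le_one hpos]
            linarith
          linarith
  · have : ∀ᵐ τ' ∂roundLaw G m τ, failureBound G τ' v ≤ 0 := by
      filter_upwards [ae_consistent G τ, ae_final_iff G τ] with τ' hc hf
      rw [failureBound, if_neg (hc.not_redraws ((hf v).2 hv))]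
    simpa using integral_roundLaw_mono G _ τ this

variable (G)

theorem ae_consistent_succ (σ : Config V) :
    ∀ᵐ ω ∂executionLaw G faultless σ, ∀ t, Consistent G (ω (t + 1)) :=
  ae_forall_round G faultless σ (fun _ _ τ' => Consistent G τ') fun _ τ => ae_consistent G τ

/-- Two rounds reduce the bound by the factor `7/8`: the probability of redrawing after the second
is at most the mean failure bound after the first. -/
theorem integral_redraws_le_pow (σ : Config V) (v : V) (s : ℕ) :
    ∫ ω, (if Redraws G (ω (1 + 2 * s)) v then (1 : ℝ) else 0) ∂executionLaw G faultless σ ≤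
      (7 / 8) ^ s := by
  induction s with
  | zero =>
    have h : ∀ ω : ℕ → Config V, (if Redraws G (ω (1 + 2 * 0)) v then (1 : ℝ) else 0) ≤ 1 := by
      intro ω
      split_ifs <;> norm_num
    have := integral_mono (μ := executionLaw G faultless σ)
      (integrable_apply G faultless σ (1 + 2 * 0) fun τ => if Redraws G τ v then (1 : ℝ) else 0)
      (integrable_const (1 : ℝ)) h
    simpa using this
  | succ s ih =>
    have h1 := integral_round_le G faultless σ (1 + 2 * s + 1) (fun τ => failureBound G τ v)
      (fun τ => if Redraws G τ v then (1 : ℝ) else 0) (by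
        filter_upwards [ae_consistent_succ G σ] with ω h
        exact (h _).integral_redraws_le v)
    have h2 := integral_round_le G faultless σ (1 + 2 * s)
      (fun τ => 7 / 8 * if Redraws G τ v then (1 : ℝ) else 0) (fun τ => failureBound G τ v)
      (Filter.Eventually.of_forall fun ω => integral_failureBound_le _ v)
    rw [integral_const_mul] at h2
    rw [pow_succ]
    calc _ = _ := rfl
      _ ≤ _ := h1
      _ ≤ _ := h2
      _ ≤ _ := by linarith

/-- A round that ends in an illegitimate configuration starts in a configuration in which some
node redraws. -/
theorem measureReal_not_isLegitimate_le_integral (d : Transport V) (σ : Config V) (t : ℕ)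
    (hd : ∀ τ, d t τ = fun w => (τ w).broadcast) (f : Config V → ℝ)
    (hf : ∀ᵐ ω ∂executionLaw G d σ, 0 ≤ f (ω t) ∧ ((∃ u, Redraws G (ω t) u) → 1 ≤ f (ω t))) :
    (executionLaw G d σ).real {ω | ¬ IsLegitimate G (ω (t + 1))} ≤
      ∫ ω, f (ω t) ∂executionLaw G d σ := by
  have hleg : ∀ᵐ ω ∂executionLaw G d σ, (∀ u, ¬ Redraws G (ω t) u) →
      IsLegitimate G (ω (t + 1)) := by
    have := ae_forall_round G d σ (fun s τ τ' => s = t → (∀ u, ¬ Redraws G τ u) →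
      IsLegitimate G τ') (fun s τ => by
        rcases eq_or_ne s t with rfl | hs
        · rw [hd]
          filter_upwards [ae_isLegitimate G τ] with τ' h _ using h
        · exact Filter.Eventually.of_forall fun _ h => absurd h hs)
    filter_upwards [this] with ω h using h t rfl
  have hmeas : MeasurableSet {ω : ℕ → Config V | ¬ IsLegitimate G (ω (t + 1))} :=
    (Set.toFinite {τ | ¬ IsLegitimate G τ}).measurableSet.preimage (measurable_pi_apply _)
  rw [← integral_indicator_one hmeas]
  refine integral_mono_ae ((integrable_const (1 : ℝ)).indicator hmeas)
    (integrable_apply G d σ t f) ?_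
  filter_upwards [hleg, hf] with ω h h'
  by_cases hω : IsLegitimate G (ω (t + 1))
  · simpa [Set.indicator_apply, hω] using h'.1
  · have : ∃ u, Redraws G (ω t) u := by
      by_contra hno
      push Not at hno
      exact hω (h hno)
    simpa [Set.indicator_apply, hω] using h'.2 this

theorem measureReal_not_isLegitimate_le (σ : Config V) (s : ℕ) :
    (executionLaw G faultless σ).real {ω | ¬ IsLegitimate G (ω (2 + 2 * s))} ≤
      Fintype.card V * (7 / 8) ^ s := by
  have h := measureReal_not_isLegitimate_le_integral G faultless σ (1 + 2 * s) (fun _ => rfl)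
    (fun τ => ∑ v, if Redraws G τ v then (1 : ℝ) else 0) (Filter.Eventually.of_forall fun ω => by
      have hnonneg : ∀ v ∈ (Finset.univ : Finset V),
          0 ≤ if Redraws G (ω (1 + 2 * s)) v then (1 : ℝ) else 0 := by
        intro v _
        split_ifs <;> norm_num
      refine ⟨Finset.sum_nonneg hnonneg, fun ⟨u, hu⟩ => ?_⟩
      have := Finset.single_le_sum hnonneg (Finset.mem_univ u)
      rwa [if_pos hu] at this)
  rw [show 2 + 2 * s = 1 + 2 * s + 1 by ring]
  refine h.trans ?_
  rw [integral_finsetSum _ fun v _ => integrable_apply G faultless σ (1 + 2 * s)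
    fun τ => if Redraws G τ v then (1 : ℝ) else 0]
  refine (Finset.sum_le_sum fun v _ => integral_redraws_le_pow G σ v s).trans_eq ?_
  simp

theorem ae_eventually_isLegitimate (σ : Config V) :
    ∀ᵐ ω ∂executionLaw G faultless σ, ∃ T, ∀ t, T ≤ t → IsLegitimate G (ω t) := by
  have hzero : (executionLaw G faultless σ).real
      {ω | ∀ s : ℕ, ¬ IsLegitimate G (ω (2 + 2 * s))} = 0 := by
    refine le_antisymm ?_ measureReal_nonneg
    have hlim : Filter.Tendsto (fun s : ℕ => (Fintype.card V : ℝ) * (7 / 8) ^ s) Filter.atTop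
        (nhds 0) := by
      rw [← mul_zero (Fintype.card V : ℝ)]
      exact (tendsto_pow_atTop_nhds_zero_of_lt_one (r := (7 / 8 : ℝ)) (by norm_num)
        (by norm_num)).const_mul _
    refine ge_of_tendsto' hlim fun s => ?_
    have hsub : {ω : ℕ → Config V | ∀ s : ℕ, ¬ IsLegitimate G (ω (2 + 2 * s))} ⊆
        {ω | ¬ IsLegitimate G (ω (2 + 2 * s))} := by
      intro ω hω
      simp only [Set.mem_ofPred_eq] at hω ⊢
      exact hω s
    exact (measureReal_mono hsub (measure_ne_top _ _)).trans
      (measureReal_not_isLegitimate_le G σ s)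
  have hae : ∀ᵐ ω ∂executionLaw G faultless σ, ¬ ∀ s : ℕ, ¬ IsLegitimate G (ω (2 + 2 * s)) := by
    rw [ae_iff]
    simp only [not_not]
    exact (measureReal_eq_zero_iff (measure_ne_top _ _)).1 hzero
  filter_upwards [hae, ae_isLegitimate_mono faultless 0 (fun _ _ _ => rfl) σ] with ω h1 h2
  simp only [not_forall, not_not] at h1
  obtain ⟨s, hs⟩ := h1
  refine ⟨2 + 2 * s, fun t ht => ?_⟩
  have h3 : ω t = ω (2 + 2 * s) := eq_of_forall_legitimate (Nat.zero_le _) h2 hs t ht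
  rw [h3]
  exact hs

/-- `16 (c + 1) ln n + 4` rounds suffice with probability `1 - n^{-c}`, because
`ln (8/7) ≥ 1/8`. -/
theorem isLegitimate_with_high_probability (c : ℝ) (hc : 1 ≤ c) (σ : Config V) :
    ENNReal.ofReal (1 - 1 / (Fintype.card V : ℝ) ^ c) ≤
      executionLaw G faultless σ
        {ω | ∀ t : ℕ, (16 * (c + 1) + 4 / Real.log 2) * Real.log (Fintype.card V) ≤ t →
          IsLegitimate G (ω t)} := by
  set n := Fintype.card V with hn
  rcases Nat.lt_or_ge n 2 with h2 | h2
  · rcases Nat.lt_or_ge n 1 with h1 | h1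
    · have : IsEmpty V := Fintype.card_eq_zero_iff.1 (by omega)
      have huniv : {ω : ℕ → Config V | ∀ t : ℕ, (16 * (c + 1) + 4 / Real.log 2) *
          Real.log n ≤ t → IsLegitimate G (ω t)} = Set.univ := by
        ext ω
        simp only [Set.mem_ofPred_eq, Set.mem_univ, iff_true]
        exact fun t _ => ⟨fun v => this.elim v, fun v => this.elim v⟩
      rw [huniv, measure_univ]
      refine ENNReal.ofReal_le_one.2 ?_
      have : (0 : ℝ) ≤ 1 / (n : ℝ) ^ c := by positivity
      linarith
    · have : (n : ℝ) = 1 := by exact_mod_cast (show n = 1 by omega)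
      rw [this, Real.one_rpow, div_one, sub_self, ENNReal.ofReal_zero]
      exact zero_le
  · have hlog2 : 0 < Real.log 2 := Real.log_pos one_lt_two
    have hnpos : (0 : ℝ) < n := by positivity
    have hlogn : Real.log 2 ≤ Real.log n := Real.log_le_log two_pos (by exact_mod_cast h2)
    set s := ⌈8 * (c + 1) * Real.log n⌉₊ with hs
    have hs1 : 8 * (c + 1) * Real.log n ≤ s := Nat.le_ceil _
    have hs2 : (s : ℝ) < 8 * (c + 1) * Real.log n + 1 :=
      Nat.ceil_lt_add_one (by positivity)
    have htime : ((2 + 2 * s : ℕ) : ℝ) ≤ (16 * (c + 1) + 4 / Real.log 2) * Real.log n := by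
      have : 4 ≤ 4 / Real.log 2 * Real.log n := by
        rw [div_mul_eq_mul_div, le_div_iff₀ hlog2]
        linarith
      push_cast
      linarith
    have hprob : (n : ℝ) * (7 / 8) ^ s ≤ 1 / (n : ℝ) ^ c := by
      have h78 : Real.log (7 / 8) ≤ -(1 / 8) := by
        have := Real.log_le_sub_one_of_pos (show (0 : ℝ) < 7 / 8 by norm_num)
        linarith
      have : (7 / 8 : ℝ) ^ s ≤ (n : ℝ) ^ (-(c + 1)) := by
        rw [← Real.log_le_log_iff (by positivity) (by positivity), Real.log_pow,
          Real.log_rpow hnpos]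
        nlinarith
      calc (n : ℝ) * (7 / 8) ^ s ≤ n * (n : ℝ) ^ (-(c + 1)) := by gcongr
        _ = 1 / (n : ℝ) ^ c := by
          rw [neg_add, Real.rpow_add hnpos, Real.rpow_neg_one, Real.rpow_neg hnpos.le]
          field_simp
    have hmeas : MeasurableSet {ω : ℕ → Config V | IsLegitimate G (ω (2 + 2 * s))} :=
      (Set.toFinite {τ | IsLegitimate G τ}).measurableSet.preimage (measurable_pi_apply _)
    have h1 : 1 - 1 / (n : ℝ) ^ c ≤
        (executionLaw G faultless σ).real {ω | IsLegitimate G (ω (2 + 2 * s))} := by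
      have h := measureReal_not_isLegitimate_le G σ s
      have hcompl := probReal_compl_eq_one_sub (μ := executionLaw G faultless σ) hmeas
      change (executionLaw G faultless σ).real {ω | ¬ IsLegitimate G (ω (2 + 2 * s))} = _
        at hcompl
      linarith
    refine (ENNReal.ofReal_le_ofReal h1).trans ?_
    rw [ofReal_measureReal]
    refine measure_mono_ae ?_
    filter_upwards [ae_isLegitimate_mono faultless 0 (fun _ _ _ => rfl) σ] with ω h2 hω t ht
    have ht' : 2 + 2 * s ≤ t := by exact_mod_cast htime.trans ht
    rw [eq_of_forall_legitimate (Nat.zero_le _) h2 hω t ht']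
    exact hω

end

section

variable {V : Type*} [Fintype V] (G : SimpleGraph V) [DecidableRel G.Adj]

/-! ### The region of a fault -/

/-- A fault at `v` in the legitimate configuration `σ`, where `A` is a set of neighbors of `v`
that is independent. -/
structure FaultRegion (σ : Config V) (v : V) (A : Finset V) : Prop where
  legit : IsLegitimate G σ
  adj : ∀ w ∈ A, G.Adj v w
  indep : ∀ w ∈ A, ∀ u ∈ A, ¬ G.Adj w u

/-- The colors in `{0, …, δ(w)}` that no neighbor of `w` outside of `{v} ∪ A` has in `σ`. -/
def freeColors [DecidableEq V] (σ : Config V) (v : V) (A : Finset V) (w : V) :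
    Finset (Color (Fintype.card V)) :=
  {x | (x : ℕ) ≤ G.degree w ∧ ∀ u, u ≠ v → u ∉ A → G.Adj w u → (σ u).c ≠ some x}

/-- The configuration `τ` differs from the legitimate configuration `σ` in `{v} ∪ A` only, the
colors there cause no conflicts with the outside, and the final choices are consistent. -/
structure Contained [DecidableEq V] (σ : Config V) (v : V) (A : Finset V) (τ : Config V) :
    Prop where
  outside : ∀ u, u ≠ v → u ∉ A → τ u = σ u
  colors : ∀ u, (u = v ∨ u ∈ A) → ∀ x, (τ u).c = some x → x ∈ freeColors G σ v A u
  consistent : Consistent G τ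

variable {G} [DecidableEq V] {σ : Config V} {v : V} {A : Finset V} {τ τ' : Config V}

theorem mem_freeColors {w : V} {x : Color (Fintype.card V)} :
    x ∈ freeColors G σ v A w ↔
      (x : ℕ) ≤ G.degree w ∧ ∀ u, u ≠ v → u ∉ A → G.Adj w u → (σ u).c ≠ some x := by
  simp [freeColors]

theorem Contained.not_redraws (hA : FaultRegion G σ v A) (h : Contained G σ v A τ) {u : V}
    (hv : u ≠ v) (hu : u ∉ A) : ¬ Redraws G τ u :=
  h.consistent.not_redraws (by rw [h.outside u hv hu]; exact (hA.legit.1 u).1)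

theorem palette_subset_freeColors (hA : FaultRegion G σ v A)
    {m : V → Message (Fintype.card V)} (hm : ∀ u, u ≠ v → u ∉ A → m u = (σ u).broadcast) (w : V) :
    palette G m w ⊆ freeColors G σ v A w := by
  intro x hx
  obtain ⟨hxd, hxt⟩ := mem_palette.1 hx
  refine mem_freeColors.2 ⟨hxd, fun u hv hu hwu hux => ?_⟩
  have h1 := hxt u hwu (by rw [hm u hv hu]; exact hux)
  rw [hm u hv hu] at h1
  have h2 := (hA.legit.1 u).1
  rw [show (σ u).final = false from h1] at h2
  exact Bool.false_ne_true h2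

/-- A round in which no node outside of `{v} ∪ A` redraws leaves the fault contained. -/
theorem ae_contained_of_round (hA : FaultRegion G σ v A) (m : V → Message (Fintype.card V))
    (hm : ∀ u, u ≠ v → u ∉ A → m u = (σ u).broadcast)
    (hout : ∀ u, u ≠ v → u ∉ A → τ u = σ u)
    (hnot : ∀ u, u ≠ v → u ∉ A → newFinal G m u (τ u) = true)
    (hkeep : ∀ u, (u = v ∨ u ∈ A) → newFinal G m u (τ u) = true →
      ∀ x, (τ u).c = some x → x ∈ freeColors G σ v A u)
    (hcons : ∀ᵐ τ' ∂roundLaw G m τ, Consistent G τ') :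
    ∀ᵐ τ' ∂roundLaw G m τ, Contained G σ v A τ' := by
  filter_upwards [ae_roundLaw G m τ, hcons] with τ' h hc
  refine ⟨fun u hv hu => ?_, fun u hu x hx => ?_, hc⟩
  · rw [(h u).1 (hnot u hv hu), hout u hv hu]
    exact NodeState.ext rfl (hA.legit.1 u).1.symm
  · cases hf : newFinal G m u (τ u)
    · exact palette_subset_freeColors hA hm u (((h u).2 hf).2 x hx)
    · rw [(h u).1 hf] at hx
      exact hkeep u hu hf x hx

theorem Contained.ae_contained (hA : FaultRegion G σ v A) (h : Contained G σ v A τ) :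
    ∀ᵐ τ' ∂roundLaw G (fun w => (τ w).broadcast) τ, Contained G σ v A τ' := by
  refine ae_contained_of_round hA _ (fun u hv hu => by rw [h.outside u hv hu]) h.outside
    (fun u hv hu => ?_) (fun u hu _ => h.colors u hu) (ae_consistent G τ)
  have := h.not_redraws hA hv hu
  simpa [Redraws] using this

theorem Contained.redrawNbrs_subset (hA : FaultRegion G σ v A) (h : Contained G σ v A τ) :
    redrawNbrs G τ v ⊆ A := by
  intro w hw
  obtain ⟨h1, h2⟩ := Finset.mem_filter.1 hw
  by_contra hwA
  exact h.not_redraws hA (G.ne_of_adj (by simpa using h1)).symm hwA h2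

/-! ### The potential -/

/-- The probability that a node `w` draws the color `c`, if it draws a color and all free colors
are in its palette. -/
def drawProb (G : SimpleGraph V) [DecidableRel G.Adj] (σ : Config V) (v : V) (A : Finset V)
    (w : V) : Option (Color (Fintype.card V)) → ℝ
  | none => 0
  | some x => if x ∈ freeColors G σ v A w then ((freeColors G σ v A w).card : ℝ)⁻¹ else 0

theorem drawProb_nonneg (w : V) (c : Option (Color (Fintype.card V))) :
    0 ≤ drawProb G σ v A w c := by
  rcases c with _ | x
  · exact le_rfl
  · simp only [drawProb]
    split_ifs <;> positivity

/-- The potential of a configuration. If `v` is final it is the number of redrawing neighbors; if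
`v` is about to become final it is twice a bound for the mean of that number after the round; and
if `v` redraws, it is given by a function `ψ` of the number `i` of redrawing neighbors and of the lower
bound `n = 1 + i + j` for the size of the palette of `v`, where `j` is the number of
confirming neighbors. -/
def potential (G : SimpleGraph V) [DecidableRel G.Adj] (σ : Config V) (v : V) (A : Finset V)
    (ψ : ℕ → ℕ → ℝ) (τ : Config V) : ℝ :=
  if (τ v).final = true then ((redrawNbrs G τ v).card : ℝ)
  else if Redraws G τ v then
    ψ (redrawNbrs G τ v).card (1 + (redrawNbrs G τ v).card + (confirmNbrs G τ v).card)
  else ∑ w ∈ redrawNbrs G τ v, (1 + drawProb G σ v A w (τ v).c)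

/-- What the functions `ψ` of the potential have to satisfy for configurations with palette bound
`1 + i`, where `i` is the number of nodes of `A` that have just redrawn. -/
structure Admissible (ψ : ℕ → ℕ → ℝ) : Prop where
  one_le : ∀ i n : ℕ, 1 + i ≤ n → 1 ≤ ψ i n
  le_self : ∀ i s : ℕ, s ≤ i → (s : ℝ) ≤ ψ s (1 + i)
  concave : ∀ i s h : ℕ, s + h ≤ i →
    ψ (s + h) (1 + i) ≤ ψ s (1 + i) + h * (ψ (s + 1) (1 + i) - ψ s (1 + i))

theorem Consistent.update_of_not_final (h : Consistent G τ)
    (s : NodeState (Fintype.card V)) (hs : s.final = false) :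
    Consistent G (Function.update τ v s) := by
  intro u hu
  rcases eq_or_ne u v with rfl | huv
  · simp [hs] at hu
  · rw [Function.update_of_ne huv] at hu ⊢
    obtain ⟨x, hx, hxd, hw⟩ := h u hu
    refine ⟨x, hx, hxd, fun w huw hwx => ?_⟩
    rcases eq_or_ne w v with rfl | hwv
    · simpa using hs
    · rw [Function.update_of_ne hwv] at hwx ⊢
      exact hw w huw hwx

theorem redraws_iff_of_not_final {c : Option (Color (Fintype.card V))}
    (hc : ∀ x, c = some x → (x : ℕ) ≤ G.degree v) :
    Redraws G (Function.update τ v ⟨c, false⟩) v ↔ c = none ∨ ∃ w, G.Adj v w ∧ (τ w).c = c := by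
  rw [← not_iff_not, not_redraws_iff]
  rcases c with _ | x
  · simp
  · simp only [Function.update_self, Option.some.injEq, exists_eq_left', Bool.false_eq_true,
      false_and, imp_false, reduceCtorEq, false_or, not_exists, not_and]
    constructor
    · rintro ⟨-, h⟩ w hw
      have := h w hw
      rwa [Function.update_of_ne hw.ne'] at this
    · intro h
      refine ⟨hc x rfl, fun w hw => ?_⟩
      rw [Function.update_of_ne hw.ne']
      exact h w hw

/-- The redrawing neighbors of `v`, given that `v` has just drawn `c`. -/
theorem redrawNbrs_update (hA : FaultRegion G σ v A)
    (hsub : redrawNbrs G τ v ⊆ A)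
    (h : ∀ u, (¬ Redraws G τ u → τ' u = ⟨(τ u).c, true⟩) ∧
      (Redraws G τ u → (τ' u).final = false))
    (hc : Contained G σ v A τ') (c : Option (Color (Fintype.card V))) :
    redrawNbrs G (Function.update τ' v ⟨c, false⟩) v =
      (redrawNbrs G τ v).filter fun w => (τ' w).c = none ∨ (τ' w).c = c := by
  have hc' := hc.consistent.update_of_not_final (v := v) ⟨c, false⟩ rfl
  ext w
  by_cases hw : G.Adj v w
  swap
  · simp [redrawNbrs, hw]
  have hwv : w ≠ v := hw.ne'
  by_cases hr : Redraws G τ w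
  swap
  · have h1 : ¬ Redraws G (Function.update τ' v ⟨c, false⟩) w :=
      hc'.not_redraws (by rw [Function.update_of_ne hwv, (h w).1 hr])
    simp [redrawNbrs, hr, h1]
  have hwA : w ∈ A := hsub (by simp [redrawNbrs, hw, hr])
  have hfin := (h w).2 hr
  have key : Redraws G (Function.update τ' v ⟨c, false⟩) w ↔
      (τ' w).c = none ∨ (τ' w).c = c := by
    constructor
    · intro hred
      by_contra hno
      push Not at hno
      obtain ⟨x, hx⟩ := Option.ne_none_iff_exists'.1 hno.1
      obtain ⟨hxd, hxo⟩ := mem_freeColors.1 (hc.colors w (Or.inr hwA) x hx)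
      refine absurd hred (not_redraws_iff.2 ⟨x, by rw [Function.update_of_ne hwv, hx], hxd,
        fun u hu hux => ?_⟩)
      exfalso
      rcases eq_or_ne u v with rfl | huv
      · rw [Function.update_self] at hux
        exact hno.2 (hx.trans hux.symm)
      · rw [Function.update_of_ne huv] at hux
        by_cases huA : u ∈ A
        · exact hA.indep w hwA u huA hu
        · rw [hc.outside u huv huA] at hux
          exact hxo u huv huA hu hux
    · intro hor
      by_contra hno
      obtain ⟨x, hx, -, hx2⟩ := not_redraws_iff.1 hno
      rw [Function.update_of_ne hwv] at hx
      rcases hor with h0 | h0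
      · simp [h0] at hx
      · have := (hx2 v hw.symm (by rw [Function.update_self]; exact h0.symm.trans hx)).1
        rw [Function.update_of_ne hwv, hfin] at this
        exact Bool.false_ne_true this
  simp [redrawNbrs, hw, hr, key]

/-- The number of redrawing neighbors of `v` that draw `x`. -/
def drawers (G : SimpleGraph V) [DecidableRel G.Adj] (τ τ' : Config V) (v : V)
    (x : Color (Fintype.card V)) : ℕ :=
  ((redrawNbrs G τ v).filter fun w => (τ' w).c = some x).card

theorem sum_drawers_add_uncolored_le (P : Finset (Color (Fintype.card V))) :
    ∑ x ∈ P, drawers G τ τ' v x + uncolored (redrawNbrs G τ v) τ' ≤ (redrawNbrs G τ v).card := by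
  have h1 : ∑ x ∈ P, drawers G τ τ' v x ≤
      ((redrawNbrs G τ v).filter fun w => ¬ (τ' w).c = none).card := by
    unfold drawers
    rw [← Finset.card_biUnion]
    · refine Finset.card_le_card fun w hw => ?_
      obtain ⟨x, -, hx⟩ := Finset.mem_biUnion.1 hw
      obtain ⟨hw1, hw2⟩ := Finset.mem_filter.1 hx
      exact Finset.mem_filter.2 ⟨hw1, by simp [hw2]⟩
    · intro x _ y _ hxy
      rw [Function.onFun, Finset.disjoint_filter]
      intro w _ hx hy
      exact hxy (Option.some.inj (hx.symm.trans hy))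
  have h2 := Finset.card_filter_add_card_filter_not (s := redrawNbrs G τ v)
    (fun w => (τ' w).c = none)
  unfold uncolored
  omega

theorem card_redraws_or (x : Color (Fintype.card V)) :
    ((redrawNbrs G τ v).filter fun w => (τ' w).c = none ∨ (τ' w).c = some x).card =
      uncolored (redrawNbrs G τ v) τ' + drawers G τ τ' v x := by
  rw [Finset.filter_or, Finset.card_union_of_disjoint]
  · rfl
  · rw [Finset.disjoint_filter]
    intro w _ h1 h2
    simp [h1] at h2

theorem card_nbrs_update (h : RoundOutcome G τ τ') (hc : Contained G σ v A τ')
    (c : Option (Color (Fintype.card V))) :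
    (redrawNbrs G (Function.update τ' v ⟨c, false⟩) v).card +
      (confirmNbrs G (Function.update τ' v ⟨c, false⟩) v).card = (redrawNbrs G τ v).card := by
  refine card_redrawNbrs_add_card_confirmNbrs
    (hc.consistent.update_of_not_final (v := v) ⟨c, false⟩ rfl) fun w hw => ?_
  rw [Function.update_of_ne hw.ne']
  exact h.final_iff w

theorem potential_update_none (hA : FaultRegion G σ v A) (hsub : redrawNbrs G τ v ⊆ A)
    (h : RoundOutcome G τ τ') (hc : Contained G σ v A τ') (ψ : ℕ → ℕ → ℝ) :
    potential G σ v A ψ (Function.update τ' v ⟨none, false⟩) =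
      ψ (uncolored (redrawNbrs G τ v) τ') (1 + (redrawNbrs G τ v).card) := by
  rw [potential, if_neg (by simp), if_pos (redraws_of_c_eq_none (by simp)), add_assoc,
    card_nbrs_update h hc,
    redrawNbrs_update hA hsub (fun u => ⟨(h u).1, fun hu => ((h u).2 hu).1⟩) hc]
  simp [uncolored]

/-- The effect of a draw `x` of `v` on the potential. The color `x` is blocked if a neighbor
confirms it in the same round. -/
theorem potential_update_some_le (hA : FaultRegion G σ v A) (hsub : redrawNbrs G τ v ⊆ A)
    (h : RoundOutcome G τ τ') (hc : Contained G σ v A τ') {ψ : ℕ → ℕ → ℝ} (hψ : Admissible ψ)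
    {x : Color (Fintype.card V)} (hx : x ∈ palette G (fun w => (τ w).broadcast) v) :
    potential G σ v A ψ (Function.update τ' v ⟨some x, false⟩) ≤
      (if ∃ w ∈ confirmNbrs G τ v, (τ w).c = some x
        then ψ (uncolored (redrawNbrs G τ v) τ') (1 + (redrawNbrs G τ v).card)
        else (uncolored (redrawNbrs G τ v) τ' : ℝ)) +
      ∑ w ∈ redrawNbrs G τ v with (τ' w).c = none, drawProb G σ v A w (some x) +
      drawers G τ τ' v x *
        (ψ (uncolored (redrawNbrs G τ v) τ' + 1) (1 + (redrawNbrs G τ v).card) -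
          uncolored (redrawNbrs G τ v) τ') := by
  have hq : 0 ≤ ∑ w ∈ redrawNbrs G τ v with (τ' w).c = none, drawProb G σ v A w (some x) :=
    Finset.sum_nonneg fun w _ => drawProb_nonneg w _
  set B := redrawNbrs G τ v with hB
  set T := uncolored B τ' with hT
  set D := drawers G τ τ' v x with hD
  have hTD : T + D ≤ B.card := by
    rw [← card_redraws_or (v := v) (τ := τ) (τ' := τ') x]
    exact Finset.card_filter_le _ _
  obtain ⟨hxd, hxt⟩ := mem_palette.1 hx
  have hred := redrawNbrs_update hA hsub (fun u => ⟨(h u).1, fun hu => ((h u).2 hu).1⟩) hc (some x)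
  have hiff := redraws_iff_of_not_final (G := G) (τ := τ') (v := v) (c := some x)
    (fun y hy => by rw [← Option.some.inj hy]; exact hxd)
  rw [potential, if_neg (by simp)]
  have hT1 := hψ.le_self B.card T (by omega)
  split_ifs with hr hb hb
  · rw [add_assoc 1, card_nbrs_update h hc, hred, card_redraws_or]
    have h1 := hψ.concave B.card T D hTD
    have : (D : ℝ) * (ψ T (1 + B.card) - T) ≥ 0 := mul_nonneg (by positivity) (by linarith)
    nlinarith
  · rw [add_assoc 1, card_nbrs_update h hc, hred, card_redraws_or]
    have h1 := hψ.concave B.card T D hTD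
    have hD1 : 1 ≤ D := by
      obtain ⟨w, hw, hwx⟩ := (hiff.1 hr).resolve_left (by simp)
      refine Finset.card_pos.2 ⟨w, Finset.mem_filter.2 ⟨?_, hwx⟩⟩
      refine Finset.mem_filter.2 ⟨by simpa using hw, ?_⟩
      by_contra hwr
      have hwc : (τ w).c = some x := by
        rw [(h w).1 hwr] at hwx
        exact hwx
      exact hb ⟨w, Finset.mem_filter.2 ⟨by simpa using hw, hwr, hxt w hw hwc⟩, hwc⟩
    have hD1' : (1 : ℝ) ≤ D := by exact_mod_cast hD1
    have : ((D : ℝ) - 1) * (ψ T (1 + B.card) - T) ≥ 0 := mul_nonneg (by linarith) (by linarith)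
    nlinarith
  · exfalso
    obtain ⟨w, hw, hwx⟩ := hb
    obtain ⟨hw1, hw2, -⟩ := Finset.mem_filter.1 hw
    refine hr (hiff.2 (Or.inr ⟨w, by simpa using hw1, ?_⟩))
    rw [(h w).1 hw2]
    exact hwx
  · have hD0 : D = 0 := by
      rw [hD, drawers, Finset.card_eq_zero, Finset.filter_eq_empty_iff]
      intro w hw hwx
      exact hr (hiff.2 (Or.inr ⟨w, by simpa using (Finset.mem_filter.1 hw).1, hwx⟩))
    have hfil : (B.filter fun w => (τ' w).c = none ∨ (τ' w).c = some x) =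
        B.filter fun w => (τ' w).c = none := by
      have hD' := hD0
      rw [hD, drawers, Finset.card_eq_zero] at hD'
      rw [Finset.filter_or, hD', Finset.union_empty]
    rw [hred, hfil, hD0, Finset.sum_add_distrib]
    simp [hT, uncolored]

theorem sum_drawProb_le (P : Finset (Color (Fintype.card V))) (w : V) :
    ∑ x ∈ P, drawProb G σ v A w (some x) ≤ 1 := by
  simp only [drawProb]
  rw [← Finset.sum_filter, Finset.sum_const, nsmul_eq_mul, ← div_eq_mul_inv]
  refine div_le_one_of_le₀ ?_ (by positivity)
  have : P.filter (fun x => x ∈ freeColors G σ v A w) ⊆ freeColors G σ v A w :=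
    fun x hx => (Finset.mem_filter.1 hx).2
  exact_mod_cast Finset.card_le_card this

/-- The sum of the potential over all colors that `v` can draw. -/
theorem sum_potential_update_le (hA : FaultRegion G σ v A) (hsub : redrawNbrs G τ v ⊆ A)
    (h : RoundOutcome G τ τ') (hc : Contained G σ v A τ') {ψ : ℕ → ℕ → ℝ} (hψ : Admissible ψ)
    {i j T : ℕ} (hi : (redrawNbrs G τ v).card = i) (hj : (confirmNbrs G τ v).card = j)
    (hT : uncolored (redrawNbrs G τ v) τ' = T) :
    ∑ x ∈ palette G (fun w => (τ w).broadcast) v,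
        potential G σ v A ψ (Function.update τ' v ⟨some x, false⟩) ≤
      j * (ψ T (1 + i) - T) + (palette G (fun w => (τ w).broadcast) v).card * T + T +
        ((i : ℝ) - T) * (ψ (T + 1) (1 + i) - T) := by
  set P := palette G (fun w => (τ w).broadcast) v
  have hTi : T ≤ i := by
    rw [← hi, ← hT]
    exact uncolored_le _ _
  have hV := hψ.le_self i T hTi
  refine (Finset.sum_le_sum fun x hx => potential_update_some_le hA hsub h hc hψ hx).trans ?_
  rw [hi, hT, Finset.sum_add_distrib, Finset.sum_add_distrib, ← Finset.sum_mul]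
  have h1 : ∑ x ∈ P, (if ∃ w ∈ confirmNbrs G τ v, (τ w).c = some x then ψ T (1 + i) else (T : ℝ))
      ≤ j * (ψ T (1 + i) - T) + P.card * T := by
    have hcard : (P.filter fun x => ∃ w ∈ confirmNbrs G τ v, (τ w).c = some x).card ≤ j := by
      rw [← hj, ← Finset.card_image_of_injective _
        (Option.some_injective (Color (Fintype.card V)))]
      refine (Finset.card_le_card (t := (confirmNbrs G τ v).image fun w => (τ w).c) ?_).trans
        Finset.card_image_le
      intro y hy
      obtain ⟨x, hx, rfl⟩ := Finset.mem_image.1 hy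
      obtain ⟨w, hw, hwx⟩ := (Finset.mem_filter.1 hx).2
      exact Finset.mem_image.2 ⟨w, hw, hwx⟩
    have hcard' : ((P.filter fun x => ∃ w ∈ confirmNbrs G τ v, (τ w).c = some x).card : ℝ) ≤ j := by
      exact_mod_cast hcard
    have : ∀ x, (if ∃ w ∈ confirmNbrs G τ v, (τ w).c = some x then ψ T (1 + i) else (T : ℝ)) =
        (if ∃ w ∈ confirmNbrs G τ v, (τ w).c = some x then ψ T (1 + i) - T else 0) + T := by
      intro x
      split_ifs <;> ring
    simp only [this]
    rw [Finset.sum_add_distrib, ← Finset.sum_filter, Finset.sum_const, Finset.sum_const,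
      nsmul_eq_mul, nsmul_eq_mul]
    gcongr
  have h2 : ∑ x ∈ P, ∑ w ∈ redrawNbrs G τ v with (τ' w).c = none, drawProb G σ v A w (some x) ≤
      T := by
    rw [Finset.sum_comm]
    refine (Finset.sum_le_sum fun w _ => sum_drawProb_le P w).trans_eq ?_
    rw [← hT]
    simp [uncolored]
  have h3 : (∑ x ∈ P, (drawers G τ τ' v x : ℝ)) * (ψ (T + 1) (1 + i) - T) ≤
      ((i : ℝ) - T) * (ψ (T + 1) (1 + i) - T) := by
    have hsum := sum_drawers_add_uncolored_le (G := G) (τ := τ) (τ' := τ') (v := v) P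
    rw [hT, hi] at hsum
    have hsum' : (∑ x ∈ P, (drawers G τ τ' v x : ℝ)) ≤ (i : ℝ) - T := by
      have : ((∑ x ∈ P, drawers G τ τ' v x : ℕ) : ℝ) + T ≤ i := by exact_mod_cast hsum
      push_cast at this
      linarith
    rcases hTi.lt_or_eq with hlt | heq
    · have := hψ.le_self i (T + 1) hlt
      push_cast at this
      exact mul_le_mul_of_nonneg_right hsum' (by linarith)
    · have h0 : (∑ x ∈ P, (drawers G τ τ' v x : ℝ)) = 0 := by
        refine le_antisymm (hsum'.trans_eq (by rw [heq]; ring)) (by positivity)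
      rw [h0, heq]
      simp
  linarith

/-- The mean potential after a round in which `v` redraws, given a lower bound `M` for the size
of the palette of `v`. -/
theorem integral_potential_le_of_redraws (hA : FaultRegion G σ v A)
    (hsub : redrawNbrs G τ v ⊆ A) (hv : Redraws G τ v)
    (hc : ∀ᵐ τ' ∂roundLaw G (fun w => (τ w).broadcast) τ, Contained G σ v A τ')
    {ψ : ℕ → ℕ → ℝ} (hψ : Admissible ψ) {i j M : ℕ}
    (hi : (redrawNbrs G τ v).card = i) (hj : (confirmNbrs G τ v).card = j)
    (hM0 : 0 < M) (hM : M ≤ (palette G (fun w => (τ w).broadcast) v).card) :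
    ∫ τ', potential G σ v A ψ τ' ∂roundLaw G (fun w => (τ w).broadcast) τ ≤
      coinMean i (fun s => ψ s (1 + i) + s + (j * (ψ s (1 + i) - s) + s +
        ((i : ℝ) - s) * (ψ (s + 1) (1 + i) - s)) / M) / 2 := by
  set m := fun w => (τ w).broadcast with hm
  set f : ℕ → ℝ := fun s => ψ s (1 + i) + s + (j * (ψ s (1 + i) - s) + s +
        ((i : ℝ) - s) * (ψ (s + 1) (1 + i) - s)) / M with hf
  have hbits := integral_uncolored G m τ (redrawNbrs G τ v)
    (fun w hw => redraws_of_mem_redrawNbrs hw) f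
  rw [hi] at hbits
  rw [← hbits, integral_roundLaw_of_false G m τ v hv, ← integral_div]
  refine integral_roundLaw_mono G m τ ?_
  filter_upwards [hc, ae_round G τ] with τ' hc' h
  set T := uncolored (redrawNbrs G τ v) τ' with hT
  have hTi : T ≤ i := by
    rw [← hi]
    exact uncolored_le _ _
  have hsum := sum_potential_update_le hA hsub h hc' hψ hi hj hT.symm
  have hV := hψ.le_self i T hTi
  have hbr : 0 ≤ j * (ψ T (1 + i) - T) + T + ((i : ℝ) - T) * (ψ (T + 1) (1 + i) - T) := by
    have h1 : 0 ≤ j * (ψ T (1 + i) - T) := mul_nonneg (by positivity) (by linarith)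
    have h2 : 0 ≤ ((i : ℝ) - T) * (ψ (T + 1) (1 + i) - T) := by
      rcases hTi.lt_or_eq with hlt | heq
      · have := hψ.le_self i (T + 1) hlt
        push_cast at this
        have hlt' : (T : ℝ) < i := by exact_mod_cast hlt
        exact mul_nonneg (by linarith) (by linarith)
      · rw [heq]
        simp
    have h3 : (0 : ℝ) ≤ T := by positivity
    linarith
  rw [potential_update_none hA hsub h hc', hi]
  have hNpos : (0 : ℝ) < (palette G m v).card := by exact_mod_cast card_palette_pos G m v
  have hMpos : (0 : ℝ) < M := by exact_mod_cast hM0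
  have hMN : (M : ℝ) ≤ (palette G m v).card := by exact_mod_cast hM
  have h4 : (∑ x ∈ palette G m v, potential G σ v A ψ (Function.update τ' v ⟨some x, false⟩)) /
      (2 * (palette G m v).card) ≤
      (T + (j * (ψ T (1 + i) - T) + T + ((i : ℝ) - T) * (ψ (T + 1) (1 + i) - T)) / M) / 2 := by
    rw [div_le_iff₀ (by positivity)]
    have h5 : j * (ψ T (1 + i) - T) + T + ((i : ℝ) - T) * (ψ (T + 1) (1 + i) - T) ≤
        (j * (ψ T (1 + i) - T) + T + ((i : ℝ) - T) * (ψ (T + 1) (1 + i) - T)) / M *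
          (palette G m v).card := by
      rw [div_mul_eq_mul_div, le_div_iff₀ hMpos]
      exact mul_le_mul_of_nonneg_left hMN hbr
    linarith
  simp only [hf]
  linarith

end

section

variable {V : Type*} [Fintype V] {G : SimpleGraph V} [DecidableRel G.Adj]
  [DecidableEq V] {σ : Config V} {v : V} {A : Finset V} {τ τ' : Config V}

/-- If `v` does not redraw, then afterwards only those neighbors redraw that have drawn `⊥` or the
color of `v`. -/
theorem redrawNbrs_subset_of_not_redraws (hA : FaultRegion G σ v A)
    (hsub : redrawNbrs G τ v ⊆ A) (h : RoundOutcome G τ τ') (hc : Contained G σ v A τ')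
    (hv : ¬ Redraws G τ v) :
    redrawNbrs G τ' v ⊆
      (redrawNbrs G τ v).filter fun w => (τ' w).c = none ∨ (τ' w).c = (τ v).c := by
  intro w hw
  obtain ⟨hvw, hred⟩ := Finset.mem_filter.1 hw
  have hvw' : G.Adj v w := by simpa using hvw
  have hr : Redraws G τ w := by
    by_contra hr
    exact hc.consistent.not_redraws ((h.final_iff w).2 hr) hred
  have hwB : w ∈ redrawNbrs G τ v := Finset.mem_filter.2 ⟨hvw, hr⟩
  refine Finset.mem_filter.2 ⟨hwB, ?_⟩
  by_contra hno
  push Not at hno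
  obtain ⟨x, hx⟩ := Option.ne_none_iff_exists'.1 hno.1
  obtain ⟨hxd, hxo⟩ := mem_freeColors.1 (hc.colors w (Or.inr (hsub hwB)) x hx)
  refine absurd hred (not_redraws_iff.2 ⟨x, hx, hxd, fun u hu hux => ?_⟩)
  exfalso
  rcases eq_or_ne u v with rfl | huv
  · rw [(h u).1 hv] at hux
    exact hno.2 (hx.trans hux.symm)
  · by_cases huA : u ∈ A
    · exact hA.indep w (hsub hwB) u huA hu
    · rw [hc.outside u huv huA] at hux
      exact hxo u huv huA hu hux

theorem integral_roundLaw_apply_of_false (m : V → Message (Fintype.card V)) (w : V)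
    (hw : newFinal G m w (τ w) = false) (f : NodeState (Fintype.card V) → ℝ) :
    ∫ τ', f (τ' w) ∂roundLaw G m τ = f ⟨none, false⟩ / 2 +
        (∑ x ∈ palette G m w, f ⟨some x, false⟩) / (2 * (palette G m w).card) := by
  rw [integral_roundLaw_of_false G m τ w hw (fun τ' => f (τ' w))]
  simp

/-- The probability that `w` redraws after the next round is at most half of its contribution to
the potential. -/
theorem integral_uncolored_or_eq_le (m : V → Message (Fintype.card V)) (w : V)
    (hw : newFinal G m w (τ w) = false) (c : Option (Color (Fintype.card V))) (q : ℝ)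
    (hq : ∀ x ∈ palette G m w, c = some x → ((palette G m w).card : ℝ)⁻¹ ≤ q) (hq0 : 0 ≤ q) :
    ∫ τ', (if (τ' w).c = none ∨ (τ' w).c = c then (1 : ℝ) else 0) ∂roundLaw G m τ ≤
      (1 + q) / 2 := by
  rw [integral_roundLaw_apply_of_false m w hw
    (fun s => if s.c = none ∨ s.c = c then (1 : ℝ) else 0)]
  simp only [true_or, if_true, reduceCtorEq, false_or]
  have hN : (0 : ℝ) < (palette G m w).card := by exact_mod_cast card_palette_pos G m w
  have : ∑ x ∈ palette G m w, (if some x = c then (1 : ℝ) else 0) ≤ (palette G m w).card * q := by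
    rcases c with _ | y
    · simp only [reduceCtorEq, if_false, Finset.sum_const_zero]
      positivity
    · simp only [Option.some.injEq, Finset.sum_ite_eq']
      split_ifs with hy
      · have := hq y hy rfl
        rwa [inv_le_iff_one_le_mul₀' hN] at this
      · positivity
  rw [add_div]
  refine add_le_add le_rfl ?_
  rw [div_le_iff₀ (by positivity)]
  linarith

theorem Contained.palette_eq_freeColors (hA : FaultRegion G σ v A) (h : Contained G σ v A τ)
    (hv : (τ v).final = false) {w : V} (hw : w ∈ A) :
    palette G (fun u => (τ u).broadcast) w = freeColors G σ v A w := by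
  refine (palette_subset_freeColors hA (fun u hv hu => by rw [h.outside u hv hu]) w).antisymm ?_
  intro x hx
  obtain ⟨hxd, hxo⟩ := mem_freeColors.1 hx
  refine mem_palette.2 ⟨hxd, fun u hu hux => ?_⟩
  rcases eq_or_ne u v with rfl | huv
  · exact hv
  · by_cases huA : u ∈ A
    · exact absurd hu (hA.indep w hw u huA)
    · refine absurd ?_ (hxo u huv huA hu)
      rw [← h.outside u huv huA]
      exact hux

/-- Passing from the potential of `ψ` to that of `ψ'`, the mean potential is at least halved in a
round in which `v` redraws (compare `integral_potential_le_of_redraws`, for the palette bound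
`1 + i + j`). The summation variable is the number of neighbors that draw `⊥`. -/
structure IsStep (ψ ψ' : ℕ → ℕ → ℝ) : Prop where
  coinMean_le : ∀ i j : ℕ, coinMean i (fun s => ψ' s (1 + i) + s + (j * (ψ' s (1 + i) - s) + s +
        ((i : ℝ) - s) * (ψ' (s + 1) (1 + i) - s)) / ((1 + i + j : ℕ) : ℝ)) ≤ ψ i (1 + i + j)

/-- If `v` does not redraw, then no function `ψ` is involved, and the redrawing neighbors of `v`
recover independently of each other. -/
theorem Contained.integral_potential_le (hA : FaultRegion G σ v A) (h : Contained G σ v A τ)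
    {ψ ψ' : ℕ → ℕ → ℝ} (hψ' : Admissible ψ') (hstep : IsStep ψ ψ') :
    ∫ τ', potential G σ v A ψ' τ' ∂roundLaw G (fun w => (τ w).broadcast) τ ≤
      potential G σ v A ψ τ / 2 := by
  set m := fun w => (τ w).broadcast with hm
  have hsub := h.redrawNbrs_subset hA
  by_cases hv : Redraws G τ v
  · have hf := h.consistent.final_eq_false hv
    rw [potential, if_neg (by simp [hf]), if_pos hv]
    refine (integral_potential_le_of_redraws hA hsub hv (h.ae_contained hA) hψ' rfl rfl
      (by omega) (h.consistent.card_palette_ge v)).trans ?_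
    gcongr
    exact hstep.coinMean_le _ _
  · set q : V → ℝ := fun w => if (τ v).final = true then 0 else drawProb G σ v A w (τ v).c with hq
    have hpot : potential G σ v A ψ τ = ∑ w ∈ redrawNbrs G τ v, (1 + q w) := by
      rw [potential, if_neg hv]
      by_cases hf : (τ v).final = true
      · simp [hq, hf]
      · simp [hq, hf]
    have hle : ∀ᵐ τ' ∂roundLaw G m τ, potential G σ v A ψ' τ' ≤
        ∑ w ∈ redrawNbrs G τ v, if (τ' w).c = none ∨ (τ' w).c = (τ v).c then (1 : ℝ) else 0 := by
      filter_upwards [ae_round G τ, h.ae_contained hA] with τ' hr hc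
      rw [potential, if_pos ((hr.final_iff v).2 hv), Finset.sum_boole]
      exact_mod_cast Finset.card_le_card (redrawNbrs_subset_of_not_redraws hA hsub hr hc hv)
    refine (integral_roundLaw_mono G m τ hle).trans ?_
    rw [integral_finsetSum _ fun w _ => Integrable.of_finite, hpot, Finset.sum_div]
    refine Finset.sum_le_sum fun w hw => ?_
    have hvw : G.Adj v w := by simpa using (Finset.mem_filter.1 hw).1
    refine integral_uncolored_or_eq_le m w (redraws_of_mem_redrawNbrs hw) _ _ ?_ ?_
    · intro x hx hcx
      by_cases hf : (τ v).final = true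
      · have := (mem_palette.1 hx).2 v hvw.symm hcx
        rw [show (m v).2 = (τ v).final from rfl, hf] at this
        simp at this
      · have hpal := h.palette_eq_freeColors hA (by simpa using hf) (hsub hw)
        rw [hpal] at hx ⊢
        simp only [hq, if_neg hf, hcx, drawProb, if_pos hx]
        exact le_rfl
    · simp only [hq]
      split_ifs
      · exact le_rfl
      · exact drawProb_nonneg w _

/-- The potential counts at least one if some node redraws, since only `v` and nodes of `A` can
redraw. -/
theorem Contained.one_le_potential (hA : FaultRegion G σ v A) (h : Contained G σ v A τ)
    {ψ : ℕ → ℕ → ℝ} (hψ : Admissible ψ) :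
    0 ≤ potential G σ v A ψ τ ∧ ((∃ u, Redraws G τ u) → 1 ≤ potential G σ v A ψ τ) := by
  have hnbr : (∃ u, Redraws G τ u) → ¬ Redraws G τ v →
      (1 : ℝ) ≤ (redrawNbrs G τ v).card := by
    rintro ⟨u, hu⟩ hv
    have huv : u ≠ v := fun h => hv (h ▸ hu)
    have huA : u ∈ A := by
      by_contra huA
      exact h.not_redraws hA huv huA hu
    have : 0 < (redrawNbrs G τ v).card :=
      Finset.card_pos.2 ⟨u, Finset.mem_filter.2 ⟨by simpa using hA.adj u huA, hu⟩⟩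
    exact_mod_cast this
  unfold potential
  split_ifs with hf hr
  · exact ⟨by positivity, fun hu => hnbr hu (h.consistent.not_redraws hf)⟩
  · have := hψ.one_le _ (1 + (redrawNbrs G τ v).card + (confirmNbrs G τ v).card)
      (Nat.le_add_right _ _)
    exact ⟨by linarith, fun _ => this⟩
  · have hsum : ((redrawNbrs G τ v).card : ℝ) ≤
        ∑ w ∈ redrawNbrs G τ v, (1 + drawProb G σ v A w (τ v).c) := by
      rw [Finset.sum_add_distrib]
      have := Finset.sum_nonneg fun w (_ : w ∈ redrawNbrs G τ v) =>
        drawProb_nonneg (G := G) (σ := σ) (v := v) (A := A) w (τ v).c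
      simpa using this
    exact ⟨le_trans (by positivity) hsum, fun hu => (hnbr hu hr).trans hsum⟩

/-! ### Tails of the recovery time -/

variable {d : Transport V} {τ₀ : Config V}

theorem ae_contained_succ (hA : FaultRegion G σ v A)
    (hd : ∀ t, 1 ≤ t → ∀ τ, d t τ = fun w => (τ w).broadcast)
    (h0 : ∀ᵐ τ ∂roundLaw G (d 0 τ₀) τ₀, Contained G σ v A τ) :
    ∀ᵐ ω ∂executionLaw G d τ₀, ∀ t, Contained G σ v A (ω (t + 1)) := by
  have h := ae_forall_round G d τ₀ (fun t τ τ' => (t = 0 → τ = τ₀ → Contained G σ v A τ') ∧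
    (1 ≤ t → Contained G σ v A τ → Contained G σ v A τ')) (fun t τ => by
      rcases Nat.eq_zero_or_pos t with rfl | ht
      · by_cases hτ : τ = τ₀
        · subst hτ
          filter_upwards [h0] with τ' h
          exact ⟨fun _ _ => h, fun h => absurd h (by norm_num)⟩
        · exact Filter.Eventually.of_forall fun τ' =>
            ⟨fun _ h => absurd h hτ, fun h => absurd h (by norm_num)⟩
      · by_cases hτ : Contained G σ v A τ
        · rw [hd t ht]
          filter_upwards [hτ.ae_contained hA] with τ' h
          exact ⟨fun h => absurd h ht.ne', fun _ _ => h⟩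
        · exact Filter.Eventually.of_forall fun τ' =>
            ⟨fun h => absurd h ht.ne', fun _ h => absurd h hτ⟩)
  filter_upwards [h, ae_apply_zero G d τ₀] with ω hω hω0 t
  induction t with
  | zero => exact (hω 0).1 rfl hω0
  | succ t ih => exact (hω (t + 1)).2 (by omega) ih

/-- The potential, hence the probability of an illegitimate configuration, is halved in every
round. -/
theorem measureReal_not_isLegitimate_le_pow (hA : FaultRegion G σ v A)
    (hd : ∀ t, 1 ≤ t → ∀ τ, d t τ = fun w => (τ w).broadcast)
    (h0 : ∀ᵐ τ ∂roundLaw G (d 0 τ₀) τ₀, Contained G σ v A τ)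
    (Ψ : ℕ → ℕ → ℕ → ℝ) (hΨ : ∀ t, Admissible (Ψ t)) (hstep : ∀ t, IsStep (Ψ t) (Ψ (t + 1)))
    {C : ℝ} (hC : ∫ τ, potential G σ v A (Ψ 0) τ ∂roundLaw G (d 0 τ₀) τ₀ ≤ C / 2) (t : ℕ) :
    (executionLaw G d τ₀).real {ω | ¬ IsLegitimate G (ω (t + 2))} ≤ C * (1 / 2) ^ (t + 1) := by
  have hcont := ae_contained_succ hA hd h0
  refine (measureReal_not_isLegitimate_le_integral G d τ₀ (t + 1) (hd _ (by omega))
    (potential G σ v A (Ψ t)) ?_).trans ?_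
  · filter_upwards [hcont] with ω h
    exact (h t).one_le_potential hA (hΨ t)
  · induction t with
    | zero =>
      rw [integral_round]
      have := integral_apply_zero G d τ₀ fun τ => ∫ τ', potential G σ v A (Ψ 0) τ'
        ∂roundLaw G (d 0 τ) τ
      rw [this]
      linarith
    | succ t ih =>
      refine (integral_round_le G d τ₀ (t + 1) (fun τ => potential G σ v A (Ψ t) τ / 2)
        (potential G σ v A (Ψ (t + 1))) ?_).trans ?_
      · filter_upwards [hcont] with ω h
        rw [hd (t + 1) (by omega)]
        exact (h t).integral_potential_le hA (hΨ _) (hstep t)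
      · rw [integral_div, pow_succ]
        linarith

/-- A node that redraws in the first round becomes final only after it has drawn a color. -/
theorem measureReal_isLegitimate_le_pow (hd : ∀ t, 1 ≤ t → ∀ τ, d t τ = fun w => (τ w).broadcast)
    (S : Finset V) (hS : ∀ u ∈ S, newFinal G (d 0 τ₀) u (τ₀ u) = false) (hS0 : S.Nonempty)
    (t : ℕ) :
    (executionLaw G d τ₀).real {ω | IsLegitimate G (ω (t + 1))} ≤
      (1 - (1 / 2) ^ t) ^ S.card := by
  -- An upper bound for the probability that all nodes of `S` without color have drawn one after
  -- `k` further rounds.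
  set g : ℕ → Config V → ℝ := fun k τ =>
    ∏ u ∈ S, (1 - (1 / 2) ^ k * if (τ u).c = none then (1 : ℝ) else 0) with hg
  have hint : ∀ (k : ℕ) (m : V → Message (Fintype.card V)) (τ : Config V),
      ∫ τ', g k τ' ∂roundLaw G m τ = ∏ u ∈ S, ∫ s : NodeState (Fintype.card V),
        (1 - (1 / 2) ^ k * if s.c = none then (1 : ℝ) else 0)
          ∂(nodeRound G m u (τ u)).toMeasure := by
    intro k m τ
    have h := integral_roundLaw_prod G m τ fun u s =>
      if u ∈ S then (1 - (1 / 2) ^ k * if s.c = none then (1 : ℝ) else 0) else 1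
    have h1 : ∀ f : V → ℝ, ∏ u, (if u ∈ S then f u else 1) = ∏ u ∈ S, f u := by
      intro f
      rw [Finset.prod_ite_mem, Finset.univ_inter]
    simp only [h1] at h
    rw [hg]
    refine h.trans ?_
    rw [← h1]
    refine Finset.prod_congr rfl fun u _ => ?_
    split_ifs
    · rfl
    · simp
  have hfalse : ∀ (k : ℕ) (m : V → Message (Fintype.card V)) (τ : Config V) (u : V),
      newFinal G m u (τ u) = false → ∫ s : NodeState (Fintype.card V),
        (1 - (1 / 2) ^ k * if s.c = none then (1 : ℝ) else 0)
          ∂(nodeRound G m u (τ u)).toMeasure = 1 - (1 / 2) ^ (k + 1) := by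
    intro k m τ u hu
    have hN : ((palette G m u).card : ℝ) ≠ 0 := by exact_mod_cast (card_palette_pos G m u).ne'
    rw [integral_nodeRound_of_false G m u _ hu]
    simp only [if_true, reduceCtorEq, if_false, mul_zero, sub_zero, Finset.sum_const, nsmul_eq_mul]
    rw [pow_succ]
    field_simp
    ring
  have hround : ∀ (k : ℕ) (τ : Config V),
      ∫ τ', g k τ' ∂roundLaw G (fun w => (τ w).broadcast) τ ≤ g (k + 1) τ := by
    intro k τ
    rw [hint]
    have hp0 : (0 : ℝ) ≤ (1 / 2) ^ k := by positivity
    have hp1 : ((1 : ℝ) / 2) ^ k ≤ 1 := pow_le_one₀ (by norm_num) (by norm_num)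
    have hp3 : (0 : ℝ) ≤ (1 / 2) ^ (k + 1) := by positivity
    have hp2 : ((1 : ℝ) / 2) ^ (k + 1) ≤ 1 := pow_le_one₀ (by norm_num) (by norm_num)
    refine Finset.prod_le_prod (fun u _ => integral_nonneg fun s => ?_) fun u _ => ?_
    · simp only [Pi.zero_apply]
      split_ifs <;> linarith
    · by_cases hu : Redraws G τ u
      · rw [hfalse k _ τ u hu]
        split_ifs <;> linarith
      · rw [integral_nodeRound_of_true G _ u _ (by simpa [Redraws] using hu)]
        have hc : (τ u).c ≠ none := fun h => hu (redraws_of_c_eq_none h)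
        simp [hc]
  have htail : ∀ t k : ℕ, ∫ ω, g k (ω (t + 1)) ∂executionLaw G d τ₀ ≤
      (1 - (1 / 2) ^ (k + t + 1)) ^ S.card := by
    intro t
    induction t with
    | zero =>
      intro k
      rw [integral_round]
      have := integral_apply_zero G d τ₀ fun τ => ∫ τ', g k τ' ∂roundLaw G (d 0 τ) τ
      rw [this, hint, Finset.prod_congr rfl fun u hu => hfalse k _ τ₀ u (hS u hu),
        Finset.prod_const]
    | succ t ih =>
      intro k
      refine (integral_round_le G d τ₀ (t + 1) (g (k + 1)) (g k) ?_).trans ?_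
      · refine Filter.Eventually.of_forall fun ω => ?_
        rw [hd (t + 1) (by omega)]
        exact hround k _
      · have := ih (k + 1)
        rwa [show k + 1 + t + 1 = k + (t + 1) + 1 by ring] at this
  have hmeas : MeasurableSet {ω : ℕ → Config V | IsLegitimate G (ω (t + 1))} :=
    (Set.toFinite {τ | IsLegitimate G τ}).measurableSet.preimage (measurable_pi_apply _)
  -- After one round the nodes of `S` are not final; in general, a legitimate configuration at
  -- time `t + 2` requires that no node of `S` has the color `⊥` at time `t + 1`.
  rcases t with _ | t
  · have hzero : ∀ᵐ ω ∂executionLaw G d τ₀, ¬ IsLegitimate G (ω 1) := by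
      have h := ae_forall_round G d τ₀ (fun t τ τ' => t = 0 → τ = τ₀ → ¬ IsLegitimate G τ')
        (fun t τ => by
          by_cases hh : t = 0 ∧ τ = τ₀
          · obtain ⟨rfl, rfl⟩ := hh
            filter_upwards [ae_roundLaw G (d 0 τ) τ] with τ' h _ _ hleg
            obtain ⟨u, hu⟩ := hS0
            have h1 := ((h u).2 (hS u hu)).1
            rw [(hleg.1 u).1] at h1
            simp at h1
          · exact Filter.Eventually.of_forall fun τ' h1 h2 => absurd ⟨h1, h2⟩ hh)
      filter_upwards [h, ae_apply_zero G d τ₀] with ω hω hω0 using hω 0 rfl hω0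
    have : (executionLaw G d τ₀).real {ω | IsLegitimate G (ω (0 + 1))} = 0 := by
      rw [measureReal_eq_zero_iff (measure_ne_top _ _)]
      have := ae_iff.1 hzero
      simpa only [not_not] using this
    rw [this]
    simp
  · refine le_trans ?_ ((htail t 0).trans_eq (by rw [zero_add]))
    rw [← integral_indicator_one hmeas]
    refine integral_mono_ae ((integrable_const (1 : ℝ)).indicator hmeas)
      (integrable_apply G d τ₀ (t + 1) (g 0)) ?_
    have h := ae_forall_round G d τ₀ (fun t τ τ' => 1 ≤ t → ∀ u, (τ' u).final = true →
      (τ u).c ≠ none) (fun t τ => by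
        by_cases ht : 1 ≤ t
        · rw [hd t ht]
          filter_upwards [ae_final_iff G τ] with τ' h _ u hu hn
          exact (h u).1 hu (redraws_of_c_eq_none hn)
        · exact Filter.Eventually.of_forall fun τ' h1 => absurd h1 ht)
    filter_upwards [h] with ω hω
    by_cases hleg : IsLegitimate G (ω (t + 1 + 1))
    · have : g 0 (ω (t + 1)) = 1 := by
        refine Finset.prod_eq_one fun u _ => ?_
        rw [if_neg (hω (t + 1) (by omega) u (hleg.1 u).1)]
        ring
      simp [hleg, this]
    · have : 0 ≤ g 0 (ω (t + 1)) := by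
        refine Finset.prod_nonneg fun u _ => ?_
        split_ifs <;> norm_num
      simpa [Set.indicator_apply, hleg] using this

end

section

/-! ### Quadratic potentials -/

theorem coinMean_cubic (i : ℕ) (a b c d : ℝ) :
    coinMean i (fun s => a + b * s + c * (s : ℝ) ^ 2 + d * (s : ℝ) ^ 3) =
      a + b * (i / 2) + c * (((i : ℝ) ^ 2 + i) / 4) + d * (((i : ℝ) ^ 3 + 3 * (i : ℝ) ^ 2) / 8) := by
  simp only [coinMean_add, coinMean_const, coinMean_const_mul, coinMean_id, coinMean_sq,
    coinMean_cube]

/-- The functions `ψ` used in the potential. -/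
def quadratic (α μ c d b : ℝ) (i n : ℕ) : ℝ :=
  α * i + μ - (c * (i : ℝ) ^ 2 + d * i + b) / n

theorem quadratic_mul (α μ c d b : ℝ) (i n : ℕ) (hn : (0 : ℝ) < n) :
    quadratic α μ c d b i n * n = (α * i + μ) * n - (c * (i : ℝ) ^ 2 + d * i + b) := by
  unfold quadratic
  field_simp

theorem quadratic_admissible {α μ c d b : ℝ} (hc : 0 ≤ c) (hb : 0 ≤ b)
    (h1 : c + 1 ≤ α) (h2 : d + 1 ≤ α) (h3 : b + 1 ≤ μ) : Admissible (quadratic α μ c d b) := by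
  have key : ∀ s n : ℕ, 1 + s ≤ n →
      (c * (s : ℝ) ^ 2 + d * s + b) / n ≤ (α - 1) * s + (μ - 1) := by
    intro s n hn
    have hn' : (1 + s : ℝ) ≤ n := by exact_mod_cast hn
    have hs : (0 : ℝ) ≤ s := by positivity
    rw [div_le_iff₀ (by linarith)]
    have h4 : 0 ≤ (α - 1) * s + (μ - 1) := by
      have : 0 ≤ (α - 1) * s := mul_nonneg (by linarith) hs
      linarith
    refine le_trans ?_ (mul_le_mul_of_nonneg_left hn' h4)
    nlinarith [mul_nonneg (sub_nonneg.2 h1) (mul_nonneg hs hs), mul_nonneg (sub_nonneg.2 h2) hs,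
      mul_nonneg (show 0 ≤ μ - 1 by linarith) hs]
  refine ⟨fun i n hn => ?_, fun i s hs => ?_, fun i s h _ => ?_⟩
  · have h5 := key i n hn
    have hi : (0 : ℝ) ≤ i := by positivity
    unfold quadratic
    linarith
  · have h5 := key s (1 + i) (by omega)
    unfold quadratic
    linarith
  · have hh : (h : ℝ) ≤ (h : ℝ) ^ 2 := by exact_mod_cast Nat.le_self_pow two_ne_zero h
    have hN : (0 : ℝ) < 1 + i := by positivity
    have : quadratic α μ c d b s (1 + i) + h * (quadratic α μ c d b (s + 1) (1 + i) -
        quadratic α μ c d b s (1 + i)) - quadratic α μ c d b (s + h) (1 + i) =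
        c * ((h : ℝ) ^ 2 - h) / (1 + i) := by
      unfold quadratic
      push_cast
      field_simp
      ring
    have h6 : 0 ≤ c * ((h : ℝ) ^ 2 - h) / (1 + i) :=
      div_nonneg (mul_nonneg hc (by linarith)) hN.le
    linarith

/-- The mean of the potential after a round in which `v` redraws, for a quadratic `ψ`. -/
theorem coinMean_quadratic (α μ c d b : ℝ) (i : ℕ) (j M : ℝ) (hM : 0 < M) :
    coinMean i (fun s => quadratic α μ c d b s (1 + i) + s +
      (j * (quadratic α μ c d b s (1 + i) - s) + s +
        ((i : ℝ) - s) * (quadratic α μ c d b (s + 1) (1 + i) - s)) / M) =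
    (((M + j) * (μ * (1 + i) - b) + i * ((μ + α) * (1 + i) - b - c - d)) +
      ((M + j) * (α * (1 + i) - d) + (M - j + 1) * (1 + i) - ((μ + α) * (1 + i) - b - c - d) +
        i * (α * (1 + i) - d - 2 * c - (1 + i))) * (i / 2) +
      (-c * (M + j + i) - (α * (1 + i) - d - 2 * c - (1 + i))) * (((i : ℝ) ^ 2 + i) / 4) +
      c * (((i : ℝ) ^ 3 + 3 * (i : ℝ) ^ 2) / 8)) / (M * (1 + i)) := by
  have hN : (0 : ℝ) < 1 + i := by positivity
  rw [← coinMean_cubic, div_eq_inv_mul, ← coinMean_const_mul]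
  congr 1
  ext s
  unfold quadratic
  push_cast
  field_simp
  ring

/-- A function whose potential is halved when it is kept from round to round. The
coefficient `α` dominates the constant of the tail bound. A smaller one than here is possible in the
first rounds, where the function is replaced after the round. -/
def psiStable : ℕ → ℕ → ℝ := quadratic (11 / 2) 2 (17 / 10) (3 / 10) 1

/-- A function with smaller `α` for the round before the first one with `psiStable`. -/
def psiSecond : ℕ → ℕ → ℝ := quadratic (93 / 20) (37 / 10) (9 / 10) (11 / 10) (27 / 10)

/-- A function with still smaller `α` for the round before that of `psiSecond`. Because of its
constant term `μ` it is of use only if many nodes redraw. -/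
def psiFirst : ℕ → ℕ → ℝ := quadratic (21 / 5) (63 / 10) (4 / 5) (29 / 20) (53 / 10)

theorem admissible_psiStable : Admissible psiStable :=
  quadratic_admissible (by norm_num) (by norm_num) (by norm_num) (by norm_num) (by norm_num)

theorem admissible_psiSecond : Admissible psiSecond :=
  quadratic_admissible (by norm_num) (by norm_num) (by norm_num) (by norm_num) (by norm_num)

theorem admissible_psiFirst : Admissible psiFirst :=
  quadratic_admissible (by norm_num) (by norm_num) (by norm_num) (by norm_num) (by norm_num)

theorem Nat.cast_mul_sub_one_nonneg (i : ℕ) : (0 : ℝ) ≤ i * (i - 1) := by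
  rcases i with _ | i
  · simp
  · push_cast
    have : (0 : ℝ) ≤ i := by positivity
    nlinarith

theorem Nat.cast_mul_sub_one_mul_sub_two_nonneg (i : ℕ) : (0 : ℝ) ≤ i * (i - 1) * (i - 2) := by
  rcases i with _ | _ | i
  · simp
  · simp
  · push_cast
    have : (0 : ℝ) ≤ i := by positivity
    have h : ((i : ℝ) + 1 + 1) * (i + 1 + 1 - 1) * (i + 1 + 1 - 2) =
      i * (i + 1) * (i + 2) := by ring
    rw [h]
    positivity

theorem isStep_psiStable : IsStep psiStable psiStable := by
  refine ⟨fun i j => ?_⟩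
  have hi := Nat.cast_mul_sub_one_nonneg i
  have hi0 : (0 : ℝ) ≤ i := by positivity
  have hj0 : (0 : ℝ) ≤ j := by positivity
  have hM : (0 : ℝ) < ((1 + i + j : ℕ) : ℝ) := by positivity
  have hN : (0 : ℝ) < 1 + i := by positivity
  rw [psiStable, coinMean_quadratic _ _ _ _ _ _ _ _ hM, div_le_iff₀ (by positivity),
    ← mul_assoc, quadratic_mul _ _ _ _ _ _ _ hM]
  push_cast
  nlinarith [mul_nonneg hi hj0, mul_nonneg hi hi0]

theorem isStep_psiSecond : IsStep psiSecond psiStable := by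
  refine ⟨fun i j => ?_⟩
  have hi := Nat.cast_mul_sub_one_mul_sub_two_nonneg i
  have hj0 : (0 : ℝ) ≤ j := by positivity
  have hM : (0 : ℝ) < ((1 + i + j : ℕ) : ℝ) := by positivity
  have hN : (0 : ℝ) < 1 + i := by positivity
  rw [psiStable, coinMean_quadratic _ _ _ _ _ _ _ _ hM, div_le_iff₀ (by positivity), psiSecond,
    ← mul_assoc, quadratic_mul _ _ _ _ _ _ _ hM]
  push_cast
  nlinarith

theorem isStep_psiFirst : IsStep psiFirst psiSecond := by
  refine ⟨fun i j => ?_⟩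
  have hi0 : (0 : ℝ) ≤ i := by positivity
  have hj0 : (0 : ℝ) ≤ j := by positivity
  have hM : (0 : ℝ) < ((1 + i + j : ℕ) : ℝ) := by positivity
  have hN : (0 : ℝ) < 1 + i := by positivity
  rw [psiSecond, coinMean_quadratic _ _ _ _ _ _ _ _ hM, div_le_iff₀ (by positivity), psiFirst,
    ← mul_assoc, quadratic_mul _ _ _ _ _ _ _ hM]
  push_cast
  nlinarith [mul_nonneg hi0 hi0]

/-- The constant of the exponential tail of the recovery time if `K` nodes redraw in the round of
the fault. It is a bound for twice the mean potential after that round, see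
`coinMean_psiSequence_zero_le` for memory faults and `two_mul_le_tailConstant` for message faults,
where the potential is at most `K`. -/
def tailConstant (K : ℕ) : ℝ :=
  if K = 1 then 2 else if K ≤ 31 then 17 / 5 * K + 3 else 331 / 100 * K

/-- The potentials used in the successive rounds, if `K` nodes redraw in the round of the
fault. -/
def psiSequence (K : ℕ) : ℕ → ℕ → ℕ → ℝ
  | 0 => if K = 1 then psiStable else if K ≤ 31 then psiSecond else psiFirst
  | 1 => if K ≤ 31 then psiStable else psiSecond
  | _ + 2 => psiStable

theorem admissible_psiSequence (K t : ℕ) : Admissible (psiSequence K t) := by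
  rcases t with _ | _ | t
  · simp only [psiSequence]
    split_ifs
    exacts [admissible_psiStable, admissible_psiSecond, admissible_psiFirst]
  · simp only [psiSequence]
    split_ifs
    exacts [admissible_psiStable, admissible_psiSecond]
  · exact admissible_psiStable

theorem isStep_psiSequence (K t : ℕ) : IsStep (psiSequence K t) (psiSequence K (t + 1)) := by
  rcases t with _ | _ | t
  · simp only [psiSequence]
    split_ifs with h1 h2 h2
    exacts [isStep_psiStable, absurd h1 (by omega), isStep_psiSecond, isStep_psiFirst]
  · simp only [psiSequence]
    split_ifs
    exacts [isStep_psiStable, isStep_psiSecond]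
  · exact isStep_psiStable

theorem two_mul_le_tailConstant {K : ℕ} (hK : 1 ≤ K) : 2 * (K : ℝ) ≤ tailConstant K := by
  have h0 : (1 : ℝ) ≤ K := by exact_mod_cast hK
  unfold tailConstant
  split_ifs with h1 h2
  · rw [h1]
    norm_num
  · linarith
  · linarith

/-- Twice the mean potential after a round in which `v` and `k` neighbors redraw, no neighbor
confirms its color, and the palette of `v` has at least `max 1 k` colors. -/
theorem coinMean_psiSequence_zero_le (k : ℕ) :
    coinMean k (fun s => psiSequence (k + 1) 0 s (1 + k) + s +
      (((0 : ℕ) : ℝ) * (psiSequence (k + 1) 0 s (1 + k) - s) + s +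
        ((k : ℝ) - s) * (psiSequence (k + 1) 0 (s + 1) (1 + k) - s)) / ((max 1 k : ℕ) : ℝ)) ≤
      tailConstant (k + 1) := by
  have hM : (0 : ℝ) < ((max 1 k : ℕ) : ℝ) := by positivity
  rcases Nat.eq_zero_or_pos k with rfl | hk
  · simp [coinMean, psiSequence, psiStable, quadratic, tailConstant]
  have hk1 : (1 : ℝ) ≤ k := by exact_mod_cast hk
  rw [max_eq_right hk] at hM ⊢
  by_cases h31 : k + 1 ≤ 31
  · have hψ : psiSequence (k + 1) 0 = psiSecond := by
      simp only [psiSequence]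
      rw [if_neg (by omega), if_pos h31]
    have hk31 : (k : ℝ) + 1 ≤ 31 := by exact_mod_cast h31
    rw [hψ, tailConstant, if_neg (by omega), if_pos h31, psiSecond,
      coinMean_quadratic _ _ _ _ _ _ _ _ hM, div_le_iff₀ (by positivity)]
    push_cast
    nlinarith [mul_nonneg (sub_nonneg.2 hk1) (show (0 : ℝ) ≤ 30 - k by linarith)]
  · have hψ : psiSequence (k + 1) 0 = psiFirst := by
      simp only [psiSequence]
      rw [if_neg (by omega), if_neg h31]
    have hk31 : (31 : ℝ) ≤ k := by exact_mod_cast (show 31 ≤ k by omega)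
    rw [hψ, tailConstant, if_neg (by omega), if_neg h31, psiFirst,
      coinMean_quadratic _ _ _ _ _ _ _ _ hM, div_le_iff₀ (by positivity)]
    push_cast
    nlinarith [mul_nonneg (sub_nonneg.2 hk31) hM.le,
      mul_nonneg (mul_nonneg (sub_nonneg.2 hk31) hM.le) hM.le]

end

section

/-! ### Moments of an integer variable with exponential tails -/

variable {Ω : Type*} [MeasurableSpace Ω] {P : Measure Ω} [IsProbabilityMeasure P] {X : Ω → ℕ}
  {K : ℕ} {C : ℝ}

/-- The weights `2 m + 1 + 2 δ` are the differences of `(m + δ) ^ 2`. -/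
theorem hasSum_succ_geometric (δ : ℝ) :
    HasSum (fun m : ℕ => (2 * m + 1 + 2 * δ) * (1 / 2 : ℝ) ^ m) (4 * δ + 6) := by
  have h1 := hasSum_coe_mul_geometric_of_norm_lt_one (𝕜 := ℝ) (r := 1 / 2) (by norm_num)
  have h2 := hasSum_geometric_two
  have h := (h1.mul_left 2).add (h2.mul_left (1 + 2 * δ))
  convert! h using 1
  · ext m
    ring
  · norm_num
    ring

theorem lintegral_indicator_const_one (hX : Measurable X) (p : ℕ → Prop) [DecidablePred p]
    (c : ℝ) :
    ∫⁻ ω, (if p (X ω) then ENNReal.ofReal c else 0) ∂P =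
      ENNReal.ofReal (c * P.real {ω | p (X ω)}) := by
  have hmeas : MeasurableSet {ω | p (X ω)} := hX (Set.to_countable {n | p n}).measurableSet
  have : (fun ω => if p (X ω) then ENNReal.ofReal c else 0) =
      {ω | p (X ω)}.indicator fun _ => ENNReal.ofReal c := by
    ext ω
    simp [Set.indicator_apply]
  rw [this, lintegral_indicator_const hmeas, ENNReal.ofReal_mul' measureReal_nonneg,
    ofReal_measureReal]

/-- The mean square deviation from the reference point `N + 1 - δ`, by summation by parts: the
first sum over tails is that of the events `X > N + 1 + m`, evaluated with
`hasSum_succ_geometric`, and the second one is that of the events `X ≤ N - j`. -/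
theorem lintegral_sq_sub_le (hX : Measurable X) (hC : 0 ≤ C)
    (hup : ∀ t, P.real {ω | t + 1 < X ω} ≤ C * (1 / 2) ^ t)
    (hlow : ∀ t, P.real {ω | X ω ≤ t + 1} ≤ (1 - (1 / 2) ^ t) ^ K) (hK : 1 ≤ K)
    (N : ℕ) (δ : ℝ) (h1 : -(1 / 2) ≤ δ) (h2 : δ ≤ 1 / 2) :
    ∫⁻ ω, ENNReal.ofReal (((X ω : ℝ) - ((N + 1 : ℕ) - δ)) ^ 2) ∂P ≤
      ENNReal.ofReal (δ ^ 2 + C * (1 / 2) ^ N * (4 * δ + 6) +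
        ∑ j ∈ Finset.range N, (2 * j + 1 - 2 * δ) * (1 - (1 / 2) ^ (N - 1 - j)) ^ K) := by
  have hupnn : ∀ m : ℕ, 0 ≤ 2 * (m : ℝ) + 1 + 2 * δ := fun m => by
    have : (0 : ℝ) ≤ m := by positivity
    linarith
  have hlownn : ∀ m : ℕ, 0 ≤ 2 * (m : ℝ) + 1 - 2 * δ := fun m => by
    have : (0 : ℝ) ≤ m := by positivity
    linarith
  have hsum1 : ∀ r : ℕ, ∑ m ∈ Finset.range r, (2 * (m : ℝ) + 1 + 2 * δ) = r ^ 2 + 2 * δ * r := by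
    intro r
    induction r with
    | zero => simp
    | succ r ih =>
      rw [Finset.sum_range_succ, ih]
      push_cast
      ring
  have hsum2 : ∀ r : ℕ, ∑ m ∈ Finset.range r, (2 * (m : ℝ) + 1 - 2 * δ) = r ^ 2 - 2 * δ * r := by
    intro r
    induction r with
    | zero => simp
    | succ r ih =>
      rw [Finset.sum_range_succ, ih]
      push_cast
      ring
  have hpt : ∀ ω, ENNReal.ofReal (((X ω : ℝ) - ((N + 1 : ℕ) - δ)) ^ 2) ≤
      ENNReal.ofReal (δ ^ 2) +
      ∑' m : ℕ, (if N + m + 1 < X ω then ENNReal.ofReal (2 * m + 1 + 2 * δ) else 0) +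
      ∑ j ∈ Finset.range (N + 1),
        (if X ω ≤ N - j then ENNReal.ofReal (2 * j + 1 - 2 * δ) else 0) := by
    intro ω
    rcases le_total (N + 1) (X ω) with h | h
    · obtain ⟨r, hr⟩ := Nat.exists_eq_add_of_le h
      have hle : ENNReal.ofReal ((r : ℝ) ^ 2 + 2 * δ * r) ≤
          ∑' m : ℕ, (if N + m + 1 < X ω then ENNReal.ofReal (2 * m + 1 + 2 * δ) else 0) := by
        refine le_trans (le_of_eq ?_) (ENNReal.sum_le_tsum (Finset.range r))
        rw [← hsum1, ENNReal.ofReal_sum_of_nonneg fun m _ => hupnn m]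
        refine Finset.sum_congr rfl fun m hm => ?_
        rw [if_pos (by have := Finset.mem_range.1 hm; omega)]
      have heq : ((X ω : ℝ) - ((N + 1 : ℕ) - δ)) ^ 2 = δ ^ 2 + (r ^ 2 + 2 * δ * r) := by
        rw [hr]
        push_cast
        ring
      rw [heq]
      refine (ENNReal.ofReal_add_le).trans ?_
      exact (add_le_add_right hle _).trans le_self_add
    · obtain ⟨r, hr⟩ := Nat.exists_eq_add_of_le h
      have hle : ENNReal.ofReal ((r : ℝ) ^ 2 - 2 * δ * r) ≤
          ∑ j ∈ Finset.range (N + 1),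
            (if X ω ≤ N - j then ENNReal.ofReal (2 * j + 1 - 2 * δ) else 0) := by
        refine le_trans (le_of_eq ?_) (Finset.sum_le_sum_of_subset
          (Finset.range_subset_range.2 (show r ≤ N + 1 by omega)))
        rw [← hsum2, ENNReal.ofReal_sum_of_nonneg fun m _ => hlownn m]
        refine Finset.sum_congr rfl fun m hm => ?_
        rw [if_pos (by have := Finset.mem_range.1 hm; omega)]
      have heq : ((X ω : ℝ) - ((N + 1 : ℕ) - δ)) ^ 2 = δ ^ 2 + (r ^ 2 - 2 * δ * r) := by
        rw [hr]
        push_cast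
        ring
      rw [heq]
      refine (ENNReal.ofReal_add_le).trans ?_
      exact add_le_add le_self_add hle
  have hm1 : ∀ m : ℕ, Measurable fun ω => (if N + m + 1 < X ω then
      ENNReal.ofReal (2 * m + 1 + 2 * δ) else 0) := fun m =>
    (measurable_of_countable fun n : ℕ => if N + m + 1 < n then
      ENNReal.ofReal (2 * m + 1 + 2 * δ) else 0).comp hX
  have hm2 : ∀ j : ℕ, Measurable fun ω => (if X ω ≤ N - j then
      ENNReal.ofReal (2 * j + 1 - 2 * δ) else 0) := fun j =>
    (measurable_of_countable fun n : ℕ => if n ≤ N - j then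
      ENNReal.ofReal (2 * j + 1 - 2 * δ) else 0).comp hX
  have hA : ∫⁻ ω, ∑' m : ℕ, (if N + m + 1 < X ω then ENNReal.ofReal (2 * m + 1 + 2 * δ) else 0) ∂P
      ≤ ENNReal.ofReal (C * (1 / 2) ^ N * (4 * δ + 6)) := by
    rw [lintegral_tsum fun m => (hm1 m).aemeasurable]
    have hs := (hasSum_succ_geometric δ).mul_left (C * (1 / 2) ^ N)
    rw [← hs.tsum_eq, ENNReal.ofReal_tsum_of_nonneg (fun m => by
      have := hupnn m
      positivity) hs.summable]
    refine ENNReal.tsum_le_tsum fun m => ?_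
    have := lintegral_indicator_const_one (P := P) hX (fun n => N + m + 1 < n)
      (2 * m + 1 + 2 * δ)
    refine (le_of_eq ?_).trans ((le_of_eq this).trans (ENNReal.ofReal_le_ofReal ?_))
    · rfl
    · calc (2 * (m : ℝ) + 1 + 2 * δ) * P.real {ω | N + m + 1 < X ω}
          ≤ (2 * (m : ℝ) + 1 + 2 * δ) * (C * (1 / 2) ^ (N + m)) :=
            mul_le_mul_of_nonneg_left (hup _) (hupnn m)
        _ = _ := by
          rw [pow_add]
          ring
  have hB : ∫⁻ ω, ∑ j ∈ Finset.range (N + 1),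
        (if X ω ≤ N - j then ENNReal.ofReal (2 * j + 1 - 2 * δ) else 0) ∂P ≤
      ENNReal.ofReal (∑ j ∈ Finset.range N,
        (2 * j + 1 - 2 * δ) * (1 - (1 / 2) ^ (N - 1 - j)) ^ K) := by
    rw [lintegral_finsetSum _ fun j _ => hm2 j, Finset.sum_range_succ]
    have hzero : ∫⁻ ω, (if X ω ≤ N - N then ENNReal.ofReal (2 * N + 1 - 2 * δ) else 0) ∂P = 0 := by
      have := lintegral_indicator_const_one (P := P) hX (fun n => n ≤ N - N)
        (2 * N + 1 - 2 * δ)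
      refine Eq.trans ?_ (this.trans ?_)
      · rfl
      · have h0 : P.real {ω | X ω ≤ N - N} ≤ 0 := by
          refine (measureReal_mono (s₂ := {ω | X ω ≤ 0 + 1}) ?_ (measure_ne_top _ _)).trans
            ((hlow 0).trans_eq ?_)
          · intro ω hω
            simp only [Set.mem_ofPred_eq] at hω ⊢
            omega
          · simp only [pow_zero, sub_self]
            exact zero_pow (by omega)
        rw [le_antisymm h0 measureReal_nonneg]
        simp
    rw [hzero, add_zero, ENNReal.ofReal_sum_of_nonneg]
    · refine Finset.sum_le_sum fun j hj => ?_
      have hj' := Finset.mem_range.1 hj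
      have := lintegral_indicator_const_one (P := P) hX (fun n => n ≤ N - j)
        (2 * j + 1 - 2 * δ)
      refine (le_of_eq ?_).trans ((le_of_eq this).trans (ENNReal.ofReal_le_ofReal ?_))
      · rfl
      · refine mul_le_mul_of_nonneg_left ?_ (hlownn j)
        have h3 := hlow (N - 1 - j)
        rwa [show N - 1 - j + 1 = N - j by omega] at h3
    · intro j _
      refine mul_nonneg (hlownn j) (pow_nonneg ?_ _)
      exact sub_nonneg.2 (pow_le_one₀ (by norm_num) (by norm_num))
  calc _ ≤ ∫⁻ ω, (ENNReal.ofReal (δ ^ 2) +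
      ∑' m : ℕ, (if N + m + 1 < X ω then ENNReal.ofReal (2 * m + 1 + 2 * δ) else 0) +
      ∑ j ∈ Finset.range (N + 1),
        (if X ω ≤ N - j then ENNReal.ofReal (2 * j + 1 - 2 * δ) else 0)) ∂P :=
        lintegral_mono hpt
    _ ≤ ENNReal.ofReal (δ ^ 2) + ENNReal.ofReal (C * (1 / 2) ^ N * (4 * δ + 6)) +
        ENNReal.ofReal (∑ j ∈ Finset.range N,
          (2 * j + 1 - 2 * δ) * (1 - (1 / 2) ^ (N - 1 - j)) ^ K) := by
      rw [lintegral_add_right _ (Finset.measurable_fun_sum _ fun j _ => hm2 j),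
        lintegral_add_left measurable_const]
      simp only [lintegral_const, measure_univ, mul_one]
      gcongr
    _ = _ := by
      rw [← ENNReal.ofReal_add, ← ENNReal.ofReal_add]
      · have : 0 ≤ 4 * δ + 6 := by linarith
        positivity
      · refine Finset.sum_nonneg fun j _ => mul_nonneg (hlownn j) (pow_nonneg ?_ _)
        exact sub_nonneg.2 (pow_le_one₀ (by norm_num) (by norm_num))
      · positivity
      · have : 0 ≤ 4 * δ + 6 := by linarith
        positivity

/-- This also holds if the right-hand side is infinite. -/
theorem evariance_le_lintegral_sq_sub {Y : Ω → ℝ} (hY : Measurable Y) (a : ℝ) :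
    evariance Y P ≤ ∫⁻ ω, ENNReal.ofReal ((Y ω - a) ^ 2) ∂P := by
  by_cases htop : ∫⁻ ω, ENNReal.ofReal ((Y ω - a) ^ 2) ∂P = ⊤
  · rw [htop]
    exact le_top
  have hint : Integrable (fun ω => (Y ω - a) ^ 2) P := by
    refine ⟨((hY.sub_const a).pow_const 2).aestronglyMeasurable, ?_⟩
    rw [hasFiniteIntegral_iff_ofReal (Filter.Eventually.of_forall fun ω => sq_nonneg _)]
    exact lt_top_iff_ne_top.2 htop
  have hmem : MemLp (fun ω => Y ω - a) 2 P :=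
    (memLp_two_iff_integrable_sq (hY.sub_const a).aestronglyMeasurable).2 hint
  have hmemY : MemLp Y 2 P := by
    have := hmem.add (memLp_const a)
    convert! this using 1
    ext ω
    simp
  have hvar : variance Y P = variance (fun ω => Y ω - a) P :=
    (variance_sub_const hY.aestronglyMeasurable a).symm
  rw [← hmemY.ofReal_variance_eq, hvar,
    ← ofReal_integral_eq_lintegral_ofReal hint (Filter.Eventually.of_forall fun ω => sq_nonneg _)]
  exact ENNReal.ofReal_le_ofReal
    (variance_le_expectation_sq (hY.sub_const a).aestronglyMeasurable)

/-- The mean of a variable with the tail `C 2^{-t}` is at most `log₂ C + 3`. -/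
theorem lintegral_le_log_add_three (hX : Measurable X) (hC : 1 ≤ C)
    (hup : ∀ t, P.real {ω | t + 1 < X ω} ≤ C * (1 / 2) ^ t) :
    ∫⁻ ω, (X ω : ENNReal) ∂P ≤ ENNReal.ofReal (Real.log C / Real.log 2 + 3) := by
  have hlog2 : 0 < Real.log 2 := Real.log_pos one_lt_two
  set L := Real.log C / Real.log 2 with hL
  have hL0 : 0 ≤ L := div_nonneg (Real.log_nonneg hC) hlog2.le
  set m := ⌈L⌉₊ with hm
  have hpt : ∀ ω, (X ω : ENNReal) ≤ ((m + 1 : ℕ) : ENNReal) +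
      ∑' r : ℕ, (if m + r + 1 < X ω then ENNReal.ofReal 1 else 0) := by
    intro ω
    rcases le_total (X ω) (m + 1) with h | h
    · exact (Nat.cast_le.2 h).trans le_self_add
    · obtain ⟨r, hr⟩ := Nat.exists_eq_add_of_le h
      have hle : (r : ENNReal) ≤
          ∑' r : ℕ, (if m + r + 1 < X ω then ENNReal.ofReal 1 else 0) := by
        refine le_trans (le_of_eq ?_) (ENNReal.sum_le_tsum (Finset.range r))
        rw [Finset.sum_congr rfl (g := fun _ => (1 : ENNReal)) fun k hk => by
          rw [if_pos (by have := Finset.mem_range.1 hk; omega), ENNReal.ofReal_one]]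
        simp
      rw [hr, Nat.cast_add]
      rw [hr] at hle
      exact add_le_add_right hle _
  have hmeas : ∀ r : ℕ, Measurable fun ω => (if m + r + 1 < X ω then
      ENNReal.ofReal 1 else 0) := fun r =>
    (measurable_of_countable fun n : ℕ => if m + r + 1 < n then
      ENNReal.ofReal 1 else 0).comp hX
  have htail : ∫⁻ ω, ∑' r : ℕ, (if m + r + 1 < X ω then ENNReal.ofReal 1 else 0) ∂P ≤
      ENNReal.ofReal (C * (1 / 2) ^ m * 2) := by
    rw [lintegral_tsum fun r => (hmeas r).aemeasurable]
    have hs := hasSum_geometric_two.mul_left (C * (1 / 2) ^ m)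
    rw [← hs.tsum_eq, ENNReal.ofReal_tsum_of_nonneg (fun r => by positivity) hs.summable]
    refine ENNReal.tsum_le_tsum fun r => ?_
    have := lintegral_indicator_const_one (P := P) hX (fun n => m + r + 1 < n) 1
    refine (le_of_eq ?_).trans ((le_of_eq this).trans (ENNReal.ofReal_le_ofReal ?_))
    · rfl
    · rw [one_mul]
      refine (hup (m + r)).trans_eq ?_
      rw [pow_add]
      ring
  have hreal : C * (1 / 2) ^ m * 2 + (m + 1) ≤ L + 3 := by
    have hm1 : L ≤ m := Nat.le_ceil L
    have hm2 : (m : ℝ) < L + 1 := Nat.ceil_lt_add_one hL0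
    have hC2 : C = 2 ^ L := by
      rw [hL, Real.rpow_def_of_pos two_pos, mul_div_cancel₀ _ hlog2.ne', Real.exp_log (by linarith)]
    have hpow : C * (1 / 2) ^ m = (1 / 2 : ℝ) ^ ((m : ℝ) - L) := by
      rw [Real.rpow_sub (by norm_num), Real.rpow_natCast, hC2, one_div, Real.inv_rpow (by norm_num)]
      field_simp
    -- Bernoulli's inequality on the unit interval, where the exponent is the rounding error
    have hbern := rpow_one_add_le_one_add_mul_self (s := -(1 / 2)) (by norm_num)
      (show 0 ≤ (m : ℝ) - L by linarith) (by linarith)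
    rw [show (1 : ℝ) + -(1 / 2) = 1 / 2 by norm_num, ← hpow] at hbern
    linarith
  calc _ ≤ ∫⁻ ω, (((m + 1 : ℕ) : ENNReal) +
      ∑' r : ℕ, (if m + r + 1 < X ω then ENNReal.ofReal 1 else 0)) ∂P := lintegral_mono hpt
    _ ≤ ((m + 1 : ℕ) : ENNReal) + ENNReal.ofReal (C * (1 / 2) ^ m * 2) := by
      rw [lintegral_add_left measurable_const]
      simp only [lintegral_const, measure_univ, mul_one]
      gcongr
    _ = ENNReal.ofReal (C * (1 / 2) ^ m * 2 + (m + 1)) := by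
      rw [ENNReal.ofReal_add (by positivity) (by positivity), add_comm]
      congr 1
      rw [← ENNReal.ofReal_natCast]
      push_cast
      rfl
    _ ≤ _ := ENNReal.ofReal_le_ofReal hreal

end

section

/-! ### Numerical bounds for the moments -/

/-- The limit, for large `K`, of the estimate of the mean square deviation in
`lintegral_sq_sub_le`, where `g = K / 2 ^ N` and the tail constant is `331/100 K`. The sum is cut
off after seven terms; the others are negligible by `sum_exp_le`. -/
def limitDeviation (δ g : ℝ) : ℝ :=
  δ ^ 2 + 331 / 100 * g * (4 * δ + 6) +
    ∑ j ∈ Finset.range 7, (2 * j + 1 - 2 * δ) * Real.exp (-(2 ^ (j + 1) * g))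

theorem convexOn_limitDeviation {δ : ℝ} (h2 : δ ≤ 1 / 2) :
    ConvexOn ℝ Set.univ (limitDeviation δ) := by
  have hlin : ConvexOn ℝ Set.univ fun g : ℝ => δ ^ 2 + 331 / 100 * g * (4 * δ + 6) := by
    refine ⟨convex_univ, fun x _ y _ a b _ _ hab => le_of_eq ?_⟩
    simp only [smul_eq_mul]
    have : b = 1 - a := by linarith
    subst this
    ring
  have hexp : ∀ j : ℕ, ConvexOn ℝ Set.univ fun g : ℝ =>
      (2 * (j : ℝ) + 1 - 2 * δ) * Real.exp (-(2 ^ (j + 1) * g)) := by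
    intro j
    have h := convexOn_exp.comp_linearMap
      ((-(2 ^ (j + 1)) : ℝ) • (LinearMap.id : ℝ →ₗ[ℝ] ℝ))
    have hj : (0 : ℝ) ≤ j := by positivity
    have h' := h.smul (show 0 ≤ 2 * (j : ℝ) + 1 - 2 * δ by linarith)
    rw [Set.preimage_univ] at h'
    convert! h' using 1
    ext g
    simp
  have hsum : ∀ n : ℕ, ConvexOn ℝ Set.univ fun g : ℝ => ∑ j ∈ Finset.range n,
      (2 * (j : ℝ) + 1 - 2 * δ) * Real.exp (-(2 ^ (j + 1) * g)) := by
    intro n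
    induction n with
    | zero => simpa using convexOn_const (0 : ℝ) convex_univ
    | succ n ih =>
      simp only [Finset.sum_range_succ]
      exact ih.add (hexp n)
  exact hlin.add (hsum 7)

/-- All exponentials are powers of `exp (-2 g)`. -/
theorem limitDeviation_le {δ g x : ℝ} (h2 : δ ≤ 1 / 2) (hx : Real.exp (-(2 * g)) ≤ x) :
    limitDeviation δ g ≤ δ ^ 2 + 331 / 100 * g * (4 * δ + 6) +
      ∑ j ∈ Finset.range 7, (2 * j + 1 - 2 * δ) * x ^ 2 ^ j := by
  unfold limitDeviation
  gcongr with j _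
  · have hj : (0 : ℝ) ≤ j := by positivity
    linarith
  · have : Real.exp (-(2 ^ (j + 1) * g)) = Real.exp (-(2 * g)) ^ 2 ^ j := by
      rw [← Real.exp_nat_mul]
      congr 1
      push_cast
      ring
    rw [this]
    gcongr

theorem exp_neg_quarter_le : Real.exp (-(2 * (1 / 8))) ≤ 7789 / 10000 := by
  refine le_of_pow_le_pow_left₀ (n := 4) (by norm_num) (by norm_num) ?_
  rw [← Real.exp_nat_mul]
  have := Real.exp_neg_one_lt_d9
  norm_num at this ⊢
  linarith

theorem exp_neg_three_eighths_le : Real.exp (-(2 * (3 / 16))) ≤ 6873 / 10000 := by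
  refine le_of_pow_le_pow_left₀ (n := 8) (by norm_num) (by norm_num) ?_
  rw [← Real.exp_nat_mul]
  have h := Real.exp_neg_one_lt_d9.le
  have h3 := pow_le_pow_left₀ (Real.exp_pos _).le h 3
  rw [← Real.exp_nat_mul] at h3
  norm_num at h3 ⊢
  linarith

theorem exp_neg_half_le : Real.exp (-(2 * (1 / 4))) ≤ 6066 / 10000 := by
  refine le_of_pow_le_pow_left₀ (n := 2) (by norm_num) (by norm_num) ?_
  rw [← Real.exp_nat_mul]
  have := Real.exp_neg_one_lt_d9
  norm_num at this ⊢
  linarith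

/-- A convex function is bounded by its values at the end points, so `g = 1/8`, `3/16` and `1/4`
are sufficient, with one reference point for each half of the interval. -/
theorem exists_limitDeviation_le {g : ℝ} (h1 : 1 / 8 ≤ g) (h2 : g ≤ 1 / 4) :
    ∃ δ : ℝ, -(1 / 2) ≤ δ ∧ δ ≤ 1 / 2 ∧ limitDeviation δ g ≤ 7.48 := by
  rcases le_total g (3 / 16) with h | h
  · refine ⟨1 / 2, by norm_num, le_rfl, ?_⟩
    refine ((convexOn_limitDeviation (δ := 1 / 2) le_rfl).le_max_of_mem_Icc (Set.mem_univ _)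
      (Set.mem_univ _) ⟨h1, h⟩).trans (max_le ?_ ?_)
    · refine (limitDeviation_le le_rfl exp_neg_quarter_le).trans ?_
      norm_num [Finset.sum_range_succ]
    · refine (limitDeviation_le le_rfl exp_neg_three_eighths_le).trans ?_
      norm_num [Finset.sum_range_succ]
  · refine ⟨-(1 / 4), by norm_num, by norm_num, ?_⟩
    refine ((convexOn_limitDeviation (δ := -(1 / 4)) (by norm_num)).le_max_of_mem_Icc
      (Set.mem_univ _) (Set.mem_univ _) ⟨h, h2⟩).trans (max_le ?_ ?_)
    · refine (limitDeviation_le (by norm_num) exp_neg_three_eighths_le).trans ?_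
      norm_num [Finset.sum_range_succ]
    · refine (limitDeviation_le (by norm_num) exp_neg_half_le).trans ?_
      norm_num [Finset.sum_range_succ]

/-- For `j ≥ 7` the exponent `2 ^ (j + 1) g` is at least `4 j + 4`, so the terms are dominated by
a geometric sequence. -/
theorem sum_exp_le {δ g : ℝ} (hδ : -(1 / 2) ≤ δ) (hg : 1 / 8 ≤ g) (n : ℕ) :
    ∑ j ∈ Finset.range (7 + n), (2 * (j : ℝ) + 1 - 2 * δ) * Real.exp (-(2 ^ (j + 1) * g)) ≤
      ∑ j ∈ Finset.range 7, (2 * (j : ℝ) + 1 - 2 * δ) * Real.exp (-(2 ^ (j + 1) * g)) +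
        ((1 / 2) ^ 10 - (1 / 2) ^ (10 + n)) := by
  induction n with
  | zero => simp
  | succ n ih =>
    rw [← add_assoc, Finset.sum_range_succ]
    have hpow : ∀ n : ℕ, (4 * ((7 + n : ℕ) : ℝ) + 4) ≤ 2 ^ (7 + n + 1) * (1 / 8) := by
      intro n
      induction n with
      | zero => norm_num
      | succ n ih =>
        rw [← add_assoc, pow_succ]
        push_cast at ih ⊢
        linarith
    have hterm : (2 * ((7 + n : ℕ) : ℝ) + 1 - 2 * δ) * Real.exp (-(2 ^ (7 + n + 1) * g)) ≤
        (1 / 2) ^ (11 + n) := by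
      have h1 : (2 * ((7 + n : ℕ) : ℝ) + 1 - 2 * δ) ≤ Real.exp (2 * ((7 + n : ℕ) : ℝ) + 2) := by
        have := Real.add_one_le_exp (2 * ((7 + n : ℕ) : ℝ) + 2)
        linarith
      have h2 : Real.exp (-(2 ^ (7 + n + 1) * g)) ≤ Real.exp (-(4 * ((7 + n : ℕ) : ℝ) + 4)) := by
        refine Real.exp_le_exp.2 (neg_le_neg ((hpow n).trans ?_))
        gcongr
      calc _ ≤ Real.exp (2 * ((7 + n : ℕ) : ℝ) + 2) * Real.exp (-(4 * ((7 + n : ℕ) : ℝ) + 4)) :=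
            mul_le_mul h1 h2 (Real.exp_pos _).le (Real.exp_pos _).le
        _ = Real.exp (-1) ^ (2 * (7 + n) + 2) := by
          rw [← Real.exp_add, ← Real.exp_nat_mul]
          congr 1
          push_cast
          ring
        _ ≤ (1 / 2) ^ (2 * (7 + n) + 2) := by
          gcongr
          have := Real.exp_neg_one_lt_d9
          linarith
        _ ≤ _ := pow_le_pow_of_le_one (by norm_num) (by norm_num) (by omega)
    have hp : ((1 : ℝ) / 2) ^ (10 + n) = 2 * (1 / 2) ^ (11 + n) := by
      rw [show 11 + n = 10 + n + 1 by ring, pow_succ]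
      ring
    rw [show 10 + (n + 1) = 11 + n by ring]
    linarith

/-- There is a reference point `N + 1 - δ` for which the estimate of the mean square deviation is
below `7.5`. -/
theorem exists_deviation_lt {K : ℕ} (hK : 1 ≤ K) :
    ∃ (N : ℕ) (δ : ℝ), -(1 / 2) ≤ δ ∧ δ ≤ 1 / 2 ∧
      δ ^ 2 + tailConstant K * (1 / 2) ^ N * (4 * δ + 6) +
        ∑ j ∈ Finset.range N, (2 * j + 1 - 2 * δ) * (1 - (1 / 2) ^ (N - 1 - j)) ^ K < 7.5 := by
  rcases Nat.lt_or_ge K 32 with hlt | hge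
  -- For small `K` the reference points, `N + 1 - δ`, grow like `log₂ K`.
  · rcases (by omega : K = 1 ∨ K = 2 ∨ (3 ≤ K ∧ K ≤ 5) ∨ K = 6 ∨ (7 ≤ K ∧ K ≤ 11) ∨
      (12 ≤ K ∧ K ≤ 13) ∨ (14 ≤ K ∧ K ≤ 23) ∨ (24 ≤ K ∧ K ≤ 26) ∨ (27 ≤ K ∧ K ≤ 31)) with
      rfl | rfl | ⟨_, _⟩ | rfl | ⟨_, _⟩ | ⟨_, _⟩ | ⟨_, _⟩ | ⟨_, _⟩ | ⟨_, _⟩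
    · refine ⟨2, -(1 / 2), le_rfl, by norm_num, ?_⟩
      norm_num [tailConstant, Finset.sum_range_succ]
    · refine ⟨3, -(1 / 2), le_rfl, by norm_num, ?_⟩
      norm_num [tailConstant, Finset.sum_range_succ]
    · refine ⟨4, -(1 / 2), le_rfl, by norm_num, ?_⟩
      interval_cases K <;> norm_num [tailConstant, Finset.sum_range_succ]
    · refine ⟨5, 0, by norm_num, by norm_num, ?_⟩
      norm_num [tailConstant, Finset.sum_range_succ]
    · refine ⟨5, -(1 / 2), le_rfl, by norm_num, ?_⟩
      interval_cases K <;> norm_num [tailConstant, Finset.sum_range_succ]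
    · refine ⟨6, 0, by norm_num, by norm_num, ?_⟩
      interval_cases K <;> norm_num [tailConstant, Finset.sum_range_succ]
    · refine ⟨6, -(1 / 2), le_rfl, by norm_num, ?_⟩
      interval_cases K <;> norm_num [tailConstant, Finset.sum_range_succ]
    · refine ⟨7, 0, by norm_num, by norm_num, ?_⟩
      interval_cases K <;> norm_num [tailConstant, Finset.sum_range_succ]
    · refine ⟨7, -(1 / 2), le_rfl, by norm_num, ?_⟩
      interval_cases K <;> norm_num [tailConstant, Finset.sum_range_succ]
  -- For large `K` the choice `N = l + 3` leads to ratios `K / 2 ^ N` between `1/8` and `1/4`.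
  · set l := Nat.log 2 K with hl
    have hl5 : 5 ≤ l := Nat.le_log_of_pow_le one_lt_two (by simpa using hge)
    have hlow : 2 ^ l ≤ K := Nat.pow_log_le_self 2 (by omega)
    have hhigh : K < 2 ^ (l + 1) := Nat.lt_pow_succ_log_self one_lt_two K
    set g : ℝ := K * (1 / 2) ^ (l + 3) with hg
    have hp : (0 : ℝ) < (1 / 2) ^ l := by positivity
    have hp2 : (2 : ℝ) ^ l * (1 / 2) ^ l = 1 := by
      rw [← mul_pow]
      norm_num
    have hlow' : (2 : ℝ) ^ l ≤ K := by exact_mod_cast hlow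
    have hhigh' : (K : ℝ) ≤ 2 ^ l * 2 := by
      rw [← pow_succ]
      exact_mod_cast hhigh.le
    have h1 : 1 / 8 ≤ g := by
      rw [hg, pow_add]
      nlinarith
    have h2 : g ≤ 1 / 4 := by
      rw [hg, pow_add]
      nlinarith
    obtain ⟨δ, hδ1, hδ2, hδ⟩ := exists_limitDeviation_le h1 h2
    refine ⟨l + 3, δ, hδ1, hδ2, ?_⟩
    have hsum : ∑ j ∈ Finset.range (l + 3), (2 * (j : ℝ) + 1 - 2 * δ) *
        (1 - (1 / 2) ^ (l + 3 - 1 - j)) ^ K ≤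
        ∑ j ∈ Finset.range (7 + (l - 4)), (2 * (j : ℝ) + 1 - 2 * δ) *
          Real.exp (-(2 ^ (j + 1) * g)) := by
      rw [show 7 + (l - 4) = l + 3 by omega]
      refine Finset.sum_le_sum fun j hj => ?_
      have hj' := Finset.mem_range.1 hj
      have hj0 : (0 : ℝ) ≤ j := by positivity
      refine mul_le_mul_of_nonneg_left ?_ (by linarith)
      have hx : ((1 : ℝ) / 2) ^ (l + 3 - 1 - j) = 2 ^ (j + 1) * (1 / 2) ^ (l + 3) := by
        have h3 : l + 3 = (l + 3 - 1 - j) + (j + 1) := by omega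
        conv_rhs => rw [h3, pow_add (1 / 2 : ℝ)]
        have h4 : (2 : ℝ) ^ (j + 1) * (1 / 2) ^ (j + 1) = 1 := by
          rw [← mul_pow]
          norm_num
        rw [mul_left_comm, h4, mul_one]
      have hx1 : ((1 : ℝ) / 2) ^ (l + 3 - 1 - j) ≤ 1 := pow_le_one₀ (by norm_num) (by norm_num)
      calc (1 - ((1 : ℝ) / 2) ^ (l + 3 - 1 - j)) ^ K ≤
          Real.exp (-((1 : ℝ) / 2) ^ (l + 3 - 1 - j)) ^ K := by
            have := Real.add_one_le_exp (-((1 : ℝ) / 2) ^ (l + 3 - 1 - j))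
            exact pow_le_pow_left₀ (by linarith) (by linarith) K
        _ = Real.exp (-(2 ^ (j + 1) * g)) := by
          rw [← Real.exp_nat_mul, hx, hg]
          congr 1
          ring
    have hexp := sum_exp_le hδ1 h1 (l - 4)
    have hpos : (0 : ℝ) ≤ (1 / 2) ^ (10 + (l - 4)) := by positivity
    unfold limitDeviation at hδ
    rw [tailConstant, if_neg (by omega), if_neg (by omega),
      show (331 / 100 : ℝ) * K * (1 / 2) ^ (l + 3) = 331 / 100 * g by rw [hg]; ring]
    have h1024 : ((1 : ℝ) / 2) ^ 10 = 1 / 1024 := by norm_num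
    have hnum : (7.48 : ℝ) + 1 / 1024 < 7.5 := by norm_num
    rw [h1024] at hexp
    linarith

theorem one_le_tailConstant {K : ℕ} (hK : 1 ≤ K) : 1 ≤ tailConstant K := by
  have h0 : (1 : ℝ) ≤ K := by exact_mod_cast hK
  have := two_mul_le_tailConstant hK
  linarith

theorem log_tailConstant_le {K : ℕ} (hK : 1 ≤ K) :
    Real.log (tailConstant K) / Real.log 2 + 3 ≤ Real.log K / Real.log 2 + 11 / 2 := by
  have h0 : (1 : ℝ) ≤ K := by exact_mod_cast hK
  have hlog2 : 0 < Real.log 2 := Real.log_pos one_lt_two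
  have hle : tailConstant K ≤ 565 / 100 * K := by
    unfold tailConstant
    split_ifs with h1 h2
    · rw [h1]
      norm_num
    · have : (2 : ℝ) ≤ K := by exact_mod_cast (show 2 ≤ K by omega)
      linarith
    · linarith
  -- The constant `5.65` is below `2 ^ (5/2)`, and it covers `17/5 K + 3` for `K ≥ 2`.
  have h565 : Real.log (565 / 100) ≤ 5 / 2 * Real.log 2 := by
    have : Real.log ((565 / 100) ^ 2) ≤ Real.log (2 ^ 5) :=
      Real.log_le_log (by norm_num) (by norm_num)
    rw [Real.log_pow, Real.log_pow] at this
    push_cast at this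
    linarith
  have h := Real.log_le_log (by linarith [one_le_tailConstant hK]) hle
  rw [Real.log_mul (by norm_num) (by positivity)] at h
  rw [← le_sub_iff_add_le, add_sub_assoc, div_add' _ _ _ hlog2.ne']
  gcongr
  linarith

variable {Ω : Type*} [MeasurableSpace Ω] {P : Measure Ω} [IsProbabilityMeasure P] {X : Ω → ℕ}
  {K : ℕ}

theorem lintegral_le_of_tail (hX : Measurable X) (hK : 1 ≤ K)
    (hup : ∀ t, P.real {ω | t + 1 < X ω} ≤ tailConstant K * (1 / 2) ^ t) :
    ∫⁻ ω, (X ω : ENNReal) ∂P ≤ ENNReal.ofReal (Real.log K / Real.log 2 + 11 / 2) :=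
  (lintegral_le_log_add_three hX (one_le_tailConstant hK) hup).trans
    (ENNReal.ofReal_le_ofReal (log_tailConstant_le hK))

theorem evariance_lt_of_tail (hX : Measurable X) (hK : 1 ≤ K)
    (hup : ∀ t, P.real {ω | t + 1 < X ω} ≤ tailConstant K * (1 / 2) ^ t)
    (hlow : ∀ t, P.real {ω | X ω ≤ t + 1} ≤ (1 - (1 / 2) ^ t) ^ K) :
    evariance (fun ω => (X ω : ℝ)) P < ENNReal.ofReal 7.5 := by
  obtain ⟨N, δ, h1, h2, h⟩ := exists_deviation_lt hK
  have hX' : Measurable fun ω => (X ω : ℝ) := (measurable_of_countable _).comp hX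
  refine (evariance_le_lintegral_sq_sub hX' _).trans_lt ((lintegral_sq_sub_le hX
    (zero_le_one.trans (one_le_tailConstant hK)) hup hlow hK N δ h1 h2).trans_lt ?_)
  exact (ENNReal.ofReal_lt_ofReal_iff (by norm_num)).2 h

end

section

variable {V : Type*} [Fintype V] {G : SimpleGraph V} [DecidableRel G.Adj]

/-! ### The recovery time -/

theorem hitLegitimate_le_iff {k t : ℕ} {ω : ℕ → Config V} :
    hitLegitimate G k ω ≤ t ↔ ∃ s, k ≤ s ∧ s ≤ t ∧ IsLegitimate G (ω s) := by
  constructor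
  · intro h
    by_contra hno
    push Not at hno
    have : ((t + 1 : ℕ) : ℕ∞) ≤ hitLegitimate G k ω := by
      refine le_iInf₂ fun s hs => ?_
      have : t + 1 ≤ s := by
        by_contra hlt
        exact hno s hs.1 (by omega) hs.2
      exact_mod_cast this
    have h2 : t + 1 ≤ t := by exact_mod_cast this.trans h
    omega
  · rintro ⟨s, hk, hst, hs⟩
    exact (iInf₂_le s ⟨hk, hs⟩).trans (by exact_mod_cast hst)

theorem hitLegitimate_lt_top {k : ℕ} {ω : ℕ → Config V} (h : ∃ s, k ≤ s ∧ IsLegitimate G (ω s)) :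
    hitLegitimate G k ω < ⊤ := by
  obtain ⟨s, hk, hs⟩ := h
  exact lt_of_le_of_lt (hitLegitimate_le_iff.2 ⟨s, hk, le_rfl, hs⟩) (ENat.natCast_lt_top s)

theorem measurable_toNat_hitLegitimate (k : ℕ) :
    Measurable fun ω : ℕ → Config V => (hitLegitimate G k ω).toNat := by
  have hle : ∀ t : ℕ, MeasurableSet {ω : ℕ → Config V | hitLegitimate G k ω ≤ t} := by
    intro t
    have : {ω : ℕ → Config V | hitLegitimate G k ω ≤ t} =
        ⋃ s, ⋃ (_ : k ≤ s ∧ s ≤ t), {ω | IsLegitimate G (ω s)} := by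
      ext ω
      simp only [Set.mem_ofPred_eq, Set.mem_iUnion, exists_prop, hitLegitimate_le_iff, and_assoc]
    rw [this]
    refine MeasurableSet.iUnion fun s => MeasurableSet.iUnion fun _ => ?_
    exact (Set.toFinite {τ | IsLegitimate G τ}).measurableSet.preimage (measurable_pi_apply s)
  have hfin : MeasurableSet {ω : ℕ → Config V | hitLegitimate G k ω = ⊤} := by
    have : {ω : ℕ → Config V | hitLegitimate G k ω = ⊤} =
        ⋂ t : ℕ, {ω | hitLegitimate G k ω ≤ t}ᶜ := by
      ext ω
      simp only [Set.mem_ofPred_eq, Set.mem_iInter, Set.mem_compl_iff, not_le]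
      constructor
      · intro h t
        rw [h]
        exact ENat.natCast_lt_top t
      · intro h
        by_contra hne
        obtain ⟨n, hn⟩ := ENat.ne_top_iff_exists.1 hne
        have := h n
        rw [← hn] at this
        exact lt_irrefl _ this
    rw [this]
    exact MeasurableSet.iInter fun t => (hle t).compl
  refine measurable_of_Iic fun n => ?_
  have : (fun ω : ℕ → Config V => (hitLegitimate G k ω).toNat) ⁻¹' Set.Iic n =
      {ω | hitLegitimate G k ω ≤ n} ∪ {ω | hitLegitimate G k ω = ⊤} := by
    ext ω
    simp only [Set.mem_preimage, Set.mem_Iic, Set.mem_union, Set.mem_ofPred_eq]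
    rcases eq_or_ne (hitLegitimate G k ω) ⊤ with h | h
    · simp [h]
    · obtain ⟨m, hm⟩ := ENat.ne_top_iff_exists.1 h
      rw [← hm]
      simp
  rw [this]
  exact (hle n).union hfin

variable {σ : Config V} {v : V} {A : Finset V} {d : Transport V} {τ₀ : Config V}
  {k : ℕ}

/-- A fault region is an independent set in a neighborhood. -/
theorem FaultRegion.card_le (hA : FaultRegion G σ v A) : A.card ≤ maxIndependentDegree G := by
  classical
  have h : (G.induce (G.neighborSet v)).IsIndepSet
      ((A.subtype fun w => w ∈ G.neighborSet v : Finset (G.neighborSet v)) :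
        Set (G.neighborSet v)) := by
    intro x hx y hy _
    simp only [Finset.mem_coe, Finset.mem_subtype] at hx hy
    exact hA.indep _ hx _ hy
  have hcard := h.card_le_indepNum
  rw [Finset.card_subtype, Finset.filter_true_of_mem (p := fun w => w ∈ G.neighborSet v)
    fun w hw => hA.adj w hw] at hcard
  exact hcard.trans (Finset.le_sup (f := fun v => (G.induce (G.neighborSet v)).indepNum)
    (Finset.mem_univ v))

theorem ne_and_notMem_of_edist (hA : FaultRegion G σ v A) {u : V}
    (hu : ((1 : ℕ) : ℕ∞) < G.edist v u) : u ≠ v ∧ u ∉ A := by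
  refine ⟨?_, fun huA => ?_⟩
  · rintro rfl
    simp at hu
  · rw [SimpleGraph.edist_eq_one_iff_adj.2 (hA.adj u huA)] at hu
    simp at hu

/-- The tail events of the recovery time. Time `0` is excluded by `hk`, and by closure the
configuration remains legitimate from the recovery time on. -/
theorem lt_toNat_hitLegitimate_iff {ω : ℕ → Config V}
    (hmono : ∀ t, 1 ≤ t → IsLegitimate G (ω t) → ω (t + 1) = ω t)
    (hk : k = 1 ∨ k = 0 ∧ ¬ IsLegitimate G (ω 0)) (hfin : hitLegitimate G k ω < ⊤) (t : ℕ) :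
    t + 1 < (hitLegitimate G k ω).toNat ↔ ¬ IsLegitimate G (ω (t + 1)) := by
  have h : (hitLegitimate G k ω).toNat ≤ t + 1 ↔ hitLegitimate G k ω ≤ ((t + 1 : ℕ) : ℕ∞) := by
    obtain ⟨m, hm⟩ := ENat.ne_top_iff_exists.1 hfin.ne
    rw [← hm]
    simp only [ENat.toNat_natCast, Nat.cast_le]
  rw [← not_le, h, hitLegitimate_le_iff, not_iff_not]
  constructor
  · rintro ⟨s, hks, hst, hs⟩
    have hs1 : 1 ≤ s := by
      rcases hk with rfl | ⟨rfl, h0⟩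
      · exact hks
      · by_contra hlt
        have : s = 0 := by omega
        exact h0 (this ▸ hs)
    rw [eq_of_forall_legitimate hs1 hmono hs (t + 1) hst]
    exact hs
  · intro hs
    exact ⟨t + 1, by omega, le_rfl, hs⟩

/-- The recovery from a fault which makes the `K ≥ 1` nodes of `S` redraw in the first round. -/
theorem recovery_of_redraws [DecidableEq V] (hA : FaultRegion G σ v A)
    (hd : ∀ t, 1 ≤ t → ∀ τ, d t τ = fun w => (τ w).broadcast)
    (hk : k = 1 ∨ k = 0 ∧ ¬ IsLegitimate G τ₀)
    (hτ₀ : ∀ u, u ≠ v → τ₀ u = σ u)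
    (h0 : ∀ᵐ τ ∂roundLaw G (d 0 τ₀) τ₀, Contained G σ v A τ)
    (S : Finset V) (hS : ∀ u ∈ S, newFinal G (d 0 τ₀) u (τ₀ u) = false) (hS0 : S.Nonempty)
    (hSA : S.card ≤ A.card + 1)
    (hC : ∫ τ, potential G σ v A (psiSequence S.card 0) τ ∂roundLaw G (d 0 τ₀) τ₀ ≤
      tailConstant S.card / 2) :
    (∀ᵐ ω ∂executionLaw G d τ₀, ContaminatesOnly G 1 v σ ω) ∧
    (∀ᵐ ω ∂executionLaw G d τ₀, hitLegitimate G k ω < ⊤) ∧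
    ∫⁻ ω, (hitLegitimate G k ω : ENNReal) ∂executionLaw G d τ₀ ≤
      ENNReal.ofReal ((harmonic (maxIndependentDegree G) : ℝ) / Real.log 2 + 11 / 2) ∧
    evariance (fun ω => ((hitLegitimate G k ω).toNat : ℝ)) (executionLaw G d τ₀) <
      ENNReal.ofReal 7.5 := by
  have hK : 1 ≤ S.card := Finset.card_pos.2 hS0
  have htail := measureReal_not_isLegitimate_le_pow hA hd h0 (psiSequence S.card)
    (admissible_psiSequence _) (isStep_psiSequence _) hC
  have hlow := measureReal_isLegitimate_le_pow hd S hS hS0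
  have hmono := ae_isLegitimate_mono (G := G) d 1 hd τ₀
  have hfin : ∀ᵐ ω ∂executionLaw G d τ₀, hitLegitimate G k ω < ⊤ := by
    have hzero : (executionLaw G d τ₀).real {ω | ¬ hitLegitimate G k ω < ⊤} = 0 := by
      refine le_antisymm ?_ measureReal_nonneg
      have hlim : Filter.Tendsto (fun t : ℕ => tailConstant S.card * (1 / 2) ^ (t + 1))
          Filter.atTop (nhds 0) := by
        rw [← mul_zero (tailConstant S.card)]
        exact ((tendsto_pow_atTop_nhds_zero_of_lt_one (r := (1 / 2 : ℝ)) (by norm_num)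
          (by norm_num)).comp (Filter.tendsto_add_atTop_nat 1)).const_mul _
      refine ge_of_tendsto' hlim fun t => ?_
      have hsub : {ω : ℕ → Config V | ¬ hitLegitimate G k ω < ⊤} ⊆
          {ω | ¬ IsLegitimate G (ω (t + 2))} := by
        intro ω hω
        simp only [Set.mem_ofPred_eq] at hω ⊢
        exact fun hleg => hω (hitLegitimate_lt_top ⟨t + 2, by omega, hleg⟩)
      exact (measureReal_mono hsub (measure_ne_top _ _)).trans (htail t)
    rw [ae_iff]
    exact (measureReal_eq_zero_iff (measure_ne_top _ _)).1 hzero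
  have hX := measurable_toNat_hitLegitimate (G := G) k
  have hiff : ∀ᵐ ω ∂executionLaw G d τ₀, ∀ t,
      (t + 1 < (hitLegitimate G k ω).toNat ↔ ¬ IsLegitimate G (ω (t + 1))) := by
    filter_upwards [hmono, hfin, ae_apply_zero G d τ₀] with ω h1 h2 h3 t
    refine lt_toNat_hitLegitimate_iff h1 ?_ h2 t
    rwa [h3]
  have hup' : ∀ t, (executionLaw G d τ₀).real {ω | t + 1 < (hitLegitimate G k ω).toNat} ≤
      tailConstant S.card * (1 / 2) ^ t := by
    intro t
    rcases t with _ | t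
    · rw [pow_zero, mul_one]
      exact measureReal_le_one.trans (one_le_tailConstant hK)
    · refine le_trans (le_of_eq (measureReal_congr ?_)) (htail t)
      filter_upwards [hiff] with ω hω
      exact propext (hω (t + 1))
  have hlow' : ∀ t, (executionLaw G d τ₀).real {ω | (hitLegitimate G k ω).toNat ≤ t + 1} ≤
      (1 - (1 / 2) ^ t) ^ S.card := by
    intro t
    refine le_trans (le_of_eq (measureReal_congr ?_)) (hlow t)
    filter_upwards [hiff] with ω hω
    exact propext (not_lt.symm.trans ((not_congr (hω t)).trans not_not))
  refine ⟨?_, hfin, ?_, evariance_lt_of_tail hX hK hup' hlow'⟩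
  · filter_upwards [ae_contained_succ hA hd h0, ae_apply_zero G d τ₀] with ω h1 h2 t u hu
    obtain ⟨huv, huA⟩ := ne_and_notMem_of_edist hA hu
    rcases t with _ | t
    · rw [h2, hτ₀ u huv]
    · exact (h1 t).outside u huv huA
  · have heq : ∫⁻ ω, (hitLegitimate G k ω : ENNReal) ∂executionLaw G d τ₀ =
        ∫⁻ ω, ((hitLegitimate G k ω).toNat : ENNReal) ∂executionLaw G d τ₀ := by
      refine lintegral_congr_ae ?_
      filter_upwards [hfin] with ω hω
      obtain ⟨m, hm⟩ := ENat.ne_top_iff_exists.1 hω.ne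
      simp [← hm]
    rw [heq]
    refine (lintegral_le_of_tail hX hK hup').trans (ENNReal.ofReal_le_ofReal ?_)
    have hlog2 : 0 < Real.log 2 := Real.log_pos one_lt_two
    have hKle : (S.card : ℝ) ≤ ((maxIndependentDegree G + 1 : ℕ) : ℝ) := by
      exact_mod_cast hSA.trans (Nat.add_le_add_right hA.card_le 1)
    have := (Real.log_le_log (by positivity) hKle).trans
      (log_add_one_le_harmonic (maxIndependentDegree G))
    gcongr

/-- The recovery from a fault which is undone within the first round. -/
theorem recovery_of_isLegitimate
    (hd : ∀ t, 1 ≤ t → ∀ τ, d t τ = fun w => (τ w).broadcast) (hk : k ≤ 1)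
    (hτ₀ : ∀ u, u ≠ v → τ₀ u = σ u)
    (h0 : ∀ᵐ τ ∂roundLaw G (d 0 τ₀) τ₀, IsLegitimate G τ ∧ ∀ u, u ≠ v → τ u = σ u) :
    (∀ᵐ ω ∂executionLaw G d τ₀, ContaminatesOnly G 1 v σ ω) ∧
    (∀ᵐ ω ∂executionLaw G d τ₀, hitLegitimate G k ω < ⊤) ∧
    ∫⁻ ω, (hitLegitimate G k ω : ENNReal) ∂executionLaw G d τ₀ ≤
      ENNReal.ofReal ((harmonic (maxIndependentDegree G) : ℝ) / Real.log 2 + 11 / 2) ∧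
    evariance (fun ω => ((hitLegitimate G k ω).toNat : ℝ)) (executionLaw G d τ₀) <
      ENNReal.ofReal 7.5 := by
  have h1 : ∀ᵐ ω ∂executionLaw G d τ₀, IsLegitimate G (ω 1) ∧ ∀ u, u ≠ v → ω 1 u = σ u := by
    have h := ae_forall_round G d τ₀ (fun t τ τ' => t = 0 → τ = τ₀ →
      IsLegitimate G τ' ∧ ∀ u, u ≠ v → τ' u = σ u) (fun t τ => by
        by_cases hh : t = 0 ∧ τ = τ₀
        · obtain ⟨rfl, rfl⟩ := hh
          filter_upwards [h0] with τ' h _ _ using h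
        · exact Filter.Eventually.of_forall fun τ' h1 h2 => absurd ⟨h1, h2⟩ hh)
    filter_upwards [h, ae_apply_zero G d τ₀] with ω hω hω0 using hω 0 rfl hω0
  have hle : ∀ᵐ ω ∂executionLaw G d τ₀, hitLegitimate G k ω ≤ ((1 : ℕ) : ℕ∞) := by
    filter_upwards [h1] with ω h
    exact hitLegitimate_le_iff.2 ⟨1, hk, le_rfl, h.1⟩
  refine ⟨?_, ?_, ?_, ?_⟩
  · filter_upwards [h1, ae_isLegitimate_mono (G := G) d 1 hd τ₀, ae_apply_zero G d τ₀]
      with ω h2 h3 h4 t u hu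
    have huv : u ≠ v := by
      rintro rfl
      simp at hu
    rcases t with _ | t
    · rw [h4, hτ₀ u huv]
    · rw [eq_of_forall_legitimate le_rfl h3 h2.1 (t + 1) (by omega), h2.2 u huv]
  · filter_upwards [hle] with ω h using h.trans_lt (ENat.natCast_lt_top 1)
  · have hlog2 : 0 < Real.log 2 := Real.log_pos one_lt_two
    calc _ ≤ ∫⁻ _, 1 ∂executionLaw G d τ₀ := by
          refine lintegral_mono_ae ?_
          filter_upwards [hle] with ω h
          have : (hitLegitimate G k ω : ENNReal) ≤ (((1 : ℕ) : ℕ∞) : ENNReal) :=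
            ENat.toENNReal_le.2 h
          simpa using this
      _ = ENNReal.ofReal 1 := by simp
      _ ≤ _ := by
          refine ENNReal.ofReal_le_ofReal ?_
          have : (0 : ℝ) ≤ harmonic (maxIndependentDegree G) := by
            refine le_trans (Real.log_nonneg ?_) (log_add_one_le_harmonic _)
            norm_num
          have := div_nonneg this hlog2.le
          linarith
  -- A variable with values in `{0, 1}` deviates from `1/2` by `1/2`.
  · refine (evariance_le_lintegral_sq_sub
      ((measurable_of_countable (fun n : ℕ => (n : ℝ))).comp
        (measurable_toNat_hitLegitimate (G := G) k)) (1 / 2)).trans_lt ?_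
    calc _ ≤ ∫⁻ _, ENNReal.ofReal (1 / 4) ∂executionLaw G d τ₀ := by
          refine lintegral_mono_ae ?_
          filter_upwards [hle] with ω h
          refine ENNReal.ofReal_le_ofReal ?_
          have h2 : (hitLegitimate G k ω).toNat ≤ 1 := ENat.toNat_le_of_le_natCast h
          simp only [Function.comp]
          interval_cases (hitLegitimate G k ω).toNat <;> norm_num
      _ = ENNReal.ofReal (1 / 4) := by simp
      _ < _ := (ENNReal.ofReal_lt_ofReal_iff (by norm_num)).2 (by norm_num)

/-! ### The two kinds of faults -/

/-- The neighbors of `v` that lose their color if `v` appears to be final with the color of the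
message `f`. -/
def victims (G : SimpleGraph V) [DecidableRel G.Adj] (σ : Config V) (v : V)
    (f : Message (Fintype.card V)) : Finset V :=
  (G.neighborFinset v).filter fun w => f.2 = true ∧ (σ w).c = f.1

theorem mem_victims {f : Message (Fintype.card V)} {w : V} :
    w ∈ victims G σ v f ↔ G.Adj v w ∧ f.2 = true ∧ (σ w).c = f.1 := by
  simp [victims]

/-- All victims have the same color in `σ`, so they are independent. -/
theorem IsLegitimate.faultRegion_victims (h : IsLegitimate G σ) (v : V)
    (f : Message (Fintype.card V)) : FaultRegion G σ v (victims G σ v f) where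
  legit := h
  adj _ hw := (mem_victims.1 hw).1
  indep _ hw _ hu hwu :=
    h.2 _ _ hwu ((mem_victims.1 hw).2.2.trans (mem_victims.1 hu).2.2.symm)

/-- Apart from `v`, only the victims redraw in the round of the fault. -/
theorem newFinal_eq_false_iff_mem_victims (h : IsLegitimate G σ) {f : Message (Fintype.card V)}
    {m : V → Message (Fintype.card V)} (hm : ∀ w, w ≠ v → m w = (σ w).broadcast) (hmv : m v = f)
    {u : V} (hu : u ≠ v) : newFinal G m u (σ u) = false ↔ u ∈ victims G σ v f := by
  obtain ⟨hfin, x, hx, hxd⟩ := h.1 u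
  rw [← not_iff_not, Bool.not_eq_false, newFinal_eq_true_iff, mem_victims]
  constructor
  · rintro ⟨y, hy, -, hw⟩ ⟨hvu, hf, hc⟩
    have := (hw v hvu.symm (by rw [hmv, ← hc, hy])).2
    rw [hmv, hf] at this
    simp at this
  · intro hno
    refine ⟨x, hx, hxd, fun w huw hwx => ⟨hfin, ?_⟩⟩
    rcases eq_or_ne w v with rfl | hwv
    · by_contra hwf
      rw [hmv] at hwx hwf
      exact hno ⟨huw.symm, by simpa using hwf, hx.trans hwx.symm⟩
    · rw [hm w hwv] at hwx
      exact absurd (hx.trans hwx.symm) (h.2 u w huw)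

/-- Recovery from a corruption of the memory of `v`. -/
theorem recovery_of_memory_fault [DecidableEq V] (h : IsLegitimate G σ) (v : V)
    (s : NodeState (Fintype.card V)) :
    (∀ᵐ ω ∂executionLaw G faultless (Function.update σ v s), ContaminatesOnly G 1 v σ ω) ∧
    (∀ᵐ ω ∂executionLaw G faultless (Function.update σ v s), hitLegitimate G 0 ω < ⊤) ∧
    ∫⁻ ω, (hitLegitimate G 0 ω : ENNReal) ∂executionLaw G faultless (Function.update σ v s) ≤
      ENNReal.ofReal ((harmonic (maxIndependentDegree G) : ℝ) / Real.log 2 + 11 / 2) ∧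
    evariance (fun ω => ((hitLegitimate G 0 ω).toNat : ℝ))
      (executionLaw G faultless (Function.update σ v s)) < ENNReal.ofReal 7.5 := by
  set τ₀ := Function.update σ v s with hτ
  have hτu : ∀ u, u ≠ v → τ₀ u = σ u := fun u hu => Function.update_of_ne hu _ _
  have hτv : τ₀ v = s := Function.update_self _ _ _
  have hd : ∀ t, 1 ≤ t → ∀ τ : Config V, faultless t τ = fun w => (τ w).broadcast :=
    fun _ _ _ => rfl
  set A := victims G σ v s.broadcast with hAdef
  have hred : ∀ u, u ≠ v → (Redraws G τ₀ u ↔ u ∈ A) := by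
    intro u hu
    rw [Redraws, hτu u hu]
    exact newFinal_eq_false_iff_mem_victims h (fun w hw => by rw [hτu w hw]) (by rw [hτv]) hu
  by_cases hv : Redraws G τ₀ v
  · have hA : FaultRegion G σ v A := h.faultRegion_victims v _
    have hvA : v ∉ A := fun hv => G.irrefl (mem_victims.1 hv).1
    have hB : redrawNbrs G τ₀ v = A := by
      ext w
      rw [redrawNbrs, Finset.mem_filter, SimpleGraph.mem_neighborFinset]
      constructor
      · rintro ⟨hvw, hw⟩
        exact (hred w hvw.ne').1 hw
      · intro hw
        have hvw := (mem_victims.1 hw).1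
        exact ⟨hvw, (hred w hvw.ne').2 hw⟩
    have hJ : confirmNbrs G τ₀ v = ∅ := by
      refine Finset.filter_eq_empty_iff.2 fun w hw hw' => ?_
      have hvw : G.Adj v w := by simpa using hw
      have := hw'.2
      rw [hτu w hvw.ne', (h.1 w).1] at this
      simp at this
    have hall : ∀ u, (u = v ∨ u ∈ A) → Redraws G τ₀ u := by
      rintro u (rfl | hu)
      · exact hv
      · exact (hred u (ne_of_mem_of_not_mem hu hvA)).2 hu
    have hcont : ∀ᵐ τ ∂roundLaw G (fun w => (τ₀ w).broadcast) τ₀, Contained G σ v A τ := by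
      refine ae_contained_of_round hA _ (fun u hu _ => by rw [hτu u hu])
        (fun u hu _ => hτu u hu) (fun u hu huA => ?_) (fun u hu hnew => ?_) (ae_consistent G τ₀)
      · have := (not_congr (hred u hu)).2 huA
        simpa [Redraws] using this
      · have : newFinal G (fun w => (τ₀ w).broadcast) u (τ₀ u) = false := hall u hu
        rw [this] at hnew
        simp at hnew
    -- The victims make at most one color tabu, all of them together, and each other neighbor of
    -- `v` makes at most one color tabu.
    have hpal : max 1 A.card ≤ (palette G (fun w => (τ₀ w).broadcast) v).card := by
      refine max_le (card_palette_pos G _ v) ?_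
      have h1 := degree_lt_card_palette_add_card (G := G) (fun w => (τ₀ w).broadcast) v
        (insert s.c ((G.neighborFinset v \ A).image fun w => (σ w).c)) fun w x hw hwx => by
          by_cases hwA : w ∈ A
          · refine Finset.mem_insert.2 (Or.inl ?_)
            have h2 := (mem_victims.1 hwA).2.2
            have h3 : (σ w).c = some x := by
              rw [← hτu w hw.ne']
              exact (Prod.ext_iff.1 hwx).1
            exact h3.symm.trans h2
          · refine Finset.mem_insert_of_mem (Finset.mem_image.2 ⟨w, ?_, ?_⟩)
            · simpa using ⟨hw, hwA⟩
            · rw [← hτu w hw.ne']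
              exact (Prod.ext_iff.1 hwx).1
      have h2 := (Finset.card_insert_le s.c
        ((G.neighborFinset v \ A).image fun w => (σ w).c)).trans
        (Nat.add_le_add_right Finset.card_image_le 1)
      have hsub : A ⊆ G.neighborFinset v := Finset.filter_subset _ _
      have h3 := Finset.card_sdiff_add_card_eq_card hsub
      rw [SimpleGraph.card_neighborFinset_eq_degree] at h3
      omega
    have hcard : (insert v A).card = A.card + 1 := Finset.card_insert_of_notMem hvA
    refine recovery_of_redraws hA hd (Or.inr ⟨rfl, fun hleg => hleg.not_redraws v hv⟩) hτu hcont
      (insert v A) (fun u hu => hall u (Finset.mem_insert.1 hu)) (Finset.insert_nonempty _ _)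
      hcard.le ?_
    rw [hcard]
    refine (integral_potential_le_of_redraws hA hB.le hv hcont (admissible_psiSequence _ _)
      (by rw [hB]) (j := 0) (by rw [hJ, Finset.card_empty]) (by positivity) hpal).trans ?_
    gcongr
    exact coinMean_psiSequence_zero_le A.card
  · have hA : ∀ u, ¬ Redraws G τ₀ u := by
      intro u hu
      have huv : u ≠ v := fun huv => hv (huv ▸ hu)
      obtain ⟨hvu, hf, hc⟩ := mem_victims.1 ((hred u huv).1 hu)
      obtain ⟨x, hx, -, hw⟩ := not_redraws_iff.1 hv
      rw [hτv] at hx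
      have := (hw u hvu (by rw [hτu u huv, hc]; exact hx)).2
      rw [hτu u huv, (h.1 u).1] at this
      simp at this
    refine recovery_of_isLegitimate hd zero_le_one hτu ?_
    change ∀ᵐ τ ∂roundLaw G (fun w => (τ₀ w).broadcast) τ₀, _
    filter_upwards [ae_isLegitimate G τ₀, ae_round G τ₀] with τ h1 h2
    refine ⟨h1 hA, fun u hu => ?_⟩
    rw [(h2 u).1 (hA u), hτu u hu]
    exact NodeState.ext rfl (h.1 u).1.symm

/-- Recovery from a corruption of a message of `v`. -/
theorem recovery_of_message_fault [DecidableEq V] (h : IsLegitimate G σ) (v : V)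
    (f : Message (Fintype.card V)) :
    (∀ᵐ ω ∂executionLaw G (corruptFirst v f) σ, ContaminatesOnly G 1 v σ ω) ∧
    (∀ᵐ ω ∂executionLaw G (corruptFirst v f) σ, hitLegitimate G 1 ω < ⊤) ∧
    ∫⁻ ω, (hitLegitimate G 1 ω : ENNReal) ∂executionLaw G (corruptFirst v f) σ ≤
      ENNReal.ofReal ((harmonic (maxIndependentDegree G) : ℝ) / Real.log 2 + 11 / 2) ∧
    evariance (fun ω => ((hitLegitimate G 1 ω).toNat : ℝ))
      (executionLaw G (corruptFirst v f) σ) < ENNReal.ofReal 7.5 := by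
  have hd : ∀ t, 1 ≤ t → ∀ τ : Config V, corruptFirst v f t τ = fun w => (τ w).broadcast := by
    intro t ht τ
    ext1 w
    rw [corruptFirst, if_neg fun h => by omega]
  set m := corruptFirst v f 0 σ with hm
  have hmu : ∀ w, w ≠ v → m w = (σ w).broadcast := by
    intro w hw
    rw [hm, corruptFirst, if_neg fun h => hw h.2]
  have hmv : m v = f := by
    rw [hm, corruptFirst, if_pos ⟨rfl, rfl⟩]
  set A := victims G σ v f with hAdef
  have hA : FaultRegion G σ v A := h.faultRegion_victims v f
  have hvA : v ∉ A := fun hv => G.irrefl (mem_victims.1 hv).1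
  have hred : ∀ u, u ≠ v → (newFinal G m u (σ u) = false ↔ u ∈ A) := fun u hu =>
    newFinal_eq_false_iff_mem_victims h hmu hmv hu
  have hv : newFinal G m v (σ v) = true := by
    obtain ⟨hfin, x, hx, hxd⟩ := h.1 v
    refine newFinal_eq_true_iff.2 ⟨x, hx, hxd, fun w hvw hwx => ?_⟩
    rw [hmu w hvw.ne'] at hwx
    exact absurd (hx.trans hwx.symm) (h.2 v w hvw)
  have hkeep : ∀ τ : Config V, (∀ u, (newFinal G m u (σ u) = true → τ u = ⟨(σ u).c, true⟩) ∧
      (newFinal G m u (σ u) = false → (τ u).final = false ∧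
        ∀ x, (τ u).c = some x → x ∈ palette G m u)) →
      ∀ u, newFinal G m u (σ u) = true → τ u = σ u := by
    intro τ hτ u hu
    rw [(hτ u).1 hu]
    exact NodeState.ext rfl (h.1 u).1.symm
  rcases A.eq_empty_or_nonempty with hempty | hne
  · refine recovery_of_isLegitimate hd le_rfl (fun _ _ => rfl) ?_
    filter_upwards [ae_roundLaw G m σ] with τ hτ
    have heq : τ = σ := by
      funext u
      refine hkeep τ hτ u ?_
      rcases eq_or_ne u v with rfl | huv
      · exact hv
      · have := (not_congr (hred u huv)).2 (by simp [hempty])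
        simpa using this
    rw [heq]
    exact ⟨h, fun _ _ => rfl⟩
  · have hcons : ∀ᵐ τ ∂roundLaw G m σ, Consistent G τ := by
      filter_upwards [ae_roundLaw G m σ] with τ hτ u hu
      have hfinal : ∀ w, (τ w).final = true → τ w = σ w := by
        intro w hw
        refine hkeep τ hτ w ?_
        by_contra hno
        have := ((hτ w).2 (by simpa using hno)).1
        rw [hw] at this
        simp at this
      obtain ⟨-, x, hx, hxd⟩ := h.1 u
      refine ⟨x, by rw [hfinal u hu, hx], hxd, fun w huw hwx => ?_⟩
      by_contra hwf
      rw [hfinal w (by simpa using hwf)] at hwx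
      exact h.2 u w huw (hx.trans hwx.symm)
    have hcont : ∀ᵐ τ ∂roundLaw G m σ, Contained G σ v A τ := by
      refine ae_contained_of_round hA m (fun u hu _ => hmu u hu) (fun _ _ _ => rfl)
        (fun u hu huA => ?_) (fun u hu hnew x hx => ?_) hcons
      · have := (not_congr (hred u hu)).2 huA
        simpa using this
      · rcases hu with rfl | hu
        · obtain ⟨-, y, hy, hyd⟩ := h.1 u
          have hxy : y = x := Option.some.inj (hy.symm.trans hx)
          subst hxy
          exact mem_freeColors.2 ⟨hyd, fun w _ _ hvw hw => h.2 u w hvw (hx.trans hw.symm)⟩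
        · rw [(hred u (ne_of_mem_of_not_mem hu hvA)).2 hu] at hnew
          simp at hnew
    refine recovery_of_redraws hA hd (Or.inl rfl) (fun _ _ => rfl) hcont A
      (fun u hu => (hred u (ne_of_mem_of_not_mem hu hvA)).2 hu) hne (Nat.le_succ _) ?_
    -- As `v` stays final, the potential after the round is a number of redrawing neighbors.
    have hle : ∀ᵐ τ ∂roundLaw G m σ, potential G σ v A (psiSequence A.card 0) τ ≤ A.card := by
      filter_upwards [hcont, ae_roundLaw G m σ] with τ h1 h2
      have hfin : (τ v).final = true := by
        rw [(h2 v).1 hv]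
      rw [potential, if_pos hfin]
      exact_mod_cast Finset.card_le_card (h1.redrawNbrs_subset hA)
    refine (integral_roundLaw_mono G m σ hle).trans ?_
    have := two_mul_le_tailConstant (Finset.card_pos.2 hne)
    rw [integral_const, probReal_univ, one_smul]
    linarith

end

end

theorem theorem2 :
    -- messages and the state of a node have `O(log n)` bits
    (∃ C : ℝ, ∀ n : ℕ, 2 ≤ n → ∃ b : ℕ, (b : ℝ) ≤ C * Real.log n ∧
      FitsInBits (Message n) b ∧ FitsInBits (NodeState n) b) ∧
    -- legitimate configurations are `(Δ + 1)`-colorings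
    (∀ (V : Type u) [Fintype V] (G : SimpleGraph V) [DecidableRel G.Adj]
      (σ : Config V), IsLegitimate G σ →
      ∃ χ : G.Coloring (Fin (G.maxDegree + 1)), ∀ v,
        (σ v).c.map Fin.val = some (χ v : ℕ)) ∧
    -- closure
    (∀ (V : Type u) [Fintype V] (G : SimpleGraph V) [DecidableRel G.Adj]
      (σ : Config V), IsLegitimate G σ →
      ∀ᵐ ω ∂executionLaw G faultless σ, ∀ t, ω t = σ) ∧
    -- convergence from every configuration, almost surely
    (∀ (V : Type u) [Fintype V] (G : SimpleGraph V) [DecidableRel G.Adj]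
      (σ : Config V),
      ∀ᵐ ω ∂executionLaw G faultless σ, ∃ T, ∀ t, T ≤ t → IsLegitimate G (ω t)) ∧
    -- convergence within `O(log n)` rounds, with high probability
    (∀ c : ℝ, 1 ≤ c → ∃ C : ℝ,
      ∀ (V : Type u) [Fintype V] (G : SimpleGraph V) [DecidableRel G.Adj]
        (σ : Config V),
      ENNReal.ofReal (1 - 1 / (Fintype.card V : ℝ) ^ c) ≤
        executionLaw G faultless σ
          {ω | ∀ t : ℕ, C * Real.log (Fintype.card V) ≤ t → IsLegitimate G (ω t)}) ∧
    -- recovery from the corruption of the memory of one node `v`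
    (∀ (V : Type u) [Fintype V] [DecidableEq V] (G : SimpleGraph V) [DecidableRel G.Adj]
      (σ : Config V), IsLegitimate G σ →
      ∀ (v : V) (s : NodeState (Fintype.card V)), s ≠ σ v →
      let P := executionLaw G faultless (Function.update σ v s)
      (∀ᵐ ω ∂P, ContaminatesOnly G 1 v σ ω) ∧
      (∀ᵐ ω ∂P, hitLegitimate G 0 ω < ⊤) ∧
      ∫⁻ ω, (hitLegitimate G 0 ω : ENNReal) ∂P ≤
        ENNReal.ofReal ((harmonic (maxIndependentDegree G) : ℝ) / Real.log 2 + 11 / 2) ∧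
      evariance (fun ω => ((hitLegitimate G 0 ω).toNat : ℝ)) P < ENNReal.ofReal 7.5) ∧
    -- recovery from the corruption of one message broadcast by a node `v`
    (∀ (V : Type u) [Fintype V] [DecidableEq V] (G : SimpleGraph V) [DecidableRel G.Adj]
      (σ : Config V), IsLegitimate G σ →
      ∀ (v : V) (f : Message (Fintype.card V)), f ≠ (σ v).broadcast →
      let P := executionLaw G (corruptFirst v f) σ
      (∀ᵐ ω ∂P, ContaminatesOnly G 1 v σ ω) ∧
      (∀ᵐ ω ∂P, hitLegitimate G 1 ω < ⊤) ∧
      ∫⁻ ω, (hitLegitimate G 1 ω : ENNReal) ∂P ≤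
        ENNReal.ofReal ((harmonic (maxIndependentDegree G) : ℝ) / Real.log 2 + 11 / 2) ∧
      evariance (fun ω => ((hitLegitimate G 1 ω).toNat : ℝ)) P < ENNReal.ofReal 7.5) := by
  refine ⟨⟨4 / Real.log 2, fun n hn => ⟨Nat.size n + 2, size_add_two_le n hn, fitsInBits_message n,
      (fitsInBits_message n).nodeState⟩⟩, fun V _ G _ σ h => h.exists_coloring G,
    fun V _ G _ σ h => h.ae_forall_eq, fun V _ G _ σ => ae_eventually_isLegitimate G σ,
    fun c hc => ⟨16 * (c + 1) + 4 / Real.log 2, fun V _ G _ σ =>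
      isLegitimate_with_high_probability G c hc σ⟩,
    fun V _ _ G _ σ h v s _ => recovery_of_memory_fault h v s,
    fun V _ _ G _ σ h v f _ => recovery_of_message_fault h v f⟩
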